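/- Lemma (Regularizing forms). Let $k$ be a perfect field of characteristic $p > 0$ and let $X$ be a smooth projective variety over $k$ (an integral scheme, smooth over $k$ and admitting a closed immersion over $k$ into some $\mathbb{P}^N_k$). Let $M$ be a line bundle on $X$, let $q \ge 1$, let $U \subset X$ be a dense open subset, and let $\alpha \in H^0(U, \Omega_U^q \otimes M|_U)$ be a nonzero twisted differential $q$-form on $U$, where $\Omega_U^q = \bigwedge^q \Omega_{U/k}$ is the sheaf of Kähler differentials. Then there exists a finite, dominant and separable morphism $f \colon Y \to X$ from a normal integral scheme $Y$ (separable meaning that the extension of function fields $k(Y)/k(X)$ is separable) such that $f^*\alpha \in H^0(f^{-1}(U), \Omega_Y^q \otimes f^*M)$ is nonzero and extends to a regular twisted form on all of $Y$: there is $\beta \in H^0(Y, \Omega_Y^q \otimes f^*M)$ with $\beta|_{f^{-1}(U)} = f^*\alpha \neq 0$. Here $\Omega_Y^q = \bigwedge^q \Omega_{Y/k}$ denotes the sheaf of Kähler differentials. -/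

import Mathlib

open CategoryTheory AlgebraicGeometry TopologicalSpace TensorProduct

universe u

noncomputable section

/-! ### Twisted differential forms over a ring -/

section Algebraic

variable (k : Type*) [CommRing k]

/-- The `A`-module `⋀^q Ω_{A/k} ⊗ P` of differential `q`-forms of `A` over `k` with values
in the `A`-module `P`. -/
abbrev AlgTwistedForms (A : Type*) [CommRing A] [Algebra k A] (P : Type*) [AddCommGroup P]
    [Module A P] (q : ℕ) : Type _ :=
  (⋀[A]^q (Ω[A⁄k])) ⊗[A] P

section Tower

variable (A B : Type*) [CommRing A] [CommRing B] [Algebra k A] [Algebra k B] [Algebra A B]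
  [IsScalarTower k A B]

/-- The alternating map `(ω₁, …, ω_q) ↦ φ ω₁ ∧ ⋯ ∧ φ ω_q`, where `φ : Ω_{A/k} → Ω_{B/k}` is the
canonical map `da ↦ da`. -/
def kaehlerAlternatingMap (q : ℕ) : (Ω[A⁄k]) [⋀^Fin q]→ₗ[A] (⋀[B]^q (Ω[B⁄k])) where
  toFun v := exteriorPower.ιMulti B q (fun i => KaehlerDifferential.map k k A B (v i))
  map_update_add' v i x y := by
    have h : ∀ z, (fun j => KaehlerDifferential.map k k A B (Function.update v i z j)) =
        Function.update (fun j => KaehlerDifferential.map k k A B (v j)) i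
          (KaehlerDifferential.map k k A B z) := by
      intro z; ext j; by_cases hj : j = i
      · subst hj; simp
      · simp [hj]
    simp only [h, map_add, AlternatingMap.map_update_add]
  map_update_smul' v i c x := by
    have h : ∀ z, (fun j => KaehlerDifferential.map k k A B (Function.update v i z j)) =
        Function.update (fun j => KaehlerDifferential.map k k A B (v j)) i
          (KaehlerDifferential.map k k A B z) := by
      intro z; ext j; by_cases hj : j = i
      · subst hj; simp
      · simp [hj]
    rw [h, h, map_smul, ← algebraMap_smul B c (KaehlerDifferential.map k k A B x),
      AlternatingMap.map_update_smul, algebraMap_smul]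
  map_eq_zero_of_eq' v i j hij hne :=
    AlternatingMap.map_eq_zero_of_eq _ _ (by simp only [hij]) hne

/-- The canonical map `⋀^q Ω_{A/k} → ⋀^q Ω_{B/k}`. -/
def kaehlerExteriorMap (q : ℕ) : (⋀[A]^q (Ω[A⁄k])) →ₗ[A] (⋀[B]^q (Ω[B⁄k])) :=
  exteriorPower.alternatingMapLinearEquiv (kaehlerAlternatingMap k A B q)

/-- For an `A`-linear map `m : P → Q` into a `B`-module, the canonical map
`⋀^q Ω_{A/k} ⊗_A P → ⋀^q Ω_{B/k} ⊗_B Q`. -/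
def algTwistedFormsMap {P Q : Type*} [AddCommGroup P] [Module A P] [AddCommGroup Q] [Module A Q]
    [Module B Q] [IsScalarTower A B Q] (m : P →ₗ[A] Q) (q : ℕ) :
    AlgTwistedForms k A P q →ₗ[A] AlgTwistedForms k B Q q :=
  (TensorProduct.mapOfCompatibleSMul B A A (⋀[B]^q (Ω[B⁄k])) Q).comp
    (TensorProduct.map (kaehlerExteriorMap k A B q) m)

lemma algTwistedFormsMap_apply {P Q : Type*} [AddCommGroup P] [Module A P] [AddCommGroup Q]
    [Module A Q] [Module B Q] [IsScalarTower A B Q] (m : P →ₗ[A] Q) (q : ℕ) (a : Fin q → A)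
    (x : P) :
    algTwistedFormsMap k A B m q
        (exteriorPower.ιMulti A q (fun i => KaehlerDifferential.D k A (a i)) ⊗ₜ x) =
      exteriorPower.ιMulti B q (fun i => KaehlerDifferential.D k B (algebraMap A B (a i))) ⊗ₜ
        m x := by
  simp [algTwistedFormsMap, kaehlerExteriorMap, kaehlerAlternatingMap]

end Tower

variable {k}

/-- The map `⋀^q Ω_{A/k} ⊗_A P → ⋀^q Ω_{B/k} ⊗_B Q`,
`da₁ ∧ ⋯ ∧ da_q ⊗ x ↦ dφ(a₁) ∧ ⋯ ∧ dφ(a_q) ⊗ m x`, induced by a homomorphism `φ : A → B` of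
`k`-algebras and a `φ`-semilinear map `m : P → Q`. -/
def semilinearFormsMap {A B : Type*} [CommRing A] [CommRing B] [Algebra k A] [Algebra k B]
    {P Q : Type*} [AddCommGroup P] [Module A P] [AddCommGroup Q] [Module B Q]
    (φ : A →ₐ[k] B) (m : P →ₛₗ[φ.toRingHom] Q) (q : ℕ) :
    AlgTwistedForms k A P q →+ AlgTwistedForms k B Q q :=
  letI : Algebra A B := φ.toRingHom.toAlgebra
  letI : Module A Q := Module.compHom Q φ.toRingHom
  haveI : IsScalarTower k A B := IsScalarTower.of_algebraMap_eq (fun r => (φ.commutes r).symm)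
  haveI : IsScalarTower A B Q := IsScalarTower.of_algebraMap_smul (fun _ _ => rfl)
  let m' : P →ₗ[A] Q := { toFun := m, map_add' := m.map_add, map_smul' := m.map_smulₛₗ }
  (algTwistedFormsMap k A B m' q).toAddMonoidHom

lemma semilinearFormsMap_apply {A B : Type*} [CommRing A] [CommRing B] [Algebra k A]
    [Algebra k B] {P Q : Type*} [AddCommGroup P] [Module A P] [AddCommGroup Q] [Module B Q]
    (φ : A →ₐ[k] B) (m : P →ₛₗ[φ.toRingHom] Q) (q : ℕ) (a : Fin q → A) (x : P) :
    semilinearFormsMap φ m q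
        (exteriorPower.ιMulti A q (fun i => KaehlerDifferential.D k A (a i)) ⊗ₜ x) =
      exteriorPower.ιMulti B q (fun i => KaehlerDifferential.D k B (φ (a i))) ⊗ₜ m x := by
  let : Algebra A B := φ.toRingHom.toAlgebra
  let : Module A Q := Module.compHom Q φ.toRingHom
  have : IsScalarTower k A B := IsScalarTower.of_algebraMap_eq (fun r => (φ.commutes r).symm)
  have : IsScalarTower A B Q := IsScalarTower.of_algebraMap_smul (fun _ _ => rfl)
  exact algTwistedFormsMap_apply k A B
    ({ toFun := m, map_add' := m.map_add, map_smul' := m.map_smulₛₗ } : P →ₗ[A] Q) q a x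

end Algebraic

/-! ### Twisted differential forms on a scheme over a field -/

section Scheme

variable {k : Type u} [Field k]

/-- The ring `Γ(X, V)`, remembering the structure morphism `p : X ⟶ Spec k`, so that it is
a `k`-algebra. -/
def SecRing {X : Scheme.{u}} (_p : X ⟶ Spec (.of k)) (V : X.Opens) : Type u := Γ(X, V)

variable {X Y : Scheme.{u}} (p : X ⟶ Spec (.of k))

instance (V : X.Opens) : CommRing (SecRing p V) := inferInstanceAs (CommRing Γ(X, V))

/-- The homomorphism `k → Γ(X, V)` given by the structure morphism. -/
def secRingScalar (V : X.Opens) : CommRingCat.of k ⟶ Γ(X, V) :=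
  (Scheme.ΓSpecIso (.of k)).inv ≫ p.appTop ≫ X.presheaf.map (homOfLE le_top).op

instance (V : X.Opens) : Algebra k (SecRing p V) :=
  RingHom.toAlgebra (S := SecRing p V) (secRingScalar p V).hom

lemma secRingScalar_comp_appLE (f : Y ⟶ X) (V : X.Opens) (W : Y.Opens) (h : W ≤ f ⁻¹ᵁ V) :
    secRingScalar p V ≫ f.appLE V W h = secRingScalar (f ≫ p) W := by
  simp only [secRingScalar, Category.assoc, Scheme.Hom.map_appLE, Scheme.Hom.comp_appTop]
  rfl

lemma secRingScalar_comp_map (V V' : X.Opens) (h : V' ≤ V) :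
    secRingScalar p V ≫ X.presheaf.map (homOfLE h).op = secRingScalar p V' := by
  simp only [secRingScalar, Category.assoc, ← Functor.map_comp]
  rfl

instance (M : X.Modules) (V : X.Opens) : Module (SecRing p V) Γ(M, V) :=
  inferInstanceAs (Module Γ(X, V) Γ(M, V))

/-- The homomorphism of `k`-algebras `Γ(X, V) → Γ(Y, W)` induced by `f : Y ⟶ X` when
`W ⊆ f⁻¹ V`. -/
def secRingMap (f : Y ⟶ X) (V : X.Opens) (W : Y.Opens) (h : W ≤ f ⁻¹ᵁ V) :
    SecRing p V →ₐ[k] SecRing (f ≫ p) W where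
  toRingHom := (f.appLE V W h).hom
  commutes' r := ConcreteCategory.congr_hom (secRingScalar_comp_appLE p f V W h) r

/-- The restriction homomorphism of `k`-algebras `Γ(X, V) → Γ(X, V')` for `V' ⊆ V`. -/
def secRingRes (V V' : X.Opens) (h : V' ≤ V) : SecRing p V →ₐ[k] SecRing p V' where
  toRingHom := (X.presheaf.map (homOfLE h).op).hom
  commutes' r := ConcreteCategory.congr_hom (secRingScalar_comp_map p V V' h) r

/-- Restriction of sections of `M` from `V` to `V' ⊆ V`, as a semilinear map. -/
def moduleRes (M : X.Modules) (V V' : X.Opens) (h : V' ≤ V) :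
    Γ(M, V) →ₛₗ[(secRingRes p V V' h).toRingHom] Γ(M, V') where
  toFun := M.presheaf.map (homOfLE h).op
  map_add' := map_add _
  map_smul' r x := M.map_smul (homOfLE h) r x

/-- The canonical pullback of sections `Γ(M, V) → Γ(f^*M, W)` for `W ⊆ f⁻¹ V`, as a semilinear
map. -/
def modulePullback (f : Y ⟶ X) (M : X.Modules) (V : X.Opens) (W : Y.Opens) (h : W ≤ f ⁻¹ᵁ V) :
    Γ(M, V) →ₛₗ[(secRingMap p f V W h).toRingHom] Γ((Scheme.Modules.pullback f).obj M, W) where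
  toFun x := ((Scheme.Modules.pullback f).obj M).presheaf.map (homOfLE h).op
    (((Scheme.Modules.pullbackPushforwardAdjunction f).unit.app M).app V x)
  map_add' x y := (congrArg _ (map_add _ x y)).trans (map_add _ _ _)
  map_smul' r x := by
    refine (congrArg _ (Scheme.Modules.Hom.app_smul
      ((Scheme.Modules.pullbackPushforwardAdjunction f).unit.app M) r x)).trans ?_
    exact ((Scheme.Modules.pullback f).obj M).map_smul (homOfLE h) (f.app V r) _

/-- The module `⋀^q Ω_{Γ(X,V)/k} ⊗ Γ(M, V)`. For `V` affine and `M` quasi-coherent, these are the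
sections over `V` of the sheaf `Ω_X^q ⊗ M`. -/
def FormsOn (M : X.Modules) (q : ℕ) (V : X.Opens) : Type u :=
  AlgTwistedForms k (SecRing p V) Γ(M, V) q

instance (M : X.Modules) (q : ℕ) (V : X.Opens) : AddCommGroup (FormsOn p M q V) :=
  inferInstanceAs (AddCommGroup (AlgTwistedForms k (SecRing p V) Γ(M, V) q))

instance (M : X.Modules) (q : ℕ) (V : X.Opens) : Module (SecRing p V) (FormsOn p M q V) :=
  inferInstanceAs (Module (SecRing p V) (AlgTwistedForms k (SecRing p V) Γ(M, V) q))

/-- Restriction of forms from `V` to `V' ⊆ V`. -/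
def formsRes (M : X.Modules) (q : ℕ) (V V' : X.Opens) (h : V' ≤ V) :
    FormsOn p M q V →+ FormsOn p M q V' :=
  semilinearFormsMap (secRingRes p V V' h) (moduleRes p M V V' h) q

/-- Pullback of forms along `f : Y ⟶ X`, from `V ⊆ X` to `W ⊆ f⁻¹ V`. -/
def formsPullback (f : Y ⟶ X) (M : X.Modules) (q : ℕ) (V : X.Opens) (W : Y.Opens)
    (h : W ≤ f ⁻¹ᵁ V) :
    FormsOn p M q V →+ FormsOn (f ≫ p) ((Scheme.Modules.pullback f).obj M) q W :=
  semilinearFormsMap (secRingMap p f V W h) (modulePullback p f M V W h) q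

/-- The affine open subsets of `U`. -/
abbrev AffineOpensIn (U : X.Opens) : Type u := {V : X.Opens // IsAffineOpen V ∧ V ≤ U}

/-- The group `H⁰(U, Ω_X^q ⊗ M)` of twisted differential `q`-forms on the open subset `U`, for
`M` quasi-coherent: as a section of a quasi-coherent sheaf is the same as a compatible family of
sections over the affine open subsets of `U`, it is the group of families of elements
`ω V ∈ ⋀^q Ω_{Γ(X,V)/k} ⊗ Γ(M, V)`, one for each affine open `V ⊆ U`, that are compatible with
restriction. -/
def TwistedForms (M : X.Modules) (q : ℕ) (U : X.Opens) :
    AddSubgroup (∀ V : AffineOpensIn U, FormsOn p M q V.1) where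
  carrier := {ω | ∀ (V V' : AffineOpensIn U) (h : V'.1 ≤ V.1),
    formsRes p M q V.1 V'.1 h (ω V) = ω V'}
  zero_mem' _ _ _ := map_zero _
  add_mem' ha hb V V' h := (map_add _ _ _).trans (congrArg₂ (· + ·) (ha V V' h) (hb V V' h))
  neg_mem' ha V V' h := (map_neg _ _).trans (congrArg Neg.neg (ha V V' h))

/-- Restriction of twisted forms to a smaller open subset. -/
def restrictForms {p : X ⟶ Spec (.of k)} {M : X.Modules} {q : ℕ} {U : X.Opens}
    (ω : TwistedForms p M q U) (U' : X.Opens) (h : U' ≤ U) : TwistedForms p M q U' :=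
  ⟨fun V => ω.1 ⟨V.1, V.2.1, V.2.2.trans h⟩,
    fun V V' h' => ω.2 ⟨V.1, V.2.1, V.2.2.trans h⟩ ⟨V'.1, V'.2.1, V'.2.2.trans h⟩ h'⟩

/-- The twisted form `γ` on `f⁻¹ U` is the pullback `f^*α` of the twisted form `α` on `U`: for all
affine opens `V ⊆ U` and `W ⊆ f⁻¹ V`, the component of `γ` on `W` is the pullback of the component
of `α` on `V`. As these `W` cover `f⁻¹ U`, this determines `γ`. -/
def IsPullbackForm (f : Y ⟶ X) {M : X.Modules} {q : ℕ} {U : X.Opens} (α : TwistedForms p M q U)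
    (γ : TwistedForms (f ≫ p) ((Scheme.Modules.pullback f).obj M) q (f ⁻¹ᵁ U)) : Prop :=
  ∀ (V : AffineOpensIn U) (W : AffineOpensIn (f ⁻¹ᵁ U)) (h : W.1 ≤ f ⁻¹ᵁ V.1),
    γ.1 W = formsPullback p f M q V.1 W.1 h (α.1 V)

end Scheme

/-! ### Geometric notions -/

section Geometry

/-- Line bundles: `𝒪_X`-modules that are locally isomorphic to `𝒪_X`. -/
def IsLineBundle {X : Scheme.{u}} (M : X.Modules) : Prop :=
  ∀ x : X, ∃ V : X.Opens, x ∈ V ∧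
    Nonempty (M.restrict V.ι ≅ (SheafOfModules.unit (V : Scheme.{u}).ringCatSheaf :
      (V : Scheme.{u}).Modules))

attribute [local instance] MvPolynomial.gradedAlgebra

/-- Projective space `ℙⁿ_k = Proj k[x₀, …, x_n]`. -/
abbrev ProjSpace (k : Type u) [Field k] (n : ℕ) : Scheme.{u} :=
  Proj (MvPolynomial.homogeneousSubmodule (Fin (n + 1)) k)

/-- The structure morphism `ℙⁿ_k ⟶ Spec k`. -/
def ProjSpace.toSpec (k : Type u) [Field k] (n : ℕ) : ProjSpace k n ⟶ Spec (.of k) :=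
  Proj.toSpecZero (MvPolynomial.homogeneousSubmodule (Fin (n + 1)) k) ≫
    Spec.map (CommRingCat.ofHom
      (algebraMap k (MvPolynomial.homogeneousSubmodule (Fin (n + 1)) k 0)))

/-- `X` is projective over `k`: it admits a closed immersion over `k` into some `ℙⁿ_k`. -/
def IsProjectiveOver {k : Type u} [Field k] {X : Scheme.{u}} (p : X ⟶ Spec (.of k)) : Prop :=
  ∃ (n : ℕ) (i : X ⟶ ProjSpace k n), IsClosedImmersion i ∧ i ≫ ProjSpace.toSpec k n = p

/-- A scheme is normal if all its local rings are integrally closed domains. -/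
def IsNormalScheme (Y : Scheme.{u}) : Prop :=
  ∀ y : Y, IsDomain (Y.presheaf.stalk y) ∧ IsIntegrallyClosed (Y.presheaf.stalk y)

lemma map_genericPoint_of_isDominant {X Y : Scheme.{u}} [IsIntegral X] [IsIntegral Y] (f : Y ⟶ X)
    [IsDominant f] : f (genericPoint Y) = genericPoint X := by
  have h := (genericPoint_spec Y).image f.continuous
  rw [Set.image_univ, f.denseRange.closure_range] at h
  exact h.eq (genericPoint_spec X)

/-- The homomorphism of function fields `k(X) → k(Y)` induced by a dominant morphism `f : Y ⟶ X`
of integral schemes. -/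
def functionFieldMap {X Y : Scheme.{u}} [IsIntegral X] [IsIntegral Y] (f : Y ⟶ X)
    [IsDominant f] : X.functionField →+* Y.functionField :=
  (X.presheaf.stalkSpecializes (specializes_of_eq (map_genericPoint_of_isDominant f)) ≫
    f.stalkMap (genericPoint Y)).hom

/-- A finite dominant morphism of integral schemes is separable if the extension of function
fields `k(Y)/k(X)` is separable. -/
def IsSeparableMap {X Y : Scheme.{u}} [IsIntegral X] [IsIntegral Y] (f : Y ⟶ X)
    [IsDominant f] : Prop :=
  letI := (functionFieldMap f).toAlgebra
  Algebra.IsSeparable X.functionField Y.functionField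

end Geometry

end

/-!
Let `ℓ` be the characteristic of `k`.

*Cancelling poles.* By projectivity, `U` contains the complement `D` of a divisor with local
equations `t j` on a finite affine cover `V j` (`IsProjectiveOver.exists_divisor`), and some power
`t j ^ r` times `α` extends to `V j`. Choose `m ≥ r`, put `s j = t j ^ m`, and let `z j i` be
finitely many generators of the algebra `Γ(X, V j)`. The polynomials `T ^ ℓ - s j ^ ℓ * T - z j i`
are separable, because their derivative is `-s j ^ ℓ`. Let `L` be the extension of `k(X)` generated
by roots `w j i` of them, and `f : Y ⟶ X` the normalization of `X` in `L`
(`exists_finite_separable_cover`). On `Y`, differentiating the equation of `w j i` gives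
`dz = -s ^ ℓ dw`. So the differential of every function on `V j` becomes divisible by `s j`, and
every `q`-form on `V j` becomes divisible by `s j ^ q`, with a quotient in the span of the wedge
products of the `dw j i` (`exists_semilinearFormsMap_eq_smul`). As `q ≥ 1`, this cancels the poles
of `α`: over each `V j`, the form `f^*α` extends (`RootChart.exists_mem_forms_formsRes_eq`).

*Gluing.* The extensions over the `V j` agree over `D`, but as `Y` may be singular and Kähler forms
on it may have torsion, this does not make them equal. They are equal because they lie in a
torsion-free submodule: that spanned by wedge products of the `dw j i`
(`eq_zero_of_smul_eq_zero_of_mem_range_map`). Let `A` be a small localization of `Γ(X, V j)`, with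
`Ω_A` free of rank `n`, and `B` the ring of functions on its preimage. Where `s` is invertible, the
`dw` are in the span of `Ω_A`, whose basis stays independent over `k(Y)`. Near the zeros of `s`,
they are generated by `n` elements, which must then be independent too: since `k` is perfect, every
`a` in `A` can be written as `x ^ ℓ - s ^ ℓ * c` with `x`, `c` in `B`; since `B` is normal, `dc`
depends only on `a`; and `a ↦ dc` is, modulo `s`, a derivation of `A`, with `dz ↦ dw`
(`exists_rootDerivation`). So it factors over `Ω_A`, and `n` elements generate the `dw` modulo `s`,
to which Nakayama's lemma applies (`exists_smul_mem_span_of_roots`). For two members of the cover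
the `t j` differ by units, so all the roots can be treated together (`RootChart.eq_of_mem_forms`).
Twisted forms being a sheaf (`exists_twistedForms_of_cover`), the extensions glue to a form `β` on
`Y`, and the same comparison shows that it restricts to `f^*α` on all of the preimage of `U`, not
only over `D` (`exists_isPullbackForm`).

*Nonvanishing.* As `f` is separable, `Ω_X ⊗ k(Y) = Ω_{k(Y)}`; as `Ω_X` is locally free, pullback of
forms is injective (`formsPullback_injective`, `IsPullbackForm.ne_zero`).
-/

noncomputable section

/-! ### Exterior powers and localization -/

section ExteriorLocalization

variable {R : Type*} [CommRing R] (S : Submonoid R) (R' : Type*) [CommRing R'] [Algebra R R']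
  {M M' : Type*} [AddCommGroup M] [Module R M] [AddCommGroup M'] [Module R M']

/-- The value of the extension of `ιMulti` at a vector `v` over the localization does not depend on
how its entries are written as fractions: if `s i • v i = f (m i)` and `s' i • v i = f (m' i)`, then
`(ιMulti m) / ∏ s i` and `(ιMulti m') / ∏ s' i` are the same element of `R' ⊗ ⋀^q M`. -/
lemma exteriorPower.clearDenom_eq [IsLocalization S R'] (f : M →ₗ[R] M') [IsLocalizedModule S f]
    {q : ℕ} {v : Fin q → M'} {m m' : Fin q → M} {s s' : Fin q → S}
    (h : ∀ i, s i • v i = f (m i)) (h' : ∀ i, s' i • v i = f (m' i)) :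
    (∏ i, s' i) • ((1 : R') ⊗ₜ[R] ιMulti R q m) = (∏ i, s i) • ((1 : R') ⊗ₜ[R] ιMulti R q m') := by
  have key : ∀ i, ∃ c : S, c • (s' i • m i) = c • (s i • m' i) := fun i => by
    refine IsLocalizedModule.exists_of_eq (S := S) (f := f) ?_
    simp only [Submonoid.smul_def, map_smul] at *
    rw [← h, ← h', smul_comm]
  choose c hc using key
  have hu : IsUnit (algebraMap R R' (∏ i, c i : S)) := IsLocalization.map_units R' _
  have e : (∏ i, c i) • (∏ i, s' i) • ιMulti R q m = (∏ i, c i) • (∏ i, s i) • ιMulti R q m' := by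
    simp only [Submonoid.smul_def, Submonoid.coe_finsetProd, ← MultilinearMap.map_smul_univ,
      ← AlternatingMap.coe_multilinearMap]
    congr 1
    funext i
    simpa only [Submonoid.smul_def] using hc i
  have e2 : algebraMap R R' (∏ i, c i : S) •
        ((∏ i, s' i) • ((1 : R') ⊗ₜ[R] ιMulti R q m)) = algebraMap R R' (∏ i, c i : S) •
      ((∏ i, s i) • ((1 : R') ⊗ₜ[R] ιMulti R q m')) := by
    simp only [algebraMap_smul, Submonoid.smul_def, ← TensorProduct.tmul_smul] at e ⊢
    rw [e]
  exact (hu.smul_left_cancel).1 e2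

/-- The map `ιMulti : M^q → ⋀^q M` extends to an alternating map on the localization `M'` of `M`,
with values in the localization of `⋀^q M`. -/
lemma exteriorPower.exists_extend_ιMulti [IsLocalization S R'] [Module R' M']
    [IsScalarTower R R' M'] (f : M →ₗ[R] M') [IsLocalizedModule S f] (q : ℕ) :
    ∃ Ψ : M' [⋀^Fin q]→ₗ[R'] (R' ⊗[R] ⋀[R]^q M),
      ∀ m : Fin q → M, Ψ (fun i => f (m i)) = (1 : R') ⊗ₜ[R] ιMulti R q m := by
  classical
  have hs : ∀ v : Fin q → M', ∃ x : R' ⊗[R] ⋀[R]^q M, ∀ (m : Fin q → M) (s : Fin q → S),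
      (∀ i, s i • v i = f (m i)) → (∏ i, s i) • x = (1 : R') ⊗ₜ[R] ιMulti R q m := by
    intro v
    choose m hm using fun i => IsLocalizedModule.surj S f (v i)
    let s : Fin q → S := fun i => (m i).2
    have hu : IsUnit (algebraMap R R' (∏ i, s i : S)) := IsLocalization.map_units R' _
    obtain ⟨u, hu⟩ := hu
    refine ⟨(↑u⁻¹ : R') • ((1 : R') ⊗ₜ[R] ιMulti R q fun i => (m i).1), fun m' s' h' => ?_⟩
    have := clearDenom_eq S R' f hm h'
    simp only [Submonoid.smul_def] at this ⊢
    rw [smul_comm, this, ← algebraMap_smul R' (∏ i, (m i).2 : S).1, ← hu, smul_smul, Units.inv_mul,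
      one_smul]
  -- `Ψ v` is determined by its multiples by denominators of `v`; additivity, homogeneity and the
  -- alternating property are checked after clearing denominators
  choose Ψ hΨ using hs
  have hinj : ∀ (s : S) (x y : R' ⊗[R] ⋀[R]^q M), s • x = s • y → x = y := fun s x y h => by
    have hu : IsUnit (algebraMap R R' s) := IsLocalization.map_units R' _
    refine hu.smul_left_cancel.1 ?_
    simpa only [algebraMap_smul, Submonoid.smul_def] using h
  have hupd : ∀ (v : Fin q → M') (i : Fin q) (x : M') (s : Fin q → S) (m : Fin q → M) (t : S)
      (n : M), (∀ i, s i • v i = f (m i)) → t • x = f n →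
      ∀ j, Function.update s i t j • Function.update v i x j = f (Function.update m i n j) := by
    intro v i x s m t n h h' j
    by_cases hj : j = i
    · subst hj; simpa using h'
    · simpa [hj] using h j
  choose σ hσ using IsLocalizedModule.surj S f
  refine ⟨{ toFun := Ψ, map_update_add' := ?_, map_update_smul' := ?_, map_eq_zero_of_eq' := ?_ },
    fun m => by simpa using! hΨ (fun i => f (m i)) m 1 (fun i => one_smul _ _)⟩
  · intro d v i x y
    obtain rfl : d = instDecidableEqFin q := Subsingleton.elim _ _
    choose m hm using fun i => IsLocalizedModule.surj S f (v i)
    obtain ⟨⟨nx, sx⟩, hx⟩ := IsLocalizedModule.surj S f x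
    obtain ⟨⟨ny, sy⟩, hy⟩ := IsLocalizedModule.surj S f y
    have hx' : (sx * sy) • x = f (sy • nx) := by
      simp only [Submonoid.smul_def, map_smul, mul_comm sx, mul_smul] at hx ⊢
      rw [hx]
    have hy' : (sx * sy) • y = f (sx • ny) := by
      simp only [Submonoid.smul_def, map_smul, mul_smul] at hy ⊢
      rw [hy]
    have hxy : (sx * sy) • (x + y) = f (sy • nx + sx • ny) := by
      rw [smul_add, hx', hy', map_add]
    have e1 := hΨ _ _ _ (hupd v i x _ _ _ _ hm hx')
    have e2 := hΨ _ _ _ (hupd v i y _ _ _ _ hm hy')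
    have e3 := hΨ _ _ _ (hupd v i _ _ _ _ _ hm hxy)
    refine hinj _ _ _ (e3.trans ?_)
    rw [smul_add, e1, e2, AlternatingMap.map_update_add, TensorProduct.tmul_add]
  · intro d v i c x
    obtain rfl : d = instDecidableEqFin q := Subsingleton.elim _ _
    choose m hm using fun i => IsLocalizedModule.surj S f (v i)
    obtain ⟨⟨nx, sx⟩, hx⟩ := IsLocalizedModule.surj S f x
    obtain ⟨⟨a, t⟩, hc⟩ := IsLocalization.surj S c
    have hx' : (t * sx) • x = f (t • nx) := by
      simp only [Submonoid.smul_def, map_smul, mul_smul] at hx ⊢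
      rw [hx]
    have hcx : (t * sx) • (c • x) = f (a • nx) := by
      simp only [Submonoid.smul_def, map_smul, mul_smul] at hx hc ⊢
      rw [smul_comm sx.1 c, hx, ← algebraMap_smul R' t.1, smul_smul, mul_comm, hc, algebraMap_smul]
    have e1 := hΨ _ _ _ (hupd v i x _ _ _ _ hm hx)
    have e2 := hΨ _ _ _ (hupd v i x _ _ _ _ hm hx')
    have e3 := hΨ _ _ _ (hupd v i _ _ _ _ _ hm hcx)
    refine hinj _ _ _ (e3.trans ?_)
    rw [smul_comm, e2]
    simp only [Submonoid.smul_def] at *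
    rw [AlternatingMap.map_update_smul, AlternatingMap.map_update_smul, TensorProduct.tmul_smul,
      TensorProduct.tmul_smul, ← algebraMap_smul R' t.1, smul_smul, hc, algebraMap_smul]
  · intro v i j hij hne
    refine hinj (∏ i, (σ (v i)).2) _ _ ?_
    rw [hΨ v (fun i => (σ (v i)).1) _
      (fun i => hσ (v i)), smul_zero,
      AlternatingMap.map_eq_zero_of_eq _ _ (by rw [hij]) hne, TensorProduct.tmul_zero]

/-- Exterior powers commute with localization: the extension of `ιMulti` to the localization of `M`
gives an inverse of the canonical map `R' ⊗ ⋀^q M → ⋀^q M'`. -/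
lemma exteriorPower.isLocalizedModule [IsLocalization S R'] [Module R' M']
    [IsScalarTower R R' M'] (f : M →ₗ[R] M') [IsLocalizedModule S f] {q : ℕ}
    (g : (⋀[R]^q M) →ₗ[R] (⋀[R']^q M'))
    (hg : ∀ m, g (ιMulti R q m) = ιMulti R' q fun i => f (m i)) : IsLocalizedModule S g := by
  obtain ⟨Ψ, hΨ⟩ := exists_extend_ιMulti S R' f q
  let φ : R' ⊗[R] (⋀[R]^q M) →ₗ[R'] (⋀[R']^q M') :=
    TensorProduct.AlgebraTensorModule.lift ((LinearMap.toSpanSingleton R' _ g).restrictScalars R')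
  have hφ : ∀ x, φ ((1 : R') ⊗ₜ x) = g x := fun x => by simp [φ]
  let ψ : (⋀[R']^q M') →ₗ[R'] R' ⊗[R] (⋀[R]^q M) := alternatingMapLinearEquiv Ψ
  have hψ : ∀ v, ψ (ιMulti R' q v) = Ψ v := fun v => alternatingMapLinearEquiv_apply_ιMulti _ _
  have h1 : ψ ∘ₗ φ = LinearMap.id := by
    have : ∀ x, ψ (g x) = (1 : R') ⊗ₜ x := fun x => by
      have : (ψ.restrictScalars R) ∘ₗ g = TensorProduct.mk R R' _ 1 := by
        refine exteriorPower.linearMap_ext ?_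
        ext m
        simp [hg, hψ, hΨ]
      exact LinearMap.congr_fun this x
    refine TensorProduct.AlgebraTensorModule.ext fun r x => ?_
    rw [← mul_one r, ← smul_eq_mul, ← TensorProduct.smul_tmul', map_smul, map_smul,
      LinearMap.comp_apply, hφ, this]
    rfl
  have h2 : φ ∘ₗ ψ = LinearMap.id := by
    have hφΨ : φ.compAlternatingMap Ψ = ιMulti R' q := by
      ext v : 1
      choose m hm using fun i => IsLocalizedModule.surj S f (v i)
      have hu : IsUnit (algebraMap R R' (∏ i, (m i).2 : S)) := IsLocalization.map_units R' _
      refine hu.smul_left_cancel.1 ?_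
      rw [LinearMap.compAlternatingMap_apply, ← map_smul]
      simp only [Submonoid.coe_finsetProd, map_prod, ← MultilinearMap.map_smul_univ,
        ← AlternatingMap.coe_multilinearMap, algebraMap_smul]
      simp only [Submonoid.smul_def] at hm
      simp only [hm, AlternatingMap.coe_multilinearMap]
      rw [hΨ, hφ, hg]
    refine exteriorPower.linearMap_ext ?_
    ext v : 1
    simpa [hψ] using! congr($hφΨ v)
  let e : R' ⊗[R] (⋀[R]^q M) ≃ₗ[R] (⋀[R']^q M') :=
    (LinearEquiv.ofLinearMap φ ψ h2 h1).restrictScalars R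
  have : g = e.toLinearMap ∘ₗ TensorProduct.mk R R' _ 1 := by
    ext x
    simp [e, hφ]
  rw [this]
  exact IsLocalizedModule.of_linearEquiv S _ e

end ExteriorLocalization

section FormsLocalization

variable (k : Type*) [CommRing k] {A B : Type*} [CommRing A] [CommRing B] [Algebra k A]
  [Algebra k B] [Algebra A B] [IsScalarTower k A B] (S : Submonoid A) [IsLocalization S B]
  {P Q : Type*} [AddCommGroup P] [Module A P] [AddCommGroup Q] [Module A Q]
    [Module B Q] [IsScalarTower A B Q] (m : P →ₗ[A] Q) [IsLocalizedModule S m]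

lemma kaehlerExteriorMap_ιMulti (B : Type*) [CommRing B] [Algebra k B] [Algebra A B]
    [IsScalarTower k A B] (q : ℕ) (v : Fin q → Ω[A⁄k]) :
    kaehlerExteriorMap k A B q (exteriorPower.ιMulti A q v) =
      exteriorPower.ιMulti B q fun i => KaehlerDifferential.map k k A B (v i) :=
  exteriorPower.alternatingMapLinearEquiv_apply_ιMulti _ _

/-- Forming twisted differential forms commutes with localization. -/
lemma isLocalizedModule_algTwistedFormsMap (q : ℕ) :
    IsLocalizedModule S (algTwistedFormsMap k A B m q) := by
  have := exteriorPower.isLocalizedModule S B (KaehlerDifferential.map k k A B)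
    (kaehlerExteriorMap k A B q) (kaehlerExteriorMap_ιMulti k B q)
  have := IsLocalization.tensorProduct_compatibleSMul S B (⋀[B]^q (Ω[B⁄k])) Q
  exact IsLocalizedModule.of_linearEquiv S
    (TensorProduct.map (kaehlerExteriorMap k A B q) m)
    (TensorProduct.equivOfCompatibleSMul B A A (⋀[B]^q (Ω[B⁄k])) Q)

end FormsLocalization

/-! ### Differentials of approximate roots -/

section FrobeniusRoots

open KaehlerDifferential

variable {k : Type*} [Field k] {p : ℕ}

lemma derivation_pow_char {k B N : Type*} [CommRing k] [CommRing B] [Algebra k B] [AddCommGroup N]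
    [Module B N] [Module k N] [CharP B p] (d : Derivation k B N) (x : B) : d (x ^ p) = 0 := by
  rw [Derivation.leibniz_pow, ← Nat.cast_smul_eq_nsmul B, CharP.cast_eq_zero, zero_smul]

variable {A B : Type*} [CommRing A] [CommRing B] [Algebra k A] [Algebra k B] [Algebra A B]
  [IsScalarTower k A B]

/-- The elements of `A` whose differential in `Ω_{B/k}` lies in the `B`-submodule `N`. -/
def differentialSubalgebra (N : Submodule B (Ω[B⁄k])) : Subalgebra k A where
  carrier := {a | D k B (algebraMap A B a) ∈ N}
  mul_mem' {a b} ha hb := by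
    simp only [Set.mem_ofPred_eq, map_mul, Derivation.leibniz] at *
    exact N.add_mem (N.smul_mem _ hb) (N.smul_mem _ ha)
  add_mem' {a b} ha hb := by
    simp only [Set.mem_ofPred_eq, map_add] at *
    exact N.add_mem ha hb
  algebraMap_mem' r := by
    simp [← IsScalarTower.algebraMap_apply]

lemma mem_differentialSubalgebra {N : Submodule B (Ω[B⁄k])} {a : A} :
    a ∈ differentialSubalgebra (A := A) N ↔ D k B (algebraMap A B a) ∈ N := Iff.rfl

lemma mem_differentialSubalgebra_of_mul_eq_one {N : Submodule B (Ω[B⁄k])} {a b : A}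
    (ha : a ∈ differentialSubalgebra N) (hab : a * b = 1) : b ∈ differentialSubalgebra N := by
  rw [mem_differentialSubalgebra] at *
  have h : algebraMap A B a * algebraMap A B b = 1 := by rw [← map_mul, hab, map_one]
  have h2 := congrArg (D k B) h
  rw [Derivation.leibniz, Derivation.map_one_eq_zero] at h2
  have h3 : D k B (algebraMap A B b) =
      -((algebraMap A B b * algebraMap A B b) • D k B (algebraMap A B a)) := by
    rw [eq_neg_iff_add_eq_zero, mul_smul, ← one_smul B (D k B (algebraMap A B b)), ← h, mul_comm,
      mul_smul, ← smul_add, h2, smul_zero]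
  rw [h3]
  exact N.neg_mem (N.smul_mem _ ha)

/-- The family `z` generates the `k`-algebra `A` up to inverting elements: a subalgebra that
contains all the `z j`, and the inverse of each of its elements that is a unit of `A`, is all of
`A`. In contrast to generation in the usual sense, this is inherited by localizations; and it is
still enough to control differentials, as `d(a⁻¹) = -a⁻² da`. -/
def GeneratesUpToInverses (k : Type*) [CommSemiring k] {A J : Type*} [CommRing A] [Algebra k A]
    (z : J → A) : Prop :=
  ∀ S : Subalgebra k A, (∀ j, z j ∈ S) → (∀ a b, a ∈ S → a * b = 1 → b ∈ S) → S = ⊤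

variable [CharP B p]
  {J : Type*} {z : J → A} {v : J → Aˣ} {s : A} {w : J → B}

set_option linter.unusedSectionVars false in
/-- Differentiating `w ^ p = z + (s v) ^ p * w` in characteristic `p` leaves
`0 = dz + (s v) ^ p dw`. -/
lemma D_generator_eq
    (hw : ∀ j, w j ^ p = algebraMap A B (z j) + algebraMap A B ((s * v j) ^ p) * w j) (j : J) :
    D k B (algebraMap A B (z j)) = -(algebraMap A B ((s * v j) ^ p) • D k B (w j)) := by
  have h := congrArg (D k B) (hw j)
  rw [derivation_pow_char, map_add, Derivation.leibniz, map_pow, derivation_pow_char,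
    smul_zero, add_zero] at h
  rw [eq_neg_iff_add_eq_zero, map_pow]
  exact h.symm

variable [hp : Fact p.Prime]

/-- The differentials in `Ω_{B/k}` of all elements of `A` are divisible by `s`, with quotients in
the span of the differentials of the roots `w j`. This is what cancels the poles of a form. -/
lemma D_algebraMap_mem_smul_span (hz : GeneratesUpToInverses k z)
    (hw : ∀ j, w j ^ p = algebraMap A B (z j) + algebraMap A B ((s * v j) ^ p) * w j) (a : A) :
    D k B (algebraMap A B a) ∈ Ideal.span {algebraMap A B s} •
      Submodule.span B (Set.range fun j => D k B (w j)) := by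
  have : a ∈ differentialSubalgebra (A := A) (Ideal.span {algebraMap A B s} •
      Submodule.span B (Set.range fun j => D k B (w j))) := by
    rw [hz (differentialSubalgebra _) (fun j => ?_)
      (fun a b ha hab => mem_differentialSubalgebra_of_mul_eq_one ha hab)]
    · trivial
    · rw [mem_differentialSubalgebra, D_generator_eq hw]
      refine Submodule.neg_mem _ (Submodule.smul_mem_smul ?_ (Submodule.subset_span ⟨j, rfl⟩))
      rw [Ideal.mem_span_singleton]
      exact map_dvd _ (Dvd.dvd.mul_right (dvd_refl _) _ |>.trans (dvd_pow_self _ hp.out.ne_zero))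
  exact this

lemma D_adjoin_mem_span (hz : GeneratesUpToInverses k z)
    (hw : ∀ j, w j ^ p = algebraMap A B (z j) + algebraMap A B ((s * v j) ^ p) * w j) {c : B}
    (hc : c ∈ Algebra.adjoin A (Set.range w)) :
    D k B c ∈ Submodule.span B (Set.range fun j => D k B (w j)) := by
  induction hc using Algebra.adjoin_induction with
  | mem x hx =>
    obtain ⟨j, rfl⟩ := hx
    exact Submodule.subset_span ⟨j, rfl⟩
  | algebraMap a => exact Submodule.smul_le_right (D_algebraMap_mem_smul_span hz hw a)
  | add x y _ _ hx hy => rw [map_add]; exact Submodule.add_mem _ hx hy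
  | mul x y _ _ hx hy =>
    rw [Derivation.leibniz]
    exact Submodule.add_mem _ (Submodule.smul_mem _ _ hy) (Submodule.smul_mem _ _ hx)

/-- The elements of `A` that are `p`-th powers in `B` modulo `s ^ p`, with an error term in the
subalgebra `C`. -/
def approximateRoots (p : ℕ) [Fact p.Prime] [CharP k p] [PerfectField k] [CharP B p] (s : A)
    (C : Subalgebra A B) : Subalgebra k A where
  carrier := {a | ∃ x : B, ∃ c ∈ C, x ^ p = algebraMap A B a + algebraMap A B s ^ p * c}
  mul_mem' := by
    rintro a b ⟨x, c, hc, hx⟩ ⟨y, d, hd, hy⟩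
    refine ⟨x * y, algebraMap A B a * d + algebraMap A B b * c + algebraMap A B s ^ p * (c * d),
      ?_, ?_⟩
    · exact C.add_mem (C.add_mem (C.mul_mem (C.algebraMap_mem a) hd)
        (C.mul_mem (C.algebraMap_mem b) hc))
        (C.mul_mem (C.pow_mem (C.algebraMap_mem s) p) (C.mul_mem hc hd))
    · rw [mul_pow, hx, hy, map_mul]; ring
  add_mem' := by
    rintro a b ⟨x, c, hc, hx⟩ ⟨y, d, hd, hy⟩
    refine ⟨x + y, c + d, C.add_mem hc hd, ?_⟩
    rw [add_pow_char, hx, hy, map_add]; ring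
  algebraMap_mem' r := by
    have : Function.Bijective (frobenius k p) := PerfectRing.bijective_frobenius
    obtain ⟨t, ht⟩ := this.2 r
    refine ⟨algebraMap k B t, 0, C.zero_mem, ?_⟩
    rw [← ht, frobenius_def, mul_zero, add_zero, ← IsScalarTower.algebraMap_apply, map_pow]

/-- The differential of the error term `c` of an approximate `p`-th root depends only on `a`. -/
lemma D_eq_of_approximateRoot [IsDomain B] [IsIntegrallyClosed B] {x y a c d s : B} (hs : s ≠ 0)
    (hx : x ^ p = a + s ^ p * c) (hy : y ^ p = a + s ^ p * d) : D k B c = D k B d := by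
  have h : (x - y) ^ p = s ^ p * (c - d) := by rw [sub_pow_char, hx, hy]; ring
  -- as `B` is normal, `s ^ p ∣ (x - y) ^ p` gives `s ∣ x - y`, so `c - d` is a `p`-th power
  obtain ⟨t, ht⟩ : s ∣ x - y :=
    (IsIntegrallyClosed.pow_dvd_pow_iff hp.out.ne_zero).1 ⟨_, h⟩
  have h2 : c - d = t ^ p := by
    rw [ht, mul_pow] at h
    exact (mul_left_cancel₀ (pow_ne_zero _ hs) h).symm
  rw [← sub_eq_zero, ← map_sub, h2, derivation_pow_char]

variable [CharP k p] [PerfectField k]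

/-- Every element of `A` is a `p`-th power in `B` modulo `s ^ p`. -/
lemma approximateRoots_eq_top (hz : GeneratesUpToInverses k z)
    (hw : ∀ j, w j ^ p = algebraMap A B (z j) + algebraMap A B ((s * v j) ^ p) * w j) :
    approximateRoots (k := k) p s (Algebra.adjoin A (Set.range w)) = ⊤ := by
  refine hz _ (fun j => ?_) (fun a b ha hab => ?_)
  · refine ⟨w j, algebraMap A B (v j ^ p) * w j, Subalgebra.mul_mem _
      (Subalgebra.algebraMap_mem _ _) (Algebra.subset_adjoin ⟨j, rfl⟩), ?_⟩
    rw [hw, mul_pow, map_mul, map_pow, mul_assoc]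
  · -- `b = b ^ p * a ^ (p - 1)`, and `b ^ p` is an exact `p`-th power
    have hb : b = b ^ p * a ^ (p - 1) := by
      obtain ⟨n, hn⟩ : ∃ n, p = n + 1 := ⟨p - 1, (Nat.succ_pred hp.out.ne_zero).symm⟩
      rw [hn, Nat.add_sub_cancel, pow_succ, mul_right_comm, ← mul_pow, mul_comm b a, hab, one_pow,
        one_mul]
    rw [hb]
    refine Subalgebra.mul_mem _ ⟨algebraMap A B b, 0, Subalgebra.zero_mem _, by simp⟩
      (Subalgebra.pow_mem _ ha _)

/-- The map `a ↦ dc`, where `x ^ p = a + s ^ p * c` for some `x` in `B`, is a well-defined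
derivation of `A` modulo `s`; as `da = -s ^ p dc`, it divides the differentials of `A` by `-s ^ p`.
It sends `z j` to `v j ^ p • d (w j)`. -/
lemma exists_rootDerivation [IsDomain B] [IsIntegrallyClosed B] (hs : algebraMap A B s ≠ 0)
    (hz : GeneratesUpToInverses k z)
    (hw : ∀ j, w j ^ p = algebraMap A B (z j) + algebraMap A B ((s * v j) ^ p) * w j)
    {F N : Submodule B (Ω[B⁄k])}
    (hF : F = Submodule.span B (Set.range fun j => D k B (w j)))
    (hN : N = Ideal.span {algebraMap A B s} • F) :
    ∃ δ : Derivation k A (Ω[B⁄k] ⧸ N), (∀ a, ∃ f ∈ F, N.mkQ f = δ a) ∧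
      ∀ j, δ (z j) = algebraMap A B (v j ^ p) • N.mkQ (D k B (w j)) := by
  have hex : ∀ a : A, ∃ x : B, ∃ c ∈ Algebra.adjoin A (Set.range w),
      x ^ p = algebraMap A B a + algebraMap A B s ^ p * c := fun a => by
    have : a ∈ approximateRoots (k := k) p s (Algebra.adjoin A (Set.range w)) := by
      rw [approximateRoots_eq_top hz hw]; trivial
    exact this
  choose x c hc hx using hex
  have huniq : ∀ (a : A) (y d : B), y ^ p = algebraMap A B a + algebraMap A B s ^ p * d →
      D k B (c a) = D k B d := fun a y d h => D_eq_of_approximateRoot hs (hx a) h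
  have hDA : ∀ a : A, D k B (algebraMap A B a) ∈ N := fun a => by
    rw [hN, hF]; exact D_algebraMap_mem_smul_span hz hw a
  have hDc : ∀ a : A, D k B (c a) ∈ F := fun a => by
    rw [hF]; exact D_adjoin_mem_span hz hw (hc a)
  have hbij : Function.Bijective (frobenius k p) := PerfectRing.bijective_frobenius
  let δ₀ : A →ₗ[k] (Ω[B⁄k] ⧸ N) :=
    { toFun := fun a => N.mkQ (D k B (c a))
      map_add' := fun a b => by
        rw [huniq (a + b) (x a + x b) (c a + c b) (by rw [add_pow_char, hx, hx, map_add]; ring),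
          map_add, map_add]
      map_smul' := fun r a => by
        obtain ⟨t, ht⟩ := hbij.2 r
        have : D k B (c (r • a)) = r • D k B (c a) := by
          rw [huniq (r • a) (t • x a) (r • c a), Derivation.map_smul]
          rw [smul_pow, hx, ← frobenius_def, ht, smul_add, Algebra.algebraMap_eq_smul_one (r • a),
            Algebra.algebraMap_eq_smul_one a, smul_assoc, mul_smul_comm]
        rw [this]
        rfl }
  refine ⟨Derivation.mk' δ₀ fun a b => ?_, fun a => ⟨_, hDc a, rfl⟩, fun j => ?_⟩
  · change N.mkQ (D k B (c (a * b))) = a • N.mkQ (D k B (c b)) + b • N.mkQ (D k B (c a))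
    rw [huniq (a * b) (x a * x b) (algebraMap A B a * c b + algebraMap A B b * c a +
      algebraMap A B s ^ p * (c a * c b)) (by rw [mul_pow, hx, hx, map_mul]; ring)]
    rw [← algebraMap_smul B a, ← algebraMap_smul B b, ← N.mkQ.map_smul, ← N.mkQ.map_smul, ← map_add,
      ← sub_eq_zero, ← map_sub, Submodule.mkQ_apply, Submodule.Quotient.mk_eq_zero]
    simp only [map_add, Derivation.leibniz, derivation_pow_char, smul_zero, add_zero]
    have e1 := N.smul_mem (c b) (hDA a)
    have e2 := N.smul_mem (c a) (hDA b)
    have e3 : algebraMap A B s ^ p • (c a • D k B (c b) + c b • D k B (c a)) ∈ N := by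
      rw [hN]
      refine Submodule.smul_mem_smul ?_ (F.add_mem (F.smul_mem _ (hDc b)) (F.smul_mem _ (hDc a)))
      exact Ideal.mem_span_singleton.2 (dvd_pow_self _ hp.out.ne_zero)
    convert N.add_mem (N.add_mem e1 e2) e3 using 1
    abel
  · change N.mkQ (D k B (c (z j))) = _
    rw [huniq (z j) (w j) (algebraMap A B (v j ^ p) * w j), ← map_smul]
    · congr 1
      rw [Derivation.leibniz, map_pow, derivation_pow_char, smul_zero, add_zero]
    · rw [hw, mul_pow, map_mul, map_pow, mul_assoc]

lemma exists_mem_mkQ_eq_of_span {X M : Type*} [AddCommGroup X] [Module A X] [AddCommGroup M]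
    [Module A M] [Module B M] [IsScalarTower A B M] {N F : Submodule B M} (θ : X →ₗ[A] (M ⧸ N))
    {T : Set X} (hT : Submodule.span A T = ⊤) (h : ∀ x ∈ T, ∃ f ∈ F, N.mkQ f = θ x) (x : X) :
    ∃ f ∈ F, N.mkQ f = θ x := by
  have : Submodule.span A T ≤ ((F.map N.mkQ).restrictScalars A).comap θ := Submodule.span_le.2 h
  exact this (hT ▸ Submodule.mem_top)

/-- Nakayama's lemma: if the `φ i` generate the span of the `m j` modulo `s`, then they generate it
after multiplication with an element of the form `1 + s r`. -/
lemma exists_smul_mem_span_of_surjective_mod {M : Type*} [AddCommGroup M] [Module B M] [Finite J]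
    {ι : Type*} {m : J → M} {φ : ι → M} {s : B} (h : ∀ j, ∃ e ∈ Submodule.span B (Set.range φ),
      m j - e ∈ Ideal.span {s} • Submodule.span B (Set.range m)) :
    ∃ r : B, ∀ j, (1 + s * r) • m j ∈ Submodule.span B (Set.range φ) := by
  have hle : Submodule.span B (Set.range m) ≤
      Submodule.span B (Set.range φ) ⊔ Ideal.span {s} • Submodule.span B (Set.range m) := by
    rw [Submodule.span_le]
    rintro _ ⟨j, rfl⟩
    obtain ⟨e, he, he'⟩ := h j
    exact Submodule.mem_sup.2 ⟨e, he, _, he', by abel⟩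
  obtain ⟨r, hr, hrF⟩ := Submodule.exists_sub_one_mem_and_smul_le_of_fg_of_le_sup
    (Submodule.fg_span (Set.finite_range m)) le_rfl hle
  obtain ⟨r', hr'⟩ := Ideal.mem_span_singleton.1 hr
  refine ⟨r', fun j => hrF ?_⟩
  rw [show 1 + s * r' = r by rw [← hr']; ring]
  exact Submodule.smul_mem_pointwise_smul _ _ _ (Submodule.subset_span ⟨j, rfl⟩)

/-- Modulo `s`, the differentials `d (w j)` are generated by as many elements as `Ω_{A/k}`;
by Nakayama, so are they after multiplication with an element of the form `1 + s r`. -/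
lemma exists_smul_mem_span_of_roots [IsDomain B] [IsIntegrallyClosed B] [Finite J]
    (hs : algebraMap A B s ≠ 0) (hz : GeneratesUpToInverses k z)
    (hw : ∀ j, w j ^ p = algebraMap A B (z j) + algebraMap A B ((s * v j) ^ p) * w j)
    {ι : Type*} (b : Module.Basis ι A (Ω[A⁄k])) :
    ∃ φ : ι → Ω[B⁄k], ∃ r : B,
      (∀ i, φ i ∈ Submodule.span B (Set.range fun j => D k B (w j))) ∧
      ∀ j, (1 + algebraMap A B s * r) • D k B (w j) ∈ Submodule.span B (Set.range φ) := by
  obtain ⟨F, hF⟩ : ∃ F, F = Submodule.span B (Set.range fun j => D k B (w j)) := ⟨_, rfl⟩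
  obtain ⟨N, hN⟩ : ∃ N, N = Ideal.span {algebraMap A B s} • F := ⟨_, rfl⟩
  obtain ⟨δ, hδF, hδ⟩ := exists_rootDerivation hs hz hw hF hN
  obtain ⟨θ, hθ⟩ : ∃ θ : Ω[A⁄k] →ₗ[A] (Ω[B⁄k] ⧸ N), ∀ a, θ (D k A a) = δ a :=
    ⟨δ.liftKaehlerDifferential, fun a => δ.liftKaehlerDifferential_comp_D a⟩
  have hθF := exists_mem_mkQ_eq_of_span (F := F) θ (span_range_derivation k A) (by
    rintro _ ⟨a, rfl⟩
    rw [hθ]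
    exact hδF a)
  choose φ hφF hφ using fun i => hθF (b i)
  have hE := exists_mem_mkQ_eq_of_span (F := Submodule.span B (Set.range φ)) θ b.span_eq (by
    rintro _ ⟨i, rfl⟩
    exact ⟨φ i, Submodule.subset_span ⟨i, rfl⟩, hφ i⟩)
  obtain ⟨r, hr⟩ := exists_smul_mem_span_of_surjective_mod (φ := φ) (s := algebraMap A B s)
      (m := fun j => D k B (w j)) (fun j => by
    obtain ⟨e, he, he'⟩ := hE (D k A (z j))
    rw [hθ, hδ] at he'
    have hv : algebraMap A B (↑(v j)⁻¹ ^ p) * algebraMap A B (v j ^ p) = 1 := by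
      rw [← map_mul, ← mul_pow, Units.inv_mul, one_pow, map_one]
    refine ⟨_, Submodule.smul_mem _ (algebraMap A B (↑(v j)⁻¹ ^ p)) he, ?_⟩
    rw [← hF, ← hN, ← Submodule.Quotient.mk_eq_zero, ← Submodule.mkQ_apply, map_sub,
      N.mkQ.map_smul, he', smul_smul, hv, one_smul, sub_self])
  exact ⟨φ, r, fun i => hF ▸ hφF i, hr⟩

end FrobeniusRoots

/-! ### Torsion-freeness of the span of wedge products of differentials of roots -/

section WedgeSpan

variable {B M : Type*} [CommRing B] [AddCommGroup M] [Module B M]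

lemma exteriorPower.map_smul {N : Type*} [AddCommGroup N] [Module B N] (q : ℕ) (r : B)
    (f : M →ₗ[B] N) : exteriorPower.map q (r • f) = r ^ q • exteriorPower.map q f := by
  refine exteriorPower.linearMap_ext ?_
  ext v : 1
  simp only [LinearMap.compAlternatingMap_apply, map_apply_ιMulti, LinearMap.smul_apply]
  have := (ιMulti B q (M := N)).toMultilinearMap.map_smul_univ (fun _ => r) (fun i => f (v i))
  simpa using! this

/-- If `r` maps `F` into `E`, then `r ^ q` maps the wedge products of elements of `F` into the span
of the wedge products of elements of `E`. -/
lemma exteriorPower.smul_mem_range_map {E F : Submodule B M} {q : ℕ} {r : B}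
    (h : ∀ x ∈ F, r • x ∈ E) {ω : ⋀[B]^q M}
    (hω : ω ∈ LinearMap.range (exteriorPower.map q F.subtype)) :
    r ^ q • ω ∈ LinearMap.range (exteriorPower.map q E.subtype) := by
  obtain ⟨y, rfl⟩ := hω
  let ρ : F →ₗ[B] E := (r • F.subtype).codRestrict E fun x => h x.1 x.2
  have hρ : E.subtype ∘ₗ ρ = r • F.subtype := by ext; rfl
  refine ⟨exteriorPower.map q ρ y, ?_⟩
  rw [← LinearMap.comp_apply, ← exteriorPower.map_comp, hρ, exteriorPower.map_smul]
  rfl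

end WedgeSpan

section TorsionFree

open KaehlerDifferential

variable {k : Type*} [Field k] {A B L : Type*} [CommRing A] [CommRing B] [Field L] [Algebra k A]
  [Algebra k B] [Algebra k L] [Algebra A B] [Algebra A L] [Algebra B L] [IsScalarTower k A B]
  [IsScalarTower k A L] [IsScalarTower k B L] [IsScalarTower A B L]

/-- A form that is spanned by the wedge products of differentials that are independent over `L` is
not torsion. -/
lemma eq_zero_of_smul_eq_zero_of_linearIndependent [IsDomain B]
    (hBL : Function.Injective (algebraMap B L))
    {n q : ℕ} {φ : Fin n → Ω[B⁄k]} (hφ : LinearIndependent L fun i => map k k B L (φ i))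
    {ω : ⋀[B]^q Ω[B⁄k]}
    (hω : ω ∈ LinearMap.range (exteriorPower.map q (Submodule.span B (Set.range φ)).subtype))
    {b : B} (hb : b ≠ 0) (h : b • ω = 0) : ω = 0 := by
  rw [exteriorPower.ιMulti_family_span, Submodule.mem_span_range_iff_exists_fun] at hω
  obtain ⟨c, rfl⟩ := hω
  have hli := exteriorPower.ιMulti_family_linearIndependent_field q hφ
  have h2 := congrArg (kaehlerExteriorMap k B L q) h
  simp only [map_zero, map_smul, map_sum, exteriorPower.ιMulti_family, kaehlerExteriorMap_ιMulti,
    Finset.smul_sum] at h2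
  have h3 : ∀ s, algebraMap B L (b * c s) = 0 := by
    refine Fintype.linearIndependent_iff.1 hli _ ?_
    rw [← h2]
    refine Finset.sum_congr rfl fun s _ => ?_
    rw [smul_smul, algebraMap_smul]
    rfl
  refine Finset.sum_eq_zero fun s _ => ?_
  have := h3 s
  rw [map_eq_zero_iff _ hBL, mul_eq_zero, or_iff_right hb] at this
  rw [this, zero_smul]

/-- A basis of `Ω_{A/k}` becomes a basis of `Ω_{L/k}` if `L` is formally étale over `A`. -/
lemma linearIndependent_map_basis [Algebra.FormallyEtale A L] {ι : Type*}
    (b : Module.Basis ι A (Ω[A⁄k])) :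
    LinearIndependent L (fun i => map k k A L (b i)) ∧
      Submodule.span L (Set.range fun i => map k k A L (b i)) = ⊤ := by
  have h := (isBaseChange_of_formallyEtale k A L)
  have e : ∀ i, h.basis b i = map k k A L (b i) := fun i => by simp [IsBaseChange.basis_apply]
  simp only [← e]
  exact ⟨(h.basis b).linearIndependent, (h.basis b).span_eq⟩

lemma map_map_apply (x : Ω[A⁄k]) : map k k B L (map k k A B x) = map k k A L x := by
  have : (map k k B L).restrictScalars A ∘ₗ map k k A B = map k k A L := by
    ext a
    simp [← IsScalarTower.algebraMap_apply]
  exact LinearMap.congr_fun this x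

variable {p : ℕ} [hp : Fact p.Prime] [CharP k p] [PerfectField k] [CharP B p]
  {J : Type*} {z : J → A} {v : J → Aˣ} {s : A} {w : J → B}

/-- The submodule `E` of `⋀^q Ω_{B/k}` that is spanned by the wedge products of the differentials of
the roots `w j` is torsion free, even though `⋀^q Ω_{B/k}` need not be. Up to a power of `s`, a form
in `E` comes from `Ω_{A/k}`; up to a power of some `1 + s r`, it is a combination of wedge products
of as many differentials as the rank of `Ω_{A/k}`. In both cases these differentials are independent
over `L`, so both multiples of a torsion form in `E` vanish, and the two factors generate the unit
ideal. -/
theorem eq_zero_of_smul_eq_zero_of_mem_range_map [IsDomain B] [IsIntegrallyClosed B] [Finite J]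
    [Algebra.FormallyEtale A L] (hBL : Function.Injective (algebraMap B L))
    (hs : algebraMap A B s ≠ 0) (hz : GeneratesUpToInverses k z)
    (hw : ∀ j, w j ^ p = algebraMap A B (z j) + algebraMap A B ((s * v j) ^ p) * w j)
    {n : ℕ} (β : Module.Basis (Fin n) A (Ω[A⁄k])) {q : ℕ} {ω : ⋀[B]^q Ω[B⁄k]}
    (hω : ω ∈ LinearMap.range (exteriorPower.map q
      (Submodule.span B (Set.range fun j => D k B (w j))).subtype))
    {b : B} (hb : b ≠ 0) (h : b • ω = 0) : ω = 0 := by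
  obtain ⟨φ, r, hφF, hφ⟩ := exists_smul_mem_span_of_roots hs hz hw β
  set F := Submodule.span B (Set.range fun j => D k B (w j)) with hF
  obtain ⟨hξ, hξ'⟩ := linearIndependent_map_basis (L := L) β
  have hDA : ∀ x : Ω[A⁄k], map k k A B x ∈ F := fun x => by
    have : (⊤ : Submodule A (Ω[A⁄k])) ≤ (F.restrictScalars A).comap (map k k A B) := by
      rw [← span_range_derivation, Submodule.span_le]
      rintro _ ⟨a, rfl⟩
      change map k k A B (D k A a) ∈ F
      rw [map_D]
      exact Submodule.smul_le_right (D_algebraMap_mem_smul_span hz hw a)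
    exact this trivial
  -- away from `s`, the submodule is generated by the image of `Ω_{A/k}`
  have h1 : algebraMap A B (s ^ p) ^ q • ω = 0 := by
    refine eq_zero_of_smul_eq_zero_of_linearIndependent (L := L) hBL
      (φ := fun i => map k k A B (β i)) (by simpa only [map_map_apply] using hξ)
      (exteriorPower.smul_mem_range_map (fun x hx => ?_) hω) hb (by rw [smul_comm, h, smul_zero])
    have hmem : ∀ x : Ω[A⁄k], map k k A B x ∈
        Submodule.span B (Set.range fun i => map k k A B (β i)) := fun x => by
      have : (⊤ : Submodule A (Ω[A⁄k])) ≤ ((Submodule.span B (Set.range fun i =>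
          map k k A B (β i))).restrictScalars A).comap (map k k A B) := by
        rw [← β.span_eq, Submodule.span_le]
        rintro _ ⟨i, rfl⟩
        exact Submodule.subset_span ⟨i, rfl⟩
      exact this trivial
    induction hx using Submodule.span_induction with
    | mem x hx =>
      obtain ⟨j, rfl⟩ := hx
      have := D_generator_eq (k := k) hw j
      have hv : algebraMap A B (s ^ p) =
          algebraMap A B (↑(v j)⁻¹ ^ p) * algebraMap A B ((s * v j) ^ p) := by
        rw [← map_mul, ← mul_pow, mul_left_comm, Units.inv_mul, mul_one]
      rw [hv, mul_smul, ← neg_neg (algebraMap A B ((s * v j) ^ p) • _), ← this, ← map_D k k]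
      exact Submodule.smul_mem _ _ (Submodule.neg_mem _ (hmem _))
    | zero => simp
    | add x y _ _ hx hy => rw [smul_add]; exact Submodule.add_mem _ hx hy
    | smul a x _ hx => rw [smul_comm]; exact Submodule.smul_mem _ _ hx
  -- near the zeros of `s`, it is generated by the `φ i`
  have hφ' : ∀ x ∈ F, (1 + algebraMap A B s * r) • x ∈ Submodule.span B (Set.range φ) := by
    intro x hx
    induction hx using Submodule.span_induction with
    | mem x hx => obtain ⟨j, rfl⟩ := hx; exact hφ j
    | zero => simp
    | add x y _ _ hx hy => rw [smul_add]; exact Submodule.add_mem _ hx hy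
    | smul a x _ hx => rw [smul_comm]; exact Submodule.smul_mem _ _ hx
  have h2 : (1 + algebraMap A B s * r) ^ (q + 1) • ω = 0 := by
    by_cases hr : 1 + algebraMap A B s * r = 0
    · rw [hr, zero_pow (Nat.succ_ne_zero q), zero_smul]
    rw [pow_succ', mul_smul]
    refine smul_eq_zero_of_right _ (eq_zero_of_smul_eq_zero_of_linearIndependent (L := L) hBL
      (φ := φ) ?_ (exteriorPower.smul_mem_range_map hφ' hω) hb (by rw [smul_comm, h, smul_zero]))
    -- `n` vectors that span the `n`-dimensional space `Ω_{L/k}`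
    refine linearIndependent_of_top_le_span_of_card_eq_finrank ?_ ?_
    · rw [← hξ', Submodule.span_le]
      rintro _ ⟨i, rfl⟩
      have h3 := hφ' _ (hDA (β i))
      have hle : Submodule.span B (Set.range φ) ≤ ((Submodule.span L (Set.range fun i =>
          map k k B L (φ i))).restrictScalars B).comap (map k k B L) := by
        rw [Submodule.span_le]
        rintro _ ⟨i, rfl⟩
        exact Submodule.subset_span ⟨i, rfl⟩
      have h4 := hle h3
      simp only [Submodule.mem_comap, map_smul, map_map_apply,
        Submodule.restrictScalars_mem] at h4
      rw [← algebraMap_smul L, Submodule.smul_mem_iff _ ((map_ne_zero_iff _ hBL).2 hr)] at h4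
      exact h4
    · have := Module.finrank_eq_card_basis (Module.Basis.mk hξ hξ'.ge)
      rw [this]
  -- `s` and `1 + s r` are coprime
  have hco : IsCoprime ((algebraMap A B (s ^ p)) ^ q) ((1 + algebraMap A B s * r) ^ (q + 1)) := by
    refine IsCoprime.pow ?_
    rw [map_pow]
    refine IsCoprime.pow_left ⟨-r, 1, by ring⟩
  obtain ⟨x, y, hxy⟩ := hco
  rw [← one_smul B ω, ← hxy, add_smul, mul_smul, mul_smul, h1, h2, smul_zero, smul_zero, add_zero]

end TorsionFree

/-! ### Frames of line bundles -/

section Frames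

variable {X Y : Scheme.{u}}

/-- The restriction of sections of an `𝒪_X`-module, as a map of sets. -/
abbrev resSection (M : X.Modules) {V V' : X.Opens} (h : V' ≤ V) (e : Γ(M, V)) : Γ(M, V') :=
  M.presheaf.map (homOfLE h).op e

/-- The section `e` of `M` over `V` is a frame: `r ↦ r • e` is an isomorphism `𝒪_V ≅ M|_V`. -/
def IsFrame (M : X.Modules) {V : X.Opens} (e : Γ(M, V)) : Prop :=
  ∀ (V' : X.Opens) (h : V' ≤ V), Function.Bijective fun r : Γ(X, V') => r • resSection M h e

lemma resSection_resSection (M : X.Modules) {V V' V'' : X.Opens} (h : V' ≤ V) (h' : V'' ≤ V')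
    (e : Γ(M, V)) : resSection M h' (resSection M h e) = resSection M (h'.trans h) e := by
  simp only [resSection, ← ConcreteCategory.comp_apply, ← Functor.map_comp]
  rfl

lemma IsFrame.res {M : X.Modules} {V V' : X.Opens} {e : Γ(M, V)} (he : IsFrame M e) (h : V' ≤ V) :
    IsFrame M (resSection M h e) := fun V'' h' => by
  simpa only [resSection_resSection] using he V'' (h'.trans h)

lemma hom_app_resSection {M N : X.Modules} (φ : M ⟶ N) {V V' : X.Opens} (h : V' ≤ V)
    (e : Γ(M, V)) : φ.app V' (resSection M h e) = resSection N h (φ.app V e) :=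
  ConcreteCategory.congr_hom (φ.mapPresheaf.naturality (homOfLE h).op) e

lemma IsFrame.map_iso {M N : X.Modules} {V : X.Opens} {e : Γ(M, V)} (he : IsFrame M e)
    (φ : M ⟶ N) [IsIso φ] : IsFrame N (φ.app V e) := fun V' h => by
  have h1 : Function.Bijective (φ.app V') := ConcreteCategory.bijective_of_isIso (φ.app V')
  have := h1.comp (he V' h)
  convert this using 1
  ext r
  simp only [Function.comp_apply]
  rw [Scheme.Modules.Hom.app_smul, hom_app_resSection]

lemma IsFrame.of_iso {M N : X.Modules} (Φ : M ≅ N) {V : X.Opens} {e : Γ(M, V)}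
    (he : IsFrame N (Φ.hom.app V e)) : IsFrame M e := by
  have h1 := he.map_iso Φ.inv
  rwa [← ConcreteCategory.comp_apply, ← Scheme.Modules.Hom.comp_app, Iso.hom_inv_id] at h1

/-- The structure sheaf, as a module over itself. -/
def unitModule (X : Scheme.{u}) : X.Modules := SheafOfModules.unit X.ringCatSheaf

/-- The section `1` of the structure sheaf. -/
def unitSection (X : Scheme.{u}) : Γ(unitModule X, ⊤) := (1 : Γ(X, ⊤))

lemma isFrame_one : IsFrame (unitModule X) (unitSection X) := fun V' h => by
  have h1 : resSection (unitModule X) h (unitSection X) = (1 : Γ(X, V')) :=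
    map_one (X.presheaf.map (homOfLE h).op).hom
  have : (fun r : Γ(X, V') => r • resSection (unitModule X) h (unitSection X)) =
      fun r => r := by
    funext r
    rw [h1]
    exact mul_one (M := Γ(X, V')) r
  rw [this]
  exact Function.bijective_id

lemma isFrame_restrict_iff {M : Y.Modules} (j : X ⟶ Y) [IsOpenImmersion j] {V : X.Opens}
    {e : Γ(M, j ''ᵁ V)} : IsFrame (M.restrict j) (V := V) e ↔ IsFrame M e := by
  have key : ∀ (W : X.Opens) (hW : W ≤ V),
      (fun r : Γ(X, W) => r • resSection (M.restrict j) hW e) =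
        (fun r : Γ(Y, j ''ᵁ W) => r • resSection M (j.image_mono hW) e) ∘ (j.appIso W).inv :=
    fun W hW => rfl
  have hb : ∀ W : X.Opens, Function.Bijective (j.appIso W).inv := fun W =>
    ConcreteCategory.bijective_of_isIso _
  constructor
  · intro he V' h
    obtain ⟨W, rfl⟩ : ∃ W, V' = j ''ᵁ W := ⟨j ⁻¹ᵁ V', by
      rw [j.image_preimage_eq_opensRange_inf, right_eq_inf]
      exact h.trans (j.image_le_opensRange V)⟩
    have hW : W ≤ V := by rwa [j.image_le_image_iff] at h
    have h1 := he W hW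
    rw [key] at h1
    exact (Function.Bijective.of_comp_iff _ (hb W)).1 h1
  · intro he W h
    rw [key]
    exact (he _ (j.image_mono h)).comp (hb W)

/-- The preimage functor on open subsets is final, as the whole space is a terminal object. -/
instance final_opensMap (f : Y ⟶ X) : (Opens.map f.base).Final where
  out U := by
    have : Nonempty (StructuredArrow U (Opens.map f.base)) :=
      ⟨StructuredArrow.mk (Y := (⊤ : X.Opens)) (homOfLE le_top)⟩
    refine zigzag_isConnected fun a b => ?_
    let c : StructuredArrow U (Opens.map f.base) :=
      StructuredArrow.mk (Y := (⊤ : X.Opens)) (homOfLE le_top)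
    have h : ∀ a : StructuredArrow U (Opens.map f.base), Nonempty (a ⟶ c) := fun a =>
      ⟨StructuredArrow.homMk (homOfLE le_top) (Subsingleton.elim _ _)⟩
    exact (Zigzag.of_hom (h a).some).trans (Zigzag.of_inv (h b).some)

/-- The pullback of a section. -/
abbrev pullSection (f : Y ⟶ X) (M : X.Modules) {V : X.Opens} (e : Γ(M, V)) :
    Γ((Scheme.Modules.pullback f).obj M, f ⁻¹ᵁ V) :=
  ((Scheme.Modules.pullbackPushforwardAdjunction f).unit.app M).app V e

lemma pullSection_map (f : Y ⟶ X) {M N : X.Modules} (φ : M ⟶ N) {V : X.Opens} (e : Γ(M, V)) :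
    ((Scheme.Modules.pullback f).map φ).app (f ⁻¹ᵁ V) (pullSection f M e) =
      pullSection f N (φ.app V e) := by
  have := congr(($((Scheme.Modules.pullbackPushforwardAdjunction f).unit.naturality φ)).app V e)
  exact this.symm

lemma isRightAdjoint_pushforward_toRingCatSheafHom (f : Y ⟶ X) :
    (SheafOfModules.pushforward.{u} f.toRingCatSheafHom).IsRightAdjoint :=
  (Scheme.Modules.pullbackPushforwardAdjunction f).isRightAdjoint

attribute [local instance] isRightAdjoint_pushforward_toRingCatSheafHom

/-- The pullback of the section `1` of `𝒪_X` is a frame of `f^*𝒪_X ≅ 𝒪_Y`. -/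
lemma isFrame_pullSection_unit (f : Y ⟶ X) :
    IsFrame _ (pullSection f (unitModule X) (V := ⊤) (unitSection X)) := by
  let ψ : (Scheme.Modules.pullback f).obj (unitModule X) ⟶ unitModule Y :=
    SheafOfModules.pullbackObjUnitToUnit f.toRingCatSheafHom
  have hψ : IsIso ψ :=
    SheafOfModules.instIsIsoPullbackObjUnitToUnitOfFinal (F := Opens.map f.base)
      f.toRingCatSheafHom
  have h : ψ.app (f ⁻¹ᵁ ⊤) (pullSection f (unitModule X) (V := ⊤) (unitSection X)) =
      resSection (unitModule Y) le_top (unitSection Y) := by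
    have h1 := SheafOfModules.pullbackPushforwardAdjunction_homEquiv_pullbackObjUnitToUnit
      f.toRingCatSheafHom
    have h2 : (Scheme.Modules.pullbackPushforwardAdjunction f).homEquiv _ _ ψ =
      SheafOfModules.unitToPushforwardObjUnit f.toRingCatSheafHom := h1
    rw [Adjunction.homEquiv_unit] at h2
    have h3 := congr(Scheme.Modules.Hom.app $h2 ⊤ (unitSection X))
    refine Eq.trans ?_ (h3.trans ?_)
    · rfl
    · exact (map_one (f.app ⊤).hom).trans (map_one (Y.presheaf.map (homOfLE le_top).op).hom).symm
  have h2 := ((isFrame_one (X := Y)).res (V' := f ⁻¹ᵁ ⊤) le_top).map_iso (inv ψ)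
  rw [← h, ← ConcreteCategory.comp_apply, ← Scheme.Modules.Hom.comp_app, IsIso.hom_inv_id] at h2
  exact h2

/-- A global frame of `M` gives an isomorphism `𝒪_X ≅ M`. -/
lemma IsFrame.exists_isIso {M : X.Modules} {e : Γ(M, ⊤)} (he : IsFrame M e) :
    ∃ φ : unitModule X ⟶ M, IsIso φ ∧ φ.app ⊤ (unitSection X) = e := by
  let σ : SheafOfModules.sections M :=
    ⟨fun V => resSection M (V := ⊤) (V' := V.unop) le_top e, fun {V W} i =>
      resSection_resSection M (V := ⊤) le_top i.unop.le e⟩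
  let φ : unitModule X ⟶ M := (SheafOfModules.unitHomEquiv M).symm σ
  have hφ1 : ∀ V : X.Opens, φ.app V (1 : Γ(X, V)) = resSection M (V := ⊤) le_top e := fun V =>
    congr($((SheafOfModules.unitHomEquiv M).apply_symm_apply σ).val (Opposite.op V))
  have hφ : ∀ (V : X.Opens) (r : Γ(X, V)), φ.app V r = r • resSection M (V := ⊤) le_top e :=
    fun V r => (congrArg (φ.app V) (mul_one (M := Γ(X, V)) r).symm).trans
      ((Scheme.Modules.Hom.app_smul φ r (show Γ(unitModule X, V) from (1 : Γ(X, V)))).trans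
        (congrArg (r • ·) (hφ1 V)))
  refine ⟨φ, ?_, (hφ1 ⊤).trans (by simp [resSection])⟩
  rw [Scheme.Modules.Hom.isIso_iff_isIso_app]
  intro V
  rw [ConcreteCategory.isIso_iff_bijective]
  rw [show (φ.app V : Γ(unitModule X, V) → Γ(M, V)) = _ from funext (hφ V)]
  exact he V le_top

lemma IsFrame.pullSection_top (f : Y ⟶ X) {M : X.Modules} {e : Γ(M, ⊤)} (he : IsFrame M e) :
    IsFrame _ (pullSection f M e) := by
  obtain ⟨φ, hφ, rfl⟩ := he.exists_isIso
  rw [← pullSection_map]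
  exact (isFrame_pullSection_unit f).map_iso _

lemma resSection_pullSection (f : Y ⟶ X) (M : X.Modules) {V V' : X.Opens} (h : V' ≤ V)
    (e : Γ(M, V)) : resSection _ (f.preimage_mono h) (pullSection f M e) =
      pullSection f M (resSection M h e) :=
  (hom_app_resSection ((Scheme.Modules.pullbackPushforwardAdjunction f).unit.app M) h e).symm

/-- Pullback of modules commutes with restriction to open subsets, compatibly with the pullback of
sections: both composites are left adjoint to the same pushforward. -/
lemma exists_restrict_pullback_iso {X' Y' : Scheme.{u}} (f : Y ⟶ X) (j : X' ⟶ X)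
    (j' : Y' ⟶ Y) (g : Y' ⟶ X') [IsOpenImmersion j] [IsOpenImmersion j'] (h : j' ≫ f = g ≫ j)
    (M : X.Modules) :
    ∃ Φ : ((Scheme.Modules.pullback f).obj M).restrict j' ≅
      (Scheme.Modules.pullback g).obj (M.restrict j), ∀ (W : Y'.Opens) (V : X.Opens)
      (V' : X'.Opens) (hV : j ''ᵁ V' ≤ V) (hW : j' ''ᵁ W ≤ f ⁻¹ᵁ V) (hW' : W ≤ g ⁻¹ᵁ V')
      (e : Γ(M, V)),
      Φ.hom.app W (resSection ((Scheme.Modules.pullback f).obj M) hW (pullSection f M e)) =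
        resSection _ hW' (pullSection g (M.restrict j) (V := V') (resSection M hV e)) := by
  let a1 := (Scheme.Modules.pullbackPushforwardAdjunction f).comp
    (Scheme.Modules.restrictAdjunction j')
  let a2 := (Scheme.Modules.restrictAdjunction j).comp
    (Scheme.Modules.pullbackPushforwardAdjunction g)
  let i : Scheme.Modules.pushforward j' ⋙ Scheme.Modules.pushforward f ≅
      Scheme.Modules.pushforward g ⋙ Scheme.Modules.pushforward j :=
    Scheme.Modules.pushforwardComp j' f ≪≫ Scheme.Modules.pushforwardCongr h ≪≫
      (Scheme.Modules.pushforwardComp g j).symm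
  let Φ := (a1.ofNatIsoRight i).leftAdjointUniq a2
  have hu := (a1.ofNatIsoRight i).unit_leftAdjointUniq_hom_app a2 M
  refine ⟨Φ.app M, fun W V V' hV hW hW' e => ?_⟩
  have h2 := congr(($hu).app V e)
  have hle : j' ''ᵁ (g ⁻¹ᵁ j ⁻¹ᵁ V) ≤ f ⁻¹ᵁ V := by
    rintro _ ⟨y, hy, rfl⟩
    have h3 : (j' ≫ f) y = (g ≫ j) y := by rw [h]
    change (j' ≫ f) y ∈ V
    rw [h3]
    exact hy
  have hVV : V' ≤ j ⁻¹ᵁ V := by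
    rintro y hy
    exact hV ⟨y, hy, rfl⟩
  have hWV : W ≤ g ⁻¹ᵁ j ⁻¹ᵁ V := hW'.trans (g.preimage_mono hVV)
  have h3 : ((a1.ofNatIsoRight i).unit.app M).app V e =
      resSection ((Scheme.Modules.pullback f).obj M) hle (pullSection f M e) := by
    simp [a1, i]
    have h5 : j' ''ᵁ (g ⁻¹ᵁ j ⁻¹ᵁ V) ≤ j' ''ᵁ (j' ⁻¹ᵁ f ⁻¹ᵁ V) := by
      rw [← Scheme.Hom.comp_preimage, ← Scheme.Hom.comp_preimage, h]
    exact resSection_resSection ((Scheme.Modules.pullback f).obj M)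
      (j'.image_preimage_le (f ⁻¹ᵁ V)) h5 (pullSection f M e)
  have h4 : (Φ.hom.app M).app _ (resSection ((Scheme.Modules.pullback f).obj M) hle
      (pullSection f M e)) = pullSection g (M.restrict j) (V := j ⁻¹ᵁ V)
        (resSection M (j.image_preimage_le V) e) := by
    refine (congrArg _ h3.symm).trans (h2.trans ?_)
    simp only [a2, Adjunction.comp_unit_app]
    rfl
  have h5 := hom_app_resSection (Φ.hom.app M) hWV
    (resSection ((Scheme.Modules.pullback f).obj M) hle (pullSection f M e))
  have h6 := resSection_resSection ((Scheme.Modules.pullback f).obj M) hle (j'.image_mono hWV)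
      (pullSection f M e)
  have h7 := resSection_pullSection g (M.restrict j) (V := j ⁻¹ᵁ V) hVV
    (resSection M (j.image_preimage_le V) e)
  have h8 : resSection (M.restrict j) hVV (resSection M (j.image_preimage_le V) e) =
    resSection M hV e := resSection_resSection M (j.image_preimage_le V) (j.image_mono hVV) e
  have h9 := resSection_resSection ((Scheme.Modules.pullback g).obj (M.restrict j))
    (g.preimage_mono hVV) hW' (pullSection g (M.restrict j) (V := j ⁻¹ᵁ V)
        (resSection M (j.image_preimage_le V) e))
  refine (congrArg _ h6.symm).trans (h5.trans ((congrArg _ h4).trans (h9.symm.trans ?_)))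
  exact congrArg _ (h7.trans (congrArg _ h8))

/-- The pullback of a frame is a frame; restricting to the open subset on which it is defined
reduces this to global frames. -/
lemma IsFrame.pullSection (f : Y ⟶ X) {M : X.Modules} {V : X.Opens} {e : Γ(M, V)}
    (he : IsFrame M e) : IsFrame _ (pullSection f M e) := by
  obtain ⟨Φ, hΦ⟩ := exists_restrict_pullback_iso f V.ι (f ⁻¹ᵁ V).ι (f ∣_ V)
    (morphismRestrict_ι f V).symm M
  have hV : V.ι ''ᵁ ⊤ ≤ V := by simp
  have hW : (f ⁻¹ᵁ V).ι ''ᵁ ⊤ ≤ f ⁻¹ᵁ V := by simp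
  have h1 := (((isFrame_restrict_iff V.ι (V := ⊤)).2 (he.res hV)).pullSection_top (f ∣_ V))
  have h2 := hΦ ⊤ V ⊤ hV hW le_top e
  have h5 : IsFrame _ (resSection ((Scheme.Modules.pullback f).obj M) hW
      (_root_.pullSection f M e)) :=
    (isFrame_restrict_iff (f ⁻¹ᵁ V).ι (V := ⊤)).1
      (IsFrame.of_iso Φ ((congrArg (IsFrame _) h2).mpr (h1.res (V' := ⊤) le_top)))
  have hW' : f ⁻¹ᵁ V ≤ (f ⁻¹ᵁ V).ι ''ᵁ ⊤ := by simp
  have h6 := h5.res hW'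
  rw [resSection_resSection] at h6
  simpa [resSection] using h6

lemma IsLineBundle.exists_frame {M : X.Modules} (hM : IsLineBundle M) (x : X) :
    ∃ (V : X.Opens) (_ : x ∈ V) (e : Γ(M, V)), IsFrame M e := by
  obtain ⟨V, hxV, ⟨ε⟩⟩ := hM x
  let ε' : M.restrict V.ι ≅ unitModule V := ε
  have h1 := (isFrame_one (X := V)).map_iso ε'.inv
  have h2 := (isFrame_restrict_iff V.ι).1 h1
  refine ⟨V.ι ''ᵁ ⊤, by simpa using hxV, _, h2⟩

end Frames

/-! ### Sections of line bundles over affine opens -/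

section Sections

variable {X : Scheme.{u}}

/-- The restriction homomorphism `Γ(X, V) → Γ(X, V')`. -/
abbrev ringRes {V V' : X.Opens} (h : V' ≤ V) : Γ(X, V) →+* Γ(X, V') :=
  (X.presheaf.map (homOfLE h).op).hom

lemma ringRes_ringRes {V V' V'' : X.Opens} (h : V' ≤ V) (h' : V'' ≤ V') (r : Γ(X, V)) :
    ringRes h' (ringRes h r) = ringRes (h'.trans h) r := by
  simp only [ringRes, ← CommRingCat.comp_apply, ← Functor.map_comp]
  rfl

lemma basicOpen_ringRes {V V' : X.Opens} (h : V' ≤ V) (r : Γ(X, V)) :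
    X.basicOpen (ringRes h r) = V' ⊓ X.basicOpen r := X.basicOpen_res r (homOfLE h).op

variable {M : X.Modules}

lemma resSection_smul {V V' : X.Opens} (h : V' ≤ V) (r : Γ(X, V)) (x : Γ(M, V)) :
    resSection M h (r • x) = ringRes h r • resSection M h x := M.map_smul (homOfLE h) r x

lemma section_eq_of_cover {ι : Type*} {W : X.Opens} {V : ι → X.Opens} (hV : ∀ i, V i ≤ W)
    (hc : W ≤ ⨆ i, V i) {x y : Γ(M, W)}
    (h : ∀ i, resSection M (hV i) x = resSection M (hV i) y) : x = y :=
  TopCat.Sheaf.eq_of_locally_eq' ⟨M.presheaf, M.isSheaf⟩ V W (fun i => homOfLE (hV i)) hc x y h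

lemma section_glue {ι : Type*} {W : X.Opens} {V : ι → X.Opens} (hV : ∀ i, V i ≤ W)
    (hc : W ≤ ⨆ i, V i) (x : ∀ i, Γ(M, V i))
    (h : ∀ i j, resSection M (inf_le_left : V i ⊓ V j ≤ V i) (x i) =
      resSection M (inf_le_right : V i ⊓ V j ≤ V j) (x j)) :
    ∃ y : Γ(M, W), ∀ i, resSection M (hV i) y = x i :=
  (TopCat.Sheaf.existsUnique_gluing' ⟨M.presheaf, M.isSheaf⟩ V W (fun i => homOfLE (hV i)) hc x
    h).exists

/-- A module that is locally free of rank one, witnessed by frames. -/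
def IsLocallyFramed (M : X.Modules) : Prop :=
  ∀ x : X, ∃ (V : X.Opens) (_ : x ∈ V) (e : Γ(M, V)), IsFrame M e

lemma IsFrame.exists_pow_smul_eq_zero {V W : X.Opens} (hW : IsAffineOpen W) (hWV : W ≤ V)
    {e : Γ(M, V)} (he : IsFrame M e) (g : Γ(X, W)) {x : Γ(M, W)}
    (hx : resSection M (X.basicOpen_le g) x = 0) : ∃ n : ℕ, g ^ n • x = 0 := by
  obtain ⟨r, rfl⟩ := (he W hWV).2 x
  dsimp only at hx ⊢
  have h0 : ringRes (X.basicOpen_le g) r = 0 := by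
    refine (he _ ((X.basicOpen_le g).trans hWV)).1 ?_
    rw [resSection_smul, resSection_resSection] at hx
    dsimp only
    rw [hx, zero_smul]
  obtain ⟨n, hn⟩ := exists_pow_mul_eq_zero_of_res_basicOpen_eq_zero_of_isAffineOpen X hW r g h0
  exact ⟨n, by rw [smul_smul, hn, zero_smul]⟩

lemma IsFrame.exists_resSection_eq_pow_smul {V W : X.Opens} (hW : IsAffineOpen W) (hWV : W ≤ V)
    {e : Γ(M, V)} (he : IsFrame M e) (g : Γ(X, W)) (y : Γ(M, X.basicOpen g)) :
    ∃ (n : ℕ) (x : Γ(M, W)), resSection M (X.basicOpen_le g) x =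
      ringRes (X.basicOpen_le g) (g ^ n) • y := by
  obtain ⟨r, rfl⟩ := (he _ ((X.basicOpen_le g).trans hWV)).2 y
  obtain ⟨n, a, ha⟩ := exists_eq_pow_mul_of_isAffineOpen X W hW g r
  refine ⟨n, a • resSection M hWV e, ?_⟩
  have ha' : ringRes (X.basicOpen_le g) a = ringRes (X.basicOpen_le g) g ^ n * r := ha
  rw [resSection_smul, ha', resSection_resSection, smul_smul, map_pow]

lemma IsLocallyFramed.exists_cover (hM : IsLocallyFramed M) {W : X.Opens} (hW : IsAffineOpen W) :
    ∃ s : Finset Γ(X, W), W ≤ ⨆ f : s, X.basicOpen f.1 ∧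
      ∀ f : s, ∃ (V : X.Opens) (_ : X.basicOpen f.1 ≤ V) (e : Γ(M, V)), IsFrame M e := by
  let S : Set Γ(X, W) := {f | ∃ (V : X.Opens) (_ : X.basicOpen f ≤ V) (e : Γ(M, V)), IsFrame M e}
  have hS : Ideal.span S = ⊤ := by
    rw [← hW.self_le_iSup_basicOpen_iff]
    intro x hx
    obtain ⟨V, hxV, e, he⟩ := hM x
    obtain ⟨f, hf, hxf⟩ := hW.exists_basicOpen_le ⟨x, hxV⟩ hx
    exact Opens.mem_iSup.2 ⟨⟨f, V, hf, e, he⟩, hxf⟩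
  obtain ⟨s, hsS, hs⟩ := (Ideal.span_eq_top_iff_finite S).1 hS
  exact ⟨s, hW.self_le_iSup_basicOpen_iff.2 hs, fun f => hsS f.2⟩

lemma resSection_eq_zero_of_le {W V : X.Opens} {x : Γ(M, W)} (h : V ≤ W) {V' : X.Opens}
    (h' : V' ≤ V) (hx : resSection M h x = 0) : resSection M (h'.trans h) x = 0 := by
  rw [← resSection_resSection M h h', hx]
  exact map_zero _

/-- A section over an affine open `W` that vanishes on `D(g)` is killed by a power of `g`. With
`IsLocallyFramed.exists_resSection_eq_pow_smul`, this says that `Γ(M, D(g))` is the localization of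
`Γ(M, W)` at the powers of `g`. -/
lemma IsLocallyFramed.exists_pow_smul_eq_zero (hM : IsLocallyFramed M) {W : X.Opens}
    (hW : IsAffineOpen W) (g : Γ(X, W)) {x : Γ(M, W)}
    (hx : resSection M (X.basicOpen_le g) x = 0) : ∃ n : ℕ, g ^ n • x = 0 := by
  obtain ⟨s, hs, hs'⟩ := hM.exists_cover hW
  have key : ∀ f : s, ∃ n : ℕ, resSection M (X.basicOpen_le f.1) (g ^ n • x) = 0 := fun f => by
    obtain ⟨V, hV, e, he⟩ := hs' f
    have h1 : X.basicOpen (ringRes (X.basicOpen_le f.1) g) ≤ X.basicOpen g := by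
      rw [basicOpen_ringRes]; exact inf_le_right
    obtain ⟨n, hn⟩ := he.exists_pow_smul_eq_zero (hW.basicOpen f.1) hV
      (ringRes (X.basicOpen_le f.1) g) (x := resSection M (X.basicOpen_le f.1) x) (by
        rw [resSection_resSection]
        exact resSection_eq_zero_of_le (X.basicOpen_le g) h1 hx)
    exact ⟨n, by rw [resSection_smul, map_pow, hn]⟩
  choose n hn using key
  refine ⟨s.attach.sup n, section_eq_of_cover (fun f : s => X.basicOpen_le f.1) hs fun f => ?_⟩
  obtain ⟨m, hm⟩ := Nat.exists_eq_add_of_le (Finset.le_sup (f := n) (Finset.mem_attach s f))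
  rw [hm, add_comm, pow_add, mul_smul, resSection_smul, hn, smul_zero]
  exact (map_zero _).symm

/-- A section over the open subset `D(g)` of an affine open `W` extends to `W` after multiplication
with a power of `g`. -/
lemma IsLocallyFramed.exists_resSection_eq_pow_smul (hM : IsLocallyFramed M) {W : X.Opens}
    (hW : IsAffineOpen W) (g : Γ(X, W)) (y : Γ(M, X.basicOpen g)) :
    ∃ (n : ℕ) (x : Γ(M, W)), resSection M (X.basicOpen_le g) x =
      ringRes (X.basicOpen_le g) (g ^ n) • y := by
  obtain ⟨s, hs, hs'⟩ := hM.exists_cover hW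
  have hle : ∀ f : s, X.basicOpen (ringRes (X.basicOpen_le f.1) g) ≤ X.basicOpen g := fun f => by
    rw [basicOpen_ringRes]; exact inf_le_right
  have key : ∀ f : s, ∃ (n : ℕ) (x : Γ(M, X.basicOpen f.1)),
      resSection M (X.basicOpen_le _) x = resSection M (hle f)
        (ringRes (X.basicOpen_le g) (g ^ n) • y) := fun f => by
    obtain ⟨V, hV, e, he⟩ := hs' f
    obtain ⟨n, x, hx⟩ := he.exists_resSection_eq_pow_smul (hW.basicOpen f.1) hV
      (ringRes (X.basicOpen_le f.1) g) (resSection M (hle f) y)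
    refine ⟨n, x, hx.trans ?_⟩
    rw [resSection_smul, ← map_pow, ringRes_ringRes, ringRes_ringRes]
  choose n x hx using key
  -- one exponent `m` for all members of the finite cover
  let m := s.attach.sup n
  have key2 : ∀ f : s, ∃ (x : Γ(M, X.basicOpen f.1)),
      resSection M (X.basicOpen_le _) x = resSection M (hle f)
        (ringRes (X.basicOpen_le g) (g ^ m) • y) := fun f => by
    obtain ⟨c, hc⟩ := Nat.exists_eq_add_of_le (Finset.le_sup (f := n) (Finset.mem_attach s f))
    refine ⟨ringRes (X.basicOpen_le f.1) (g ^ c) • x f, ?_⟩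
    rw [resSection_smul, hx, ringRes_ringRes, resSection_smul, ringRes_ringRes, smul_smul,
      ← map_mul, ← pow_add, resSection_smul, ringRes_ringRes, add_comm, ← hc]
  choose x' hx' using key2
  -- the local extensions agree on overlaps after multiplication with a further power of `g`
  have key3 : ∀ f f' : s, ∃ N : ℕ, ringRes (inf_le_left.trans (X.basicOpen_le f.1)) (g ^ N) •
      (resSection M (inf_le_left : X.basicOpen f.1 ⊓ X.basicOpen f'.1 ≤ _) (x' f) -
        resSection M (inf_le_right : X.basicOpen f.1 ⊓ X.basicOpen f'.1 ≤ _) (x' f')) = 0 :=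
      fun f f' => by
    obtain ⟨V, hV, e, he⟩ := hs' f
    have haff : IsAffineOpen (X.basicOpen f.1 ⊓ X.basicOpen f'.1) := by
      rw [← X.basicOpen_mul]; exact hW.basicOpen _
    obtain ⟨N, hN⟩ := he.exists_pow_smul_eq_zero haff (inf_le_left.trans hV)
      (ringRes (inf_le_left.trans (X.basicOpen_le f.1)) g)
      (x := resSection M (inf_le_left : X.basicOpen f.1 ⊓ X.basicOpen f'.1 ≤ _) (x' f) -
        resSection M (inf_le_right : X.basicOpen f.1 ⊓ X.basicOpen f'.1 ≤ _) (x' f')) (by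
        refine (map_sub _ _ _).trans (sub_eq_zero.2 ?_)
        change resSection M _ (resSection M _ _) = resSection M _ (resSection M _ _)
        rw [resSection_resSection, resSection_resSection]
        have h1 : X.basicOpen (ringRes (inf_le_left.trans (X.basicOpen_le f.1) :
            X.basicOpen f.1 ⊓ X.basicOpen f'.1 ≤ _) g) ≤
            X.basicOpen (ringRes (X.basicOpen_le f.1) g) := by
          rw [basicOpen_ringRes, basicOpen_ringRes]
          exact inf_le_inf inf_le_left le_rfl
        have h2 : X.basicOpen (ringRes (inf_le_left.trans (X.basicOpen_le f.1) :
            X.basicOpen f.1 ⊓ X.basicOpen f'.1 ≤ _) g) ≤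
            X.basicOpen (ringRes (X.basicOpen_le f'.1) g) := by
          rw [basicOpen_ringRes, basicOpen_ringRes]
          exact inf_le_inf inf_le_right le_rfl
        have e1 := congrArg (resSection M h1) (hx' f)
        have e2 := congrArg (resSection M h2) (hx' f')
        rw [resSection_resSection, resSection_resSection] at e1 e2
        exact e1.trans e2.symm)
    exact ⟨N, by rw [map_pow, hN]⟩
  choose N hN using key3
  let N' := s.attach.sup fun f => s.attach.sup (N f)
  obtain ⟨z, hz⟩ := section_glue (fun f : s => X.basicOpen_le f.1) hs
    (fun f => ringRes (X.basicOpen_le f.1) (g ^ N') • x' f) (fun f f' => by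
      obtain ⟨c, hc⟩ := Nat.exists_eq_add_of_le
        ((Finset.le_sup (f := N f) (Finset.mem_attach s f')).trans
          (Finset.le_sup (f := fun f => s.attach.sup (N f)) (Finset.mem_attach s f)))
      rw [resSection_smul, resSection_smul, ringRes_ringRes, ringRes_ringRes, ← sub_eq_zero,
        ← smul_sub, show N' = c + N f f' from hc.trans (add_comm _ _), pow_add, map_mul, mul_smul,
        hN, smul_zero])
  refine ⟨N' + m, z, ?_⟩
  refine section_eq_of_cover (V := fun f : s => X.basicOpen (ringRes (X.basicOpen_le f.1) g))
    hle ?_ fun f => ?_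
  · intro a ha
    obtain ⟨f, hf⟩ := Opens.mem_iSup.1 (hs (X.basicOpen_le g ha))
    refine Opens.mem_iSup.2 ⟨f, ?_⟩
    rw [basicOpen_ringRes]
    exact ⟨hf, ha⟩
  · rw [resSection_resSection, ← resSection_resSection M (X.basicOpen_le f.1) (X.basicOpen_le _),
      hz, resSection_smul, hx', ringRes_ringRes, resSection_smul, ringRes_ringRes, smul_smul,
      ← map_mul, ← pow_add, resSection_smul, ringRes_ringRes]

lemma IsLineBundle.isLocallyFramed (hM : IsLineBundle M) : IsLocallyFramed M := hM.exists_frame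

lemma IsLocallyFramed.pullback {Y : Scheme.{u}} (hM : IsLocallyFramed M) (f : Y ⟶ X) :
    IsLocallyFramed ((Scheme.Modules.pullback f).obj M) := fun y => by
  obtain ⟨V, hV, e, he⟩ := hM (f y)
  exact ⟨f ⁻¹ᵁ V, hV, pullSection f M e, he.pullSection f⟩

end Sections

/-! ### Functoriality of twisted forms over rings -/

section AlgForms

variable {k : Type*} [CommRing k]

section Induction

variable {A : Type*} [CommRing A] [Algebra k A] {P : Type*} [AddCommGroup P] [Module A P] {q : ℕ}

/-- Twisted forms are sums of elements `da₁ ∧ ⋯ ∧ da_q ⊗ x`. -/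
lemma AlgTwistedForms.induction_on {motive : AlgTwistedForms k A P q → Prop}
    (ω : AlgTwistedForms k A P q) (zero : motive 0)
    (tmul : ∀ (a : Fin q → A) (x : P),
      motive (exteriorPower.ιMulti A q (fun i => KaehlerDifferential.D k A (a i)) ⊗ₜ x))
    (add : ∀ x y, motive x → motive y → motive (x + y)) : motive ω := by
  induction ω using TensorProduct.induction_on with
  | zero => exact zero
  | add x y hx hy => exact add x y hx hy
  | tmul η x =>
    have hη : η ∈ (⊤ : Submodule A (⋀[A]^q Ω[A⁄k])) := trivial
    rw [← exteriorPower.ιMulti_span_of_span A q _ (KaehlerDifferential.span_range_derivation k A)]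
      at hη
    induction hη using Submodule.span_induction generalizing x with
    | mem η h =>
      obtain ⟨v, hv, rfl⟩ := h
      choose a ha using fun i => hv (Set.mem_range_self i)
      obtain rfl : (fun i => KaehlerDifferential.D k A (a i)) = v := funext ha
      exact tmul a x
    | zero => rw [TensorProduct.zero_tmul]; exact zero
    | add η η' _ _ h h' => rw [TensorProduct.add_tmul]; exact add _ _ (h x) (h' x)
    | smul r η _ h => rw [TensorProduct.smul_tmul]; exact h _

end Induction

variable {A B C : Type*} [CommRing A] [CommRing B] [CommRing C] [Algebra k A] [Algebra k B]
  [Algebra k C] {P Q R : Type*} [AddCommGroup P] [Module A P] [AddCommGroup Q] [Module B Q]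
  [AddCommGroup R] [Module C R] {q : ℕ}

lemma semilinearFormsMap_comp {φ : A →ₐ[k] B} {m : P →ₛₗ[φ.toRingHom] Q} {φ' : B →ₐ[k] C}
    {m' : Q →ₛₗ[φ'.toRingHom] R} {φ'' : A →ₐ[k] C} {m'' : P →ₛₗ[φ''.toRingHom] R}
    (hφ : ∀ a, φ' (φ a) = φ'' a) (hm : ∀ x, m' (m x) = m'' x) (ω : AlgTwistedForms k A P q) :
    semilinearFormsMap φ' m' q (semilinearFormsMap φ m q ω) = semilinearFormsMap φ'' m'' q ω := by
  induction ω using AlgTwistedForms.induction_on with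
  | zero => simp only [map_zero]
  | add x y hx hy => simp only [map_add, hx, hy]
  | tmul a x => simp only [semilinearFormsMap_apply, hφ, hm]

lemma semilinearFormsMap_smul (φ : A →ₐ[k] B) (m : P →ₛₗ[φ.toRingHom] Q) (r : A)
    (ω : AlgTwistedForms k A P q) :
    semilinearFormsMap φ m q (r • ω) = φ r • semilinearFormsMap φ m q ω := by
  induction ω using AlgTwistedForms.induction_on with
  | zero => simp only [map_zero, smul_zero]
  | add x y hx hy => simp only [map_add, hx, hy, smul_add]
  | tmul a x =>
    rw [← TensorProduct.tmul_smul, semilinearFormsMap_apply, semilinearFormsMap_apply,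
      ← TensorProduct.tmul_smul]
    exact congrArg _ (m.map_smulₛₗ r x)

lemma semilinearFormsMap_id {φ : A →ₐ[k] A} {m : P →ₛₗ[φ.toRingHom] P}
    (hφ : ∀ a, φ a = a) (hm : ∀ x, m x = x) (ω : AlgTwistedForms k A P q) :
    semilinearFormsMap φ m q ω = ω := by
  induction ω using AlgTwistedForms.induction_on with
  | zero => simp only [map_zero]
  | add x y hx hy => simp only [map_add, hx, hy]
  | tmul a x => simp only [semilinearFormsMap_apply, hφ, hm]

/-- If `B` is the localization of `A` at the powers of `g`, and `m` exhibits `Q` as the localization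
of `P`, then twisted forms localize too: forms with image `0` are killed by a power of `g`, and
every form over `B` is the image of a form over `A` up to a power of `g`. -/
lemma isLocalizedModule_semilinearFormsMap (φ : A →ₐ[k] B) (m : P →ₛₗ[φ.toRingHom] Q) (g : A)
    (hφ : letI := φ.toRingHom.toAlgebra; IsLocalization.Away g B)
    (hm0 : ∀ x, m x = 0 → ∃ n : ℕ, g ^ n • x = 0)
    (hms : ∀ y, ∃ (n : ℕ) (x : P), m x = φ (g ^ n) • y) :
    (∀ ω : AlgTwistedForms k A P q, semilinearFormsMap φ m q ω = 0 → ∃ n : ℕ, g ^ n • ω = 0) ∧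
      ∀ η : AlgTwistedForms k B Q q, ∃ (n : ℕ) (ω : AlgTwistedForms k A P q),
        semilinearFormsMap φ m q ω = φ (g ^ n) • η := by
  let : Algebra A B := φ.toRingHom.toAlgebra
  let : Module A Q := Module.compHom Q φ.toRingHom
  have : IsScalarTower k A B := IsScalarTower.of_algebraMap_eq (fun r => (φ.commutes r).symm)
  have : IsScalarTower A B Q := IsScalarTower.of_algebraMap_smul (fun _ _ => rfl)
  have : IsLocalization (Submonoid.powers g) B := hφ
  let m' : P →ₗ[A] Q := { toFun := m, map_add' := m.map_add, map_smul' := m.map_smulₛₗ }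
  have : IsLocalizedModule (Submonoid.powers g) m' := by
    refine ⟨?_, ?_, ?_⟩
    · rintro ⟨_, n, rfl⟩
      have hu : IsUnit (algebraMap A B (g ^ n)) :=
        IsLocalization.map_units B (⟨g ^ n, n, rfl⟩ : Submonoid.powers g)
      rw [Module.End.isUnit_iff]
      have h2 : Function.Bijective fun y : Q => hu.unit • y := MulAction.bijective _
      exact h2
    · intro y
      obtain ⟨n, x, hx⟩ := hms y
      exact ⟨⟨x, ⟨g ^ n, n, rfl⟩⟩, hx.symm⟩
    · intro x y h
      obtain ⟨n, hn⟩ := hm0 (x - y) ((map_sub m x y).trans (sub_eq_zero.2 h))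
      exact ⟨⟨g ^ n, n, rfl⟩, by rwa [smul_sub, sub_eq_zero] at hn⟩
  have hL := isLocalizedModule_algTwistedFormsMap k (B := B) (Submonoid.powers g) m' q
  refine ⟨fun ω h => ?_, fun η => ?_⟩
  · obtain ⟨⟨_, n, rfl⟩, h⟩ := hL.exists_of_eq (x₁ := ω) (x₂ := 0)
      (Eq.trans (b := 0) h (map_zero (algTwistedFormsMap k A B m' q)).symm)
    exact ⟨n, h.trans (smul_zero _)⟩
  · obtain ⟨⟨ω, _, n, rfl⟩, h⟩ := hL.surj η
    refine ⟨n, ω, h.symm.trans ?_⟩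
    exact algebra_compatible_smul B (g ^ n) η

end AlgForms

/-! ### Functoriality of twisted forms on schemes -/

section SchemeForms

variable {k : Type u} [Field k] {X Y : Scheme.{u}} (p : X ⟶ Spec (.of k)) (M : X.Modules) (q : ℕ)

lemma formsRes_formsRes {V V' V'' : X.Opens} (h : V' ≤ V) (h' : V'' ≤ V') (ω : FormsOn p M q V) :
    formsRes p M q V' V'' h' (formsRes p M q V V' h ω) = formsRes p M q V V'' (h'.trans h) ω :=
  semilinearFormsMap_comp (A := SecRing p V) (B := SecRing p V') (C := SecRing p V'')
    (fun a => ringRes_ringRes h h' a) (fun x => resSection_resSection M h h' x) ω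

lemma formsRes_self {V : X.Opens} (h : V ≤ V) (ω : FormsOn p M q V) :
    formsRes p M q V V h ω = ω := by
  have h1 : ∀ a : SecRing p V, secRingRes p V V h a = a := fun a =>
    ConcreteCategory.congr_hom (X.presheaf.map_id (.op V)) a
  have h2 : ∀ x : Γ(M, V), moduleRes p M V V h x = x := fun x =>
    ConcreteCategory.congr_hom (M.presheaf.map_id (.op V)) x
  exact semilinearFormsMap_id (A := SecRing p V) h1 h2 ω

lemma formsRes_smul {V V' : X.Opens} (h : V' ≤ V) (r : SecRing p V) (ω : FormsOn p M q V) :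
    formsRes p M q V V' h (r • ω) = secRingRes p V V' h r • formsRes p M q V V' h ω :=
  semilinearFormsMap_smul _ _ r ω

lemma formsPullback_smul (f : Y ⟶ X) {V : X.Opens} {W : Y.Opens} (h : W ≤ f ⁻¹ᵁ V)
    (r : SecRing p V) (ω : FormsOn p M q V) :
    formsPullback p f M q V W h (r • ω) =
      secRingMap p f V W h r • formsPullback p f M q V W h ω :=
  semilinearFormsMap_smul _ _ r ω

lemma formsRes_formsPullback (f : Y ⟶ X) {V : X.Opens} {W W' : Y.Opens} (h : W ≤ f ⁻¹ᵁ V)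
    (h' : W' ≤ W) (ω : FormsOn p M q V) :
    formsRes (f ≫ p) _ q W W' h' (formsPullback p f M q V W h ω) =
      formsPullback p f M q V W' (h'.trans h) ω :=
  semilinearFormsMap_comp (A := SecRing p V) (B := SecRing (f ≫ p) W) (C := SecRing (f ≫ p) W')
    (fun a => by exact ConcreteCategory.congr_hom (f.appLE_map h (homOfLE h').op) a)
    (fun x => resSection_resSection ((Scheme.Modules.pullback f).obj M) h h' _) ω

lemma formsPullback_formsRes (f : Y ⟶ X) {V V' : X.Opens} {W : Y.Opens} (h : W ≤ f ⁻¹ᵁ V')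
    (h' : V' ≤ V) (ω : FormsOn p M q V) :
    formsPullback p f M q V' W h (formsRes p M q V V' h' ω) =
      formsPullback p f M q V W (h.trans (f.preimage_mono h')) ω :=
  semilinearFormsMap_comp (A := SecRing p V) (B := SecRing p V') (C := SecRing (f ≫ p) W)
    (fun a => by exact ConcreteCategory.congr_hom (f.map_appLE h (homOfLE h').op) a)
    (fun x => by
      have h1 := (resSection_pullSection f M h' x).symm
      refine (congrArg (resSection ((Scheme.Modules.pullback f).obj M) h) h1).trans ?_
      exact resSection_resSection ((Scheme.Modules.pullback f).obj M) (f.preimage_mono h') h _) ω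

variable {M}

/-- Over an affine open `W`, the forms on `D(g)` are the localization of the forms on `W` at the
powers of `g`. -/
lemma formsRes_isLocalized (hM : IsLocallyFramed M) {W : X.Opens} (hW : IsAffineOpen W)
    (g : Γ(X, W)) :
    (∀ ω : FormsOn p M q W, formsRes p M q W _ (X.basicOpen_le g) ω = 0 →
      ∃ n : ℕ, (show SecRing p W from g ^ n) • ω = 0) ∧
    ∀ η : FormsOn p M q (X.basicOpen g), ∃ (n : ℕ) (ω : FormsOn p M q W),
      formsRes p M q W _ (X.basicOpen_le g) ω =
        secRingRes p W _ (X.basicOpen_le g) (show SecRing p W from g ^ n) • η :=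
  isLocalizedModule_semilinearFormsMap (secRingRes p W _ (X.basicOpen_le g))
    (moduleRes p M W _ (X.basicOpen_le g)) (show SecRing p W from g)
    (hW.isLocalization_of_eq_basicOpen g (homOfLE (X.basicOpen_le g)) rfl)
    (fun _ h => hM.exists_pow_smul_eq_zero hW g h)
    (fun y => hM.exists_resSection_eq_pow_smul hW g y)

end SchemeForms

/-! ### Gluing twisted forms -/

section AlgGlue

variable {R N : Type*} [CommRing R] [AddCommGroup N] [Module R N]

lemma eq_zero_of_forall_pow_smul_eq_zero {S : Set R} (hS : Ideal.span S = ⊤) {x : N}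
    (h : ∀ g ∈ S, ∃ n : ℕ, g ^ n • x = 0) : x = 0 := by
  choose n hn using h
  have h1 := Ideal.span_range_pow_eq_top S hS fun g => n g.1 g.2
  have h2 : Ideal.span (Set.range fun g : S => g.1 ^ n g.1 g.2) ≤
      LinearMap.ker (LinearMap.toSpanSingleton R N x) := by
    rw [Ideal.span_le]
    rintro _ ⟨g, rfl⟩
    exact hn g.1 g.2
  have h3 : (1 : R) ∈ LinearMap.ker (LinearMap.toSpanSingleton R N x) := h2 (h1 ▸ trivial)
  simpa using h3

/-- Gluing the fractions `n i / h i ^ m`: if they agree on overlaps, up to torsion that is killed by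
`(h i * h j) ^ K`, they are all equal to one element `x`. A partition of unity
`1 = ∑ a j * h j ^ (m + K)` gives `x = ∑ a j h j ^ K n j`. -/
lemma exists_pow_smul_eq_of_compatible {ι : Type*} [Finite ι] {h : ι → R}
    (hh : Ideal.span (Set.range h) = ⊤) {n : ι → N} {m K : ℕ}
    (hn : ∀ i j, (h i * h j) ^ K • (h j ^ m • n i - h i ^ m • n j) = 0) :
    ∃ x : N, ∀ i, h i ^ (m + K) • x = h i ^ K • n i := by
  have := Fintype.ofFinite ι
  have h1 : Ideal.span (Set.range fun i => h i ^ (m + K)) = ⊤ := by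
    have := Ideal.span_pow_eq_top _ hh (m + K)
    rwa [← Set.range_comp] at this
  obtain ⟨a, ha⟩ := (Ideal.mem_span_range_iff_exists_fun (x := (1 : R))).1
    (h1.ge Submodule.mem_top)
  refine ⟨∑ j, a j • h j ^ K • n j, fun i => ?_⟩
  have key : ∀ j, h i ^ (m + K) • h j ^ K • n j = h j ^ (m + K) • h i ^ K • n i := fun j => by
    have := hn i j
    rw [smul_sub, sub_eq_zero] at this
    simp only [smul_smul] at this ⊢
    rw [show h i ^ (m + K) * h j ^ K = (h i * h j) ^ K * h i ^ m by ring, ← this]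
    ring_nf
  calc h i ^ (m + K) • ∑ j, a j • h j ^ K • n j
      = ∑ j, a j • h i ^ (m + K) • h j ^ K • n j := by
        rw [Finset.smul_sum]
        exact Finset.sum_congr rfl fun j _ => smul_comm _ _ _
    _ = (∑ j, a j * h j ^ (m + K)) • h i ^ K • n i := by
        rw [Finset.sum_smul]
        exact Finset.sum_congr rfl fun j _ => by rw [key, mul_smul]
    _ = h i ^ K • n i := by rw [ha, one_smul]

end AlgGlue

section SchemeGlue

variable {k : Type u} [Field k] {X : Scheme.{u}} {p : X ⟶ Spec (.of k)} {M : X.Modules} {q : ℕ}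

lemma forms_eq_zero_of_locally (hM : IsLocallyFramed M) {W : X.Opens} (hW : IsAffineOpen W)
    {ω : FormsOn p M q W}
    (h : ∀ x ∈ W, ∃ (V : X.Opens) (_ : x ∈ V) (hV : V ≤ W), formsRes p M q W V hV ω = 0) :
    ω = 0 := by
  let S : Set (SecRing p W) := {g | ∃ n : ℕ, g ^ n • ω = 0}
  refine eq_zero_of_forall_pow_smul_eq_zero (S := S) ?_ fun g hg => hg
  refine hW.self_le_iSup_basicOpen_iff.1 fun x hx => ?_
  obtain ⟨V, hxV, hV, h0⟩ := h x hx
  obtain ⟨g, hgV, hxg⟩ := hW.exists_basicOpen_le ⟨x, hxV⟩ hx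
  refine Opens.mem_iSup.2 ⟨⟨g, ?_⟩, hxg⟩
  refine (formsRes_isLocalized p q hM hW g).1 ω ?_
  rw [← formsRes_formsRes p M q hV hgV, h0, map_zero]

lemma forms_eq_of_locally (hM : IsLocallyFramed M) {W : X.Opens} (hW : IsAffineOpen W)
    {ω η : FormsOn p M q W}
    (h : ∀ x ∈ W, ∃ (V : X.Opens) (_ : x ∈ V) (hV : V ≤ W),
      formsRes p M q W V hV ω = formsRes p M q W V hV η) : ω = η := by
  refine sub_eq_zero.1 (forms_eq_zero_of_locally hM hW fun x hx => ?_)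
  obtain ⟨V, hxV, hV, h0⟩ := h x hx
  exact ⟨V, hxV, hV, by rw [map_sub, h0, sub_self]⟩

lemma isUnit_secRingRes_basicOpen {W : X.Opens} (g : SecRing p W) :
    IsUnit (secRingRes p W (X.basicOpen (show Γ(X, W) from g)) (X.basicOpen_le _) g) :=
  RingedSpace.isUnit_res_basicOpen _ (show Γ(X, W) from g)

/-- Compatible forms on finitely many basic open subsets that cover an affine open glue. -/
lemma forms_glue_basicOpen (hM : IsLocallyFramed M) {W : X.Opens} (hW : IsAffineOpen W)
    (s : Finset Γ(X, W)) (hs : W ≤ ⨆ f : s, X.basicOpen f.1)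
    (y : ∀ f : s, FormsOn p M q (X.basicOpen f.1))
    (hy : ∀ (f f' : s) (V : X.Opens) (_ : IsAffineOpen V) (h : V ≤ X.basicOpen f.1)
      (h' : V ≤ X.basicOpen f'.1), formsRes p M q _ V h (y f) = formsRes p M q _ V h' (y f')) :
    ∃ x : FormsOn p M q W, ∀ f : s, formsRes p M q W _ (X.basicOpen_le f.1) x = y f := by
  have h1 := fun f : s => (formsRes_isLocalized p q hM hW f.1).2 (y f)
  choose n ω hω using h1
  -- one exponent `m` for all members of the finite cover
  let m := s.attach.sup n
  have h2 : ∀ f : s, ∃ ω : FormsOn p M q W, formsRes p M q W _ (X.basicOpen_le f.1) ω =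
      secRingRes p W _ (X.basicOpen_le f.1) (show SecRing p W from f.1) ^ m • y f := fun f => by
    obtain ⟨c, hc⟩ := Nat.exists_eq_add_of_le (Finset.le_sup (f := n) (Finset.mem_attach s f))
    refine ⟨(show SecRing p W from f.1) ^ c • ω f, ?_⟩
    rw [formsRes_smul, hω, smul_smul, ← map_pow]
    rw [show m = c + n f from hc.trans (add_comm _ _), pow_add, map_mul]
    rfl
  choose η hη using h2
  -- the numerators `η f` agree on overlaps up to torsion
  let r : s → SecRing p W := fun f => f.1
  have h3 : ∀ f f' : s, ∃ K : ℕ, (r f * r f') ^ K • (r f' ^ m • η f - r f ^ m • η f') = 0 :=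
      fun f f' => by
    refine (formsRes_isLocalized p q hM hW (f.1 * f'.1)).1 _ ?_
    have hl : X.basicOpen (f.1 * f'.1) ≤ X.basicOpen f.1 :=
      (X.basicOpen_mul _ _).trans_le inf_le_left
    have hl' : X.basicOpen (f.1 * f'.1) ≤ X.basicOpen f'.1 :=
      (X.basicOpen_mul _ _).trans_le inf_le_right
    have e : ∀ (g : s) (hg : X.basicOpen (f.1 * f'.1) ≤ X.basicOpen g.1),
        formsRes p M q W (X.basicOpen (f.1 * f'.1)) (X.basicOpen_le _) (η g) =
          secRingRes p W (X.basicOpen (f.1 * f'.1)) (X.basicOpen_le _) (r g) ^ m •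
            formsRes p M q _ _ hg (y g) := fun g hg => by
      rw [← formsRes_formsRes p M q (X.basicOpen_le g.1) hg, hη, formsRes_smul, map_pow]
      congr 2
      exact ringRes_ringRes (X.basicOpen_le g.1) hg g.1
    rw [map_sub, formsRes_smul, formsRes_smul, e f hl, e f' hl', map_pow, map_pow, smul_smul,
      smul_smul, hy f f' _ (hW.basicOpen _) hl hl']
    exact sub_eq_zero.2 (congrArg (· • _) (mul_comm _ _))
  choose K hK using h3
  let K' := s.attach.sup fun f => s.attach.sup (K f)
  obtain ⟨x, hx⟩ := exists_pow_smul_eq_of_compatible (h := r) (n := η) (m := m) (K := K')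
    (by
      have h5 : Set.range (fun f : s => f.1) = (s : Set Γ(X, W)) := Subtype.range_coe
      have h6 := hW.self_le_iSup_basicOpen_iff.1 hs
      rw [← h5] at h6
      exact h6) (fun f f' => by
      obtain ⟨c, hc⟩ := Nat.exists_eq_add_of_le
        ((Finset.le_sup (f := K f) (Finset.mem_attach s f')).trans
          (Finset.le_sup (f := fun f => s.attach.sup (K f)) (Finset.mem_attach s f)))
      rw [show K' = c + K f f' from hc.trans (add_comm _ _), pow_add, mul_smul, hK, smul_zero])
  refine ⟨x, fun f => ?_⟩
  have h4 := congrArg (formsRes p M q W _ (X.basicOpen_le f.1)) (hx f)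
  rw [formsRes_smul, formsRes_smul, hη, smul_smul, map_pow, map_pow, ← pow_add, add_comm K'] at h4
  exact (((isUnit_secRingRes_basicOpen (p := p) (r f)).pow (m + K')).smul_left_cancel).1 h4

/-- Compatible forms on open subsets that cover an affine open `W` glue to a form on `W`. The
members of the cover need not be affine, hence compatibility and the result are expressed through
affine opens. -/
lemma forms_glue (hM : IsLocallyFramed M) {W : X.Opens} (hW : IsAffineOpen W) {ι : Type*}
    (V : ι → X.Opens) (hc : W ≤ ⨆ a, V a) (ω : ∀ a, FormsOn p M q (V a))
    (hω : ∀ (a b : ι) (V' : X.Opens) (_ : IsAffineOpen V') (h : V' ≤ V a) (h' : V' ≤ V b),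
      formsRes p M q _ V' h (ω a) = formsRes p M q _ V' h' (ω b)) :
    ∃ x : FormsOn p M q W, ∀ (a : ι) (V' : X.Opens) (_ : IsAffineOpen V') (h : V' ≤ W)
      (h' : V' ≤ V a), formsRes p M q _ V' h x = formsRes p M q _ V' h' (ω a) := by
  let S : Set Γ(X, W) := {f | ∃ a, X.basicOpen f ≤ V a}
  have hS : Ideal.span S = ⊤ := by
    rw [← hW.self_le_iSup_basicOpen_iff]
    intro x hx
    obtain ⟨a, ha⟩ := Opens.mem_iSup.1 (hc hx)
    obtain ⟨f, hf, hxf⟩ := hW.exists_basicOpen_le ⟨x, ha⟩ hx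
    exact Opens.mem_iSup.2 ⟨⟨f, a, hf⟩, hxf⟩
  obtain ⟨s, hsS, hs⟩ := (Ideal.span_eq_top_iff_finite S).1 hS
  choose a ha using fun f : s => hsS f.2
  have hs' := hW.self_le_iSup_basicOpen_iff.2 hs
  obtain ⟨x, hx⟩ := forms_glue_basicOpen hM hW s hs'
    (fun f => formsRes p M q _ _ (ha f) (ω (a f))) (fun f f' V hV h h' => by
      rw [formsRes_formsRes, formsRes_formsRes]
      exact hω _ _ _ hV _ _)
  refine ⟨x, fun b V' hV' h h' => forms_eq_of_locally hM hV' fun z hz => ?_⟩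
  obtain ⟨f, hf⟩ := Opens.mem_iSup.1 (hs' (h hz))
  obtain ⟨g, hg, hzg⟩ := hV'.exists_basicOpen_le ⟨z, hf⟩ hz
  refine ⟨X.basicOpen g, hzg, X.basicOpen_le g, ?_⟩
  rw [formsRes_formsRes, formsRes_formsRes, ← formsRes_formsRes p M q (X.basicOpen_le f.1) hg, hx,
    formsRes_formsRes]
  exact hω _ _ _ (hV'.basicOpen g) _ _

/-- Compatible sections of `Ω^q ⊗ M` over the members of an open cover glue. -/
lemma exists_twistedForms_of_cover (hM : IsLocallyFramed M) {ι : Type*}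
    (V : ι → X.Opens) (hc : ⨆ a, V a = ⊤) (ω : ∀ a, FormsOn p M q (V a))
    (hω : ∀ (a b : ι) (V' : X.Opens) (_ : IsAffineOpen V') (h : V' ≤ V a) (h' : V' ≤ V b),
      formsRes p M q _ V' h (ω a) = formsRes p M q _ V' h' (ω b)) :
    ∃ β : TwistedForms p M q ⊤, ∀ (a : ι) (V' : X.Opens) (hV' : IsAffineOpen V') (h' : V' ≤ V a),
      β.1 ⟨V', hV', le_top⟩ = formsRes p M q _ V' h' (ω a) := by
  choose β hβ using fun W : AffineOpensIn (⊤ : X.Opens) =>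
    forms_glue hM W.2.1 V (le_top.trans hc.ge) ω hω
  refine ⟨⟨β, fun W W' h => forms_eq_of_locally hM W'.2.1 fun z hz => ?_⟩, fun a V' hV' h' => ?_⟩
  · obtain ⟨a, ha⟩ := Opens.mem_iSup.1 (hc.ge (Opens.mem_top z))
    obtain ⟨g, hg, hzg⟩ := W'.2.1.exists_basicOpen_le ⟨z, ha⟩ hz
    refine ⟨X.basicOpen g, hzg, X.basicOpen_le g, ?_⟩
    rw [formsRes_formsRes, hβ _ a _ (W'.2.1.basicOpen g) _ hg, hβ _ a _ (W'.2.1.basicOpen g) _ hg]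
  · rw [← hβ ⟨V', hV', le_top⟩ a V' hV' le_rfl h', formsRes_self]

end SchemeGlue

/-! ### Twisted forms spanned by wedge products -/

section WedgeForms

open KaehlerDifferential

variable (k : Type*) [CommRing k] {B : Type*} [CommRing B] [Algebra k B] {J : Type*} (w : J → B)
  (Q : Type*) [AddCommGroup Q] [Module B Q] (q : ℕ)

/-- The submodule of `⋀^q Ω_{B/k} ⊗ Q` spanned by the forms `dw_{σ 1} ∧ ⋯ ∧ dw_{σ q} ⊗ y`. -/
def wedgeForms : Submodule B (AlgTwistedForms k B Q q) :=
  Submodule.span B (Set.range fun x : (Fin q → J) × Q =>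
    exteriorPower.ιMulti B q (fun i => D k B (w (x.1 i))) ⊗ₜ[B] x.2)

variable {k w Q q}

/-- The submodule `wedgeForms` contains all wedge products of elements of the span of the `dw j`. -/
lemma ιMulti_tmul_mem_wedgeForms {v : Fin q → Ω[B⁄k]}
    (hv : ∀ i, v i ∈ Submodule.span B (Set.range fun j => D k B (w j))) (y : Q) :
    exteriorPower.ιMulti B q v ⊗ₜ[B] y ∈ wedgeForms k w Q q := by
  let F := Submodule.span B (Set.range fun j => D k B (w j))
  let d : J → F := fun j => ⟨D k B (w j), Submodule.subset_span ⟨j, rfl⟩⟩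
  have hd : Submodule.span B (Set.range d) = ⊤ := by
    refine Submodule.map_injective_of_injective F.injective_subtype ?_
    rw [Submodule.map_span, ← Set.range_comp, Submodule.map_top, Submodule.range_subtype]
    rfl
  have h1 : ∀ η : ⋀[B]^q F, exteriorPower.map q F.subtype η ⊗ₜ[B] y ∈ wedgeForms k w Q q := by
    intro η
    have hη : η ∈ (⊤ : Submodule B (⋀[B]^q F)) := trivial
    rw [← exteriorPower.ιMulti_span_of_span B q _ hd] at hη
    induction hη using Submodule.span_induction with
    | mem η h =>
      obtain ⟨v, hv, rfl⟩ := h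
      choose σ hσ using fun i => hv (Set.mem_range_self i)
      obtain rfl : (fun i => d (σ i)) = v := funext hσ
      rw [exteriorPower.map_apply_ιMulti]
      exact Submodule.subset_span ⟨(σ, y), rfl⟩
    | zero => rw [map_zero, TensorProduct.zero_tmul]; exact Submodule.zero_mem _
    | add a b _ _ ha hb =>
      rw [map_add, TensorProduct.add_tmul]; exact Submodule.add_mem _ ha hb
    | smul r a _ ha =>
      rw [map_smul, ← TensorProduct.smul_tmul']; exact Submodule.smul_mem _ r ha
  have h2 := h1 (exteriorPower.ιMulti B q fun i => ⟨v i, hv i⟩)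
  rw [exteriorPower.map_apply_ιMulti] at h2
  exact h2

lemma wedgeForms_mono {J' : Type*} {w' : J' → B} (h : ∀ j, ∃ j', w' j' = w j) :
    wedgeForms k w Q q ≤ wedgeForms k w' Q q := by
  choose τ hτ using h
  refine Submodule.span_le.2 ?_
  rintro _ ⟨⟨σ, y⟩, rfl⟩
  refine Submodule.subset_span ⟨(τ ∘ σ, y), ?_⟩
  simp [hτ]

variable {C : Type*} [CommRing C] [Algebra k C] {R : Type*} [AddCommGroup R] [Module C R]

lemma semilinearFormsMap_mem_wedgeForms (φ : B →ₐ[k] C) (m : Q →ₛₗ[φ.toRingHom] R)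
    {ω : AlgTwistedForms k B Q q} (hω : ω ∈ wedgeForms k w Q q) :
    semilinearFormsMap φ m q ω ∈ wedgeForms k (fun j => φ (w j)) R q := by
  induction hω using Submodule.span_induction with
  | mem ω h =>
    obtain ⟨⟨σ, y⟩, rfl⟩ := h
    dsimp only
    rw [semilinearFormsMap_apply]
    exact Submodule.subset_span ⟨(σ, m y), rfl⟩
  | zero => rw [map_zero]; exact Submodule.zero_mem _
  | add a b _ _ ha hb => rw [map_add]; exact Submodule.add_mem _ ha hb
  | smul r a _ ha => rw [semilinearFormsMap_smul]; exact Submodule.smul_mem _ _ ha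

/-- If every `dφ(a)` is divisible by `c` in the span of the `dw j`, then the image of every form is
divisible by `c ^ q` in the span of the wedge products of the `dw j`. -/
lemma exists_semilinearFormsMap_eq_smul {w : J → C} (φ : B →ₐ[k] C) (m : Q →ₛₗ[φ.toRingHom] R)
    {c : C} (hc : ∀ a, ∃ x ∈ Submodule.span C (Set.range fun j => D k C (w j)), c • x = D k C (φ a))
    (ω : AlgTwistedForms k B Q q) :
    ∃ η ∈ wedgeForms k w R q, semilinearFormsMap φ m q ω = c ^ q • η := by
  induction ω using AlgTwistedForms.induction_on with
  | zero => exact ⟨0, Submodule.zero_mem _, by rw [map_zero, smul_zero]⟩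
  | add x y hx hy =>
    obtain ⟨a, ha, hxa⟩ := hx
    obtain ⟨b, hb, hyb⟩ := hy
    exact ⟨a + b, Submodule.add_mem _ ha hb, by rw [map_add, hxa, hyb, smul_add]⟩
  | tmul a x =>
    choose v hv hva using fun i => hc (a i)
    refine ⟨_, ιMulti_tmul_mem_wedgeForms hv (m x), ?_⟩
    rw [semilinearFormsMap_apply]
    simp only [← hva]
    have := (exteriorPower.ιMulti C q (M := Ω[C⁄k])).toMultilinearMap.map_smul_univ
      (fun _ => c) v
    have h2 : exteriorPower.ιMulti C q (fun i => c • v i) = c ^ q • exteriorPower.ιMulti C q v := by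
      simpa using! this
    rw [h2, TensorProduct.smul_tmul']

end WedgeForms

section TorsionFreeTwisted

open KaehlerDifferential

variable {k : Type*} [Field k] {A B L : Type*} [CommRing A] [CommRing B] [Field L] [Algebra k A]
  [Algebra k B] [Algebra k L] [Algebra A B] [Algebra A L] [Algebra B L] [IsScalarTower k A B]
  [IsScalarTower k A L] [IsScalarTower k B L] [IsScalarTower A B L]
  {p : ℕ} [hp : Fact p.Prime] [CharP k p] [PerfectField k] [CharP B p]
  {J : Type*} {z : J → A} {v : J → Aˣ} {s : A} {w : J → B} {Q : Type*} [AddCommGroup Q] [Module B Q]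

/-- The twisted version of `eq_zero_of_smul_eq_zero_of_mem_range_map`, for coefficients in a free
module of rank one. -/
theorem eq_zero_of_smul_eq_zero_of_mem_wedgeForms [IsDomain B] [IsIntegrallyClosed B] [Finite J]
    [Algebra.FormallyEtale A L] (hBL : Function.Injective (algebraMap B L))
    (hs : algebraMap A B s ≠ 0) (hz : GeneratesUpToInverses k z)
    (hw : ∀ j, w j ^ p = algebraMap A B (z j) + algebraMap A B ((s * v j) ^ p) * w j)
    {n : ℕ} (β : Module.Basis (Fin n) A (Ω[A⁄k])) (e : Q ≃ₗ[B] B) {q : ℕ}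
    {ω : AlgTwistedForms k B Q q} (hω : ω ∈ wedgeForms k w Q q)
    {b : B} (hb : b ≠ 0) (h : b • ω = 0) : ω = 0 := by
  let T : AlgTwistedForms k B Q q ≃ₗ[B] ⋀[B]^q Ω[B⁄k] :=
    TensorProduct.congr (LinearEquiv.refl B _) e ≪≫ₗ TensorProduct.rid B _
  refine T.map_eq_zero_iff.1 ?_
  refine eq_zero_of_smul_eq_zero_of_mem_range_map (L := L) hBL hs hz hw β ?_ hb
    (by rw [← map_smul, h, map_zero])
  have : wedgeForms k w Q q ≤ (LinearMap.range (exteriorPower.map q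
      (Submodule.span B (Set.range fun j => D k B (w j))).subtype)).comap T.toLinearMap := by
    refine Submodule.span_le.2 ?_
    rintro _ ⟨⟨σ, y⟩, rfl⟩
    have : T (exteriorPower.ιMulti B q (fun i => D k B (w (σ i))) ⊗ₜ[B] y) =
        e y • exteriorPower.ιMulti B q (fun i => D k B (w (σ i))) := by simp [T]
    refine (congrArg (· ∈ LinearMap.range (exteriorPower.map q
      (Submodule.span B (Set.range fun j => D k B (w j))).subtype)) this).mpr ?_
    refine Submodule.smul_mem _ _ ⟨exteriorPower.ιMulti B q fun i =>
      ⟨D k B (w (σ i)), Submodule.subset_span ⟨σ i, rfl⟩⟩, ?_⟩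
    rw [exteriorPower.map_apply_ιMulti]
    rfl
  exact this hω

end TorsionFreeTwisted

/-! ### Normality of smooth algebras -/

section SmoothNormal

/-- A domain that is étale over an integrally closed domain is integrally closed: integral closure
commutes with smooth base change. -/
lemma isIntegrallyClosed_of_etale (R A : Type*) [CommRing R] [IsDomain R] [IsIntegrallyClosed R]
    [CommRing A] [IsDomain A] [Algebra R A] [Algebra.Etale R A] : IsIntegrallyClosed A := by
  let F := FractionRing R
  have hflat : Module.Flat R A := inferInstance
  have hinj : Function.Injective (algebraMap R A) :=
    FaithfulSMul.algebraMap_injective R A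
  have hloc : IsLocalization (Algebra.algebraMapSubmonoid A (nonZeroDivisors R)) (A ⊗[R] F) :=
    inferInstance
  have hle : Algebra.algebraMapSubmonoid A (nonZeroDivisors R) ≤ nonZeroDivisors A := by
    rintro _ ⟨r, hr, rfl⟩
    exact mem_nonZeroDivisors_of_ne_zero ((map_ne_zero_iff _ hinj).2 (nonZeroDivisors.ne_zero hr))
  have hdom : IsDomain (A ⊗[R] F) := IsLocalization.isDomain_of_le_nonZeroDivisors _ hle
  -- the generic fibre is finite over `F`, hence a field, and it is the fraction field of `A`
  have hfin : Module.Finite F (F ⊗[R] A) := Algebra.FormallyUnramified.finite_of_free _ _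
  have hdom' : IsDomain (F ⊗[R] A) :=
    (Algebra.TensorProduct.comm R F A).toMulEquiv.isDomain (A ⊗[R] F)
  have hfield' : IsField (F ⊗[R] A) := isField_of_isIntegral_of_isField' (Field.toIsField F)
  have hfield : IsField (A ⊗[R] F) :=
    MulEquiv.isField hfield' (Algebra.TensorProduct.comm R A F).toMulEquiv
  let := hfield.toField
  have hAinj : Function.Injective (algebraMap A (A ⊗[R] F)) := IsLocalization.injective _ hle
  have : FaithfulSMul A (A ⊗[R] F) := (faithfulSMul_iff_algebraMap_injective _ _).2 hAinj
  have hfrac : IsFractionRing A (A ⊗[R] F) := IsFractionRing.of_field A _ fun z => by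
    obtain ⟨x, y, rfl⟩ := IsLocalization.exists_mk'_eq
      (Algebra.algebraMapSubmonoid A (nonZeroDivisors R)) z
    exact ⟨x, y, by rw [IsLocalization.mk'_eq_iff_eq_mul, div_mul_cancel₀]
                    exact (map_ne_zero_iff _ hAinj).2 (nonZeroDivisors.ne_zero (hle y.2))⟩
  rw [isIntegrallyClosed_iff (A ⊗[R] F)]
  intro x hx
  obtain ⟨y, hy⟩ := (TensorProduct.toIntegralClosure_bijective_of_smooth (R := R) (S := A)
    (B := F)).2 ⟨x, hx⟩
  have key : ∀ y : A ⊗[R] integralClosure R F, ∃ a : A, algebraMap A (A ⊗[R] F) a =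
      (TensorProduct.toIntegralClosure R A F y : A ⊗[R] F) := by
    intro y
    induction y with
    | zero => exact ⟨0, by simp⟩
    | add y y' h h' =>
      obtain ⟨a, ha⟩ := h
      obtain ⟨a', ha'⟩ := h'
      exact ⟨a + a', by simp [ha, ha']⟩
    | tmul a c =>
      obtain ⟨r, hr⟩ := (isIntegrallyClosed_iff F).1 ‹_› c.2
      refine ⟨r • a, ?_⟩
      have h1 : (TensorProduct.toIntegralClosure R A F (a ⊗ₜ c) : A ⊗[R] F) = a ⊗ₜ (c : F) := rfl
      rw [h1, ← hr, Algebra.algebraMap_eq_smul_one (A := F), TensorProduct.tmul_smul,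
        TensorProduct.smul_tmul']
      rfl
  obtain ⟨a, ha⟩ := key y
  exact ⟨a, ha.trans (by rw [hy])⟩

/-- A standard smooth algebra over a field is étale over a polynomial ring. -/
lemma isIntegrallyClosed_of_isStandardSmooth (k A : Type*) [Field k] [CommRing A] [IsDomain A]
    [Algebra k A] [Algebra.IsStandardSmooth k A] : IsIntegrallyClosed A := by
  have h : (algebraMap k A).IsStandardSmooth := by
    rw [RingHom.isStandardSmooth_algebraMap]; infer_instance
  obtain ⟨n, g, -, hg⟩ := h.exists_etale_mvPolynomial
  algebraize [g]
  exact isIntegrallyClosed_of_etale (MvPolynomial (Fin n) k) A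

end SmoothNormal

/-! ### Generators up to inverses of a localization -/

section Generators

variable {k A A' J : Type*} [Field k] [CommRing A] [CommRing A'] [Algebra k A] [Algebra k A']
  [Algebra A A'] [IsScalarTower k A A']

/-- Generators of an algebra generate its localization at an element up to inverses. -/
lemma generatesUpToInverses_of_isLocalization (g : A) [IsLocalization.Away g A'] {z : J → A}
    (hz : Algebra.adjoin k (Set.range z) = ⊤) :
    GeneratesUpToInverses k fun j => algebraMap A A' (z j) := by
  intro S hS hinv
  have h1 : ∀ a : A, algebraMap A A' a ∈ S := fun a => by
    have : Algebra.adjoin k (Set.range z) ≤ S.comap (IsScalarTower.toAlgHom k A A') := by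
      rw [Algebra.adjoin_le_iff]
      rintro _ ⟨j, rfl⟩
      exact hS j
    exact this (hz ▸ Algebra.mem_top)
  refine top_unique fun x _ => ?_
  obtain ⟨n, a, ha⟩ := IsLocalization.Away.surj g x
  obtain ⟨b, hb⟩ := (IsLocalization.Away.algebraMap_isUnit (S := A') g).exists_right_inv
  have hb' : b ∈ S := hinv _ _ (h1 g) hb
  have : x = algebraMap A A' a * b ^ n := by
    rw [← ha, mul_assoc, ← mul_pow, hb, one_pow, mul_one]
  rw [this]
  exact S.mul_mem (h1 a) (S.pow_mem hb' n)

lemma GeneratesUpToInverses.of_comp {J' : Type*} {z : J → A} (hz : GeneratesUpToInverses k z)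
    {z' : J' → A} (h : ∀ j, ∃ j', z' j' = z j) : GeneratesUpToInverses k z' :=
  fun S hS hinv => hz S (fun j => by obtain ⟨j', hj⟩ := h j; exact hj ▸ hS j') hinv

end Generators

/-! ### Divisors on projective schemes -/

section ProjSections

open HomogeneousLocalization

variable {σ A : Type*} [CommRing A] [SetLike σ A] [AddSubgroupClass σ A] (𝒜 : ℕ → σ) [GradedRing 𝒜]

/-- The section `S / f ^ e` of the structure sheaf of `Proj` over `D₊(f)`, for `f` of degree `1` and
`S` of degree `e`. -/
def projSection {f S : A} {e : ℕ} (hf : f ∈ 𝒜 1) (hS : S ∈ 𝒜 e) :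
    Γ(Proj 𝒜, Proj.basicOpen 𝒜 f) :=
  Proj.awayToSection 𝒜 f (Away.mk 𝒜 hf e S (by simpa using hS))

/-- The section `S / f ^ e` is invertible exactly on `D₊(f) ∩ D₊(S)`. -/
lemma basicOpen_projSection {f S : A} {e : ℕ} (hf : f ∈ 𝒜 1) (hS : S ∈ 𝒜 e) :
    (Proj 𝒜).basicOpen (projSection 𝒜 hf hS) = Proj.basicOpen 𝒜 f ⊓ Proj.basicOpen 𝒜 S := by
  ext x
  by_cases hx : x ∈ Proj.basicOpen 𝒜 f
  swap
  · exact ⟨fun h => absurd ((Proj 𝒜).basicOpen_le _ h) hx, fun h => absurd h.1 hx⟩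
  have h1 : x ∈ (Proj 𝒜).basicOpen (projSection 𝒜 hf hS) ↔
      IsUnit ((Proj 𝒜).presheaf.germ _ x hx (projSection 𝒜 hf hS)) :=
    (Proj 𝒜).mem_basicOpen _ x hx
  have h2 := ConcreteCategory.congr_hom
    (ProjectiveSpectrum.Proj.awayToSection_germ 𝒜 f x hx) (Away.mk 𝒜 hf e S (by simpa using hS))
  have h3 : (Proj 𝒜).presheaf.germ _ x hx (projSection 𝒜 hf hS) =
      (Proj.stalkIso' 𝒜 x).symm (mapId 𝒜 (Submonoid.powers_le.mpr hx)
        (Away.mk 𝒜 hf e S (by simpa using hS))) := h2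
  change x ∈ (Proj 𝒜).basicOpen (projSection 𝒜 hf hS) ↔ _
  have : x.asHomogeneousIdeal.toIdeal.IsPrime := x.isPrime
  have hx' : f ^ e ∈ x.asHomogeneousIdeal.toIdeal.primeCompl :=
    Submonoid.pow_mem _ hx e
  have h4 : (mapId 𝒜 (Submonoid.powers_le.mpr hx)
      (Away.mk 𝒜 hf e S (by simpa using hS)) : AtPrime 𝒜 x.asHomogeneousIdeal.toIdeal).val =
      IsLocalization.mk' (Localization.AtPrime x.asHomogeneousIdeal.toIdeal) S ⟨f ^ e, hx'⟩ :=
    Localization.mk_eq_mk'_apply _ _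
  rw [h1, h3]
  refine (isUnit_map_iff (Proj.stalkIso' 𝒜 x).symm _).trans
    ((isUnit_iff_isUnit_val _ _ _).symm.trans ?_)
  rw [h4, IsLocalization.AtPrime.isUnit_mk'_iff _ x.asHomogeneousIdeal.toIdeal]
  exact ⟨fun h => ⟨hx, h⟩, fun h => h.2⟩

/-- The local equations `S / f ^ e` and `S / g ^ e` of the divisor `S = 0` differ by the unit
`(f / g) ^ e` on `D₊(f) ∩ D₊(g)`. -/
lemma exists_units_projSection {f g S : A} {e : ℕ} (hf : f ∈ 𝒜 1) (hg : g ∈ 𝒜 1) (hS : S ∈ 𝒜 e) :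
    ∃ u : Γ(Proj 𝒜, Proj.basicOpen 𝒜 f ⊓ Proj.basicOpen 𝒜 g)ˣ,
      ringRes inf_le_right (projSection 𝒜 hg hS) =
        u.val * ringRes inf_le_left (projSection 𝒜 hf hS) := by
  have hfg : f * g ∈ 𝒜 (1 + 1) := SetLike.mul_mem_graded hf hg
  let a : Away 𝒜 (f * g) := Away.mk 𝒜 hfg 1 (f * f) (by simpa using SetLike.mul_mem_graded hf hf)
  let b : Away 𝒜 (f * g) := Away.mk 𝒜 hfg 1 (g * g) (by simpa using SetLike.mul_mem_graded hg hg)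
  have hab : a * b = 1 := by
    apply val_injective
    simp only [a, b, val_mul, val_one, Away.val_mk, Localization.mk_mul]
    rw [← Localization.mk_one, Localization.mk_eq_mk_iff, Localization.r_iff_exists]
    exact ⟨1, by simp; ring⟩
  let u : (Away 𝒜 (f * g))ˣ := ⟨a, b, hab, (mul_comm _ _).trans hab⟩
  have key : awayMap 𝒜 hf (mul_comm f g) (Away.mk 𝒜 hg e S (by simpa using hS)) =
      (u ^ e : (Away 𝒜 (f * g))ˣ) * awayMap 𝒜 hg rfl (Away.mk 𝒜 hf e S (by simpa using hS)) := by
    apply val_injective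
    simp only [awayMap_mk, val_mul, Units.val_pow_eq_pow_val, val_pow, u, a, Away.val_mk,
      Localization.mk_mul, Localization.mk_pow]
    rw [Localization.mk_eq_mk_iff, Localization.r_iff_exists]
    exact ⟨1, by simp; ring⟩
  have h1 := ConcreteCategory.congr_hom (Proj.awayMap_awayToSection 𝒜 (f := f) hg rfl)
    (Away.mk 𝒜 hf e S (by simpa using hS))
  have h2 := ConcreteCategory.congr_hom (Proj.awayMap_awayToSection 𝒜 (f := g) hf (mul_comm f g))
    (Away.mk 𝒜 hg e S (by simpa using hS))
  have hle : Proj.basicOpen 𝒜 f ⊓ Proj.basicOpen 𝒜 g ≤ Proj.basicOpen 𝒜 (f * g) :=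
    (Proj.basicOpen_mul 𝒜 f g).ge
  have h3 : ∀ (h : A) (hh : Proj.basicOpen 𝒜 (f * g) ≤ Proj.basicOpen 𝒜 h)
      (hh' : Proj.basicOpen 𝒜 f ⊓ Proj.basicOpen 𝒜 g ≤ Proj.basicOpen 𝒜 h)
      (x : Γ(Proj 𝒜, Proj.basicOpen 𝒜 h)), ringRes hh' x = ringRes hle (ringRes hh x) :=
    fun h hh hh' x => (ringRes_ringRes hh hle x).symm
  refine ⟨Units.map ((ringRes hle).comp (Proj.awayToSection 𝒜 (f * g)).hom : _ →* _) (u ^ e), ?_⟩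
  rw [h3 f (Proj.basicOpen_mono _ _ _ ⟨_, rfl⟩), h3 g (Proj.basicOpen_mono _ _ _ ⟨_, mul_comm f g⟩)]
  have h1' : ringRes (Proj.basicOpen_mono 𝒜 _ _ ⟨_, rfl⟩) (projSection 𝒜 hf hS) =
    (Proj.awayToSection 𝒜 (f * g)).hom
      (awayMap 𝒜 hg rfl (Away.mk 𝒜 hf e S (by simpa using hS))) := h1.symm
  have h2' : ringRes (Proj.basicOpen_mono 𝒜 _ _ ⟨_, mul_comm f g⟩) (projSection 𝒜 hg hS) =
    (Proj.awayToSection 𝒜 (f * g)).hom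
      (awayMap 𝒜 hf (mul_comm f g) (Away.mk 𝒜 hg e S (by simpa using hS))) := h2.symm
  rw [h1', h2', key, map_mul, map_mul]
  rfl

end ProjSections

section Divisor

attribute [local instance] MvPolynomial.gradedAlgebra

lemma ringRes_app {X Y : Scheme.{u}} (f : Y ⟶ X) {V V' : X.Opens} (h : V' ≤ V) (r : Γ(X, V)) :
    ringRes (f.preimage_mono h) (f.app V r) = f.app V' (ringRes h r) :=
  (ConcreteCategory.congr_hom (f.naturality (homOfLE h).op) r).symm

/-- On a projective scheme, every nonempty open subset `U` contains a nonempty open subset `D` that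
is the complement of a divisor: `D` is the locus where the local equations `t j`, defined on the
members of a finite affine cover and associated on overlaps, are invertible. -/
lemma IsProjectiveOver.exists_divisor {k : Type u} [Field k] {X : Scheme.{u}}
    {p : X ⟶ Spec (.of k)} (hp : IsProjectiveOver p) {U : X.Opens} (hU : (U : Set X).Nonempty) :
    ∃ (n : ℕ) (V : Fin n → X.Opens) (t : ∀ j, Γ(X, V j)) (D : X.Opens), (∀ j, IsAffineOpen (V j)) ∧
      (∀ x, ∃ j, x ∈ V j) ∧ D ≤ U ∧ (D : Set X).Nonempty ∧
      (∀ j, X.basicOpen (t j) = V j ⊓ D) ∧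
      ∀ j j', ∃ u : Γ(X, V j ⊓ V j')ˣ,
        ringRes inf_le_right (t j') = u.val * ringRes inf_le_left (t j) := by
  obtain ⟨n, i, hi, rfl⟩ := hp
  let 𝒜 := MvPolynomial.homogeneousSubmodule (Fin (n + 1)) k
  have hX : ∀ j : Fin (n + 1), (MvPolynomial.X j : MvPolynomial (Fin (n + 1)) k) ∈ 𝒜 1 := fun j =>
    MvPolynomial.isHomogeneous_X k j
  obtain ⟨x₀, hx₀⟩ := hU
  obtain ⟨W, hW⟩ := i.isEmbedding.isInducing.isOpen_iff.1 U.2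
  have hx₀W : i x₀ ∈ W := by
    have : x₀ ∈ i ⁻¹' W := hW.2 ▸ hx₀
    exact this
  obtain ⟨_, ⟨_, ⟨F, rfl⟩, rfl⟩, hxF, hFW⟩ :=
    (Proj.isBasis_basicOpen 𝒜).exists_subset_of_mem_open hx₀W hW.1
  have hxF' : i x₀ ∈ Proj.basicOpen 𝒜 F := hxF
  -- pass from `F` to a homogeneous component `S` that does not vanish at the chosen point
  rw [Proj.basicOpen_eq_iSup_proj, Opens.mem_iSup] at hxF'
  obtain ⟨e, he⟩ := hxF'
  have hSe : GradedRing.proj 𝒜 e F ∈ 𝒜 e := SetLike.coe_mem _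
  have hSF : Proj.basicOpen 𝒜 (GradedRing.proj 𝒜 e F) ≤ Proj.basicOpen 𝒜 F := by
    rw [Proj.basicOpen_eq_iSup_proj 𝒜 F]
    exact le_iSup (fun e => Proj.basicOpen 𝒜 (GradedRing.proj 𝒜 e F)) e
  generalize GradedRing.proj 𝒜 e F = S at *
  refine ⟨n + 1, fun j => i ⁻¹ᵁ Proj.basicOpen 𝒜 (MvPolynomial.X j),
    fun j => i.app _ (projSection 𝒜 (hX j) hSe), i ⁻¹ᵁ Proj.basicOpen 𝒜 S, fun j => ?_, fun x => ?_,
    ?_, ⟨x₀, he⟩, fun j => ?_, fun j j' => ?_⟩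
  · exact (Proj.isAffineOpen_basicOpen 𝒜 _ (hX j) one_pos).preimage i
  · have h1 : ⨆ j : Fin (n + 1), Proj.basicOpen 𝒜 (MvPolynomial.X j) = ⊤ := by
      refine Proj.iSup_basicOpen_eq_top' 𝒜 _ (fun j => ⟨1, hX j⟩) ?_
      refine top_unique fun f _ => ?_
      induction f using MvPolynomial.induction_on with
      | C a =>
        exact Subalgebra.algebraMap_mem _
          (⟨MvPolynomial.C a, MvPolynomial.isHomogeneous_C _ a⟩ : 𝒜 0)
      | add f g hf hg => exact Subalgebra.add_mem _ (hf trivial) (hg trivial)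
      | mul_X f j hf =>
        exact Subalgebra.mul_mem _ (hf trivial) (Algebra.subset_adjoin ⟨j, rfl⟩)
    obtain ⟨j, hj⟩ := Opens.mem_iSup.1 (h1.ge (Opens.mem_top (i x)))
    exact ⟨j, hj⟩
  · intro x hx
    have : x ∈ i ⁻¹' W := hFW (hSF hx)
    rwa [hW.2] at this
  · rw [← Scheme.preimage_basicOpen, basicOpen_projSection]
    rfl
  · obtain ⟨u, hu⟩ := exists_units_projSection 𝒜 (hX j) (hX j') hSe
    refine ⟨Units.map (i.app _).hom.toMonoidHom u, ?_⟩
    have h1 := ringRes_app i (inf_le_right : Proj.basicOpen 𝒜 (MvPolynomial.X j) ⊓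
      Proj.basicOpen 𝒜 (MvPolynomial.X j') ≤ _) (projSection 𝒜 (hX j') hSe)
    have h2 := ringRes_app i (inf_le_left : Proj.basicOpen 𝒜 (MvPolynomial.X j) ⊓
      Proj.basicOpen 𝒜 (MvPolynomial.X j') ≤ _) (projSection 𝒜 (hX j) hSe)
    rw [hu, map_mul, ← h2] at h1
    exact h1

end Divisor

/-! ### Standard smooth opens -/

section SmallOpens

variable {k : Type u} [Field k] {X : Scheme.{u}} (p : X ⟶ Spec (.of k))

lemma smooth_secRing [Smooth p] {W : X.Opens} (hW : IsAffineOpen W) :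
    Algebra.Smooth k (SecRing p W) := by
  have h1 := p.smooth_appLE (isAffineOpen_top _) hW le_top
  have h2 : (secRingScalar p W).hom.Smooth := by
    have h3 : secRingScalar p W = (Scheme.ΓSpecIso (.of k)).inv ≫ p.appLE ⊤ W le_top := rfl
    rw [h3, CommRingCat.hom_comp]
    exact RingHom.Smooth.respectsIso.2 _ (Scheme.ΓSpecIso (.of k)).symm.commRingCatIsoToRingEquiv h1
  exact (RingHom.smooth_algebraMap (R := k) (S := SecRing p W)).1 h2

lemma isLocalization_secRing {W : X.Opens} (hW : IsAffineOpen W) (g : Γ(X, W)) {V : X.Opens}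
    (hV : V = X.basicOpen g) (hle : V ≤ W) :
    letI := (secRingRes p W V hle).toRingHom.toAlgebra
    IsLocalization.Away (show SecRing p W from g) (SecRing p V) :=
  hW.isLocalization_of_eq_basicOpen g (homOfLE hle) hV

/-- Standard smooth basic open subsets of an affine open form a basis of its topology. -/
lemma exists_basicOpen_isStandardSmooth [Smooth p] {W : X.Opens} (hW : IsAffineOpen W) {x : X}
    (hx : x ∈ W) {O : X.Opens} (hO : x ∈ O) :
    ∃ g : Γ(X, W), x ∈ X.basicOpen g ∧ X.basicOpen g ≤ O ∧
      Algebra.IsStandardSmooth k (SecRing p (X.basicOpen g)) := by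
  have := smooth_secRing p hW
  obtain ⟨s, hs, hs'⟩ := Algebra.Smooth.exists_span_eq_top_isStandardSmooth k (SecRing p W)
  obtain ⟨f, hf, hxf⟩ : ∃ f : Γ(X, W), (show SecRing p W from f) ∈ s ∧ x ∈ X.basicOpen f := by
    obtain ⟨⟨f, hf⟩, hxf⟩ := Opens.mem_iSup.1 (hW.self_le_iSup_basicOpen_iff.2 hs hx)
    exact ⟨f, hf, hxf⟩
  obtain ⟨h, hhO, hxh⟩ := hW.exists_basicOpen_le ⟨x, hO⟩ hx
  have hle : X.basicOpen (f * h : Γ(X, W)) ≤ X.basicOpen f := by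
    rw [X.basicOpen_mul]; exact inf_le_left
  refine ⟨(f * h : Γ(X, W)), ?_, ?_, ?_⟩
  · rw [X.basicOpen_mul]; exact ⟨hxf, hxh⟩
  · rw [X.basicOpen_mul]; exact inf_le_right.trans hhO
  · have h1 : Algebra.IsStandardSmooth k (Localization.Away (show SecRing p W from f)) := hs' f hf
    have h2 : Algebra.IsStandardSmooth k (SecRing p (X.basicOpen f)) := by
      let φ := secRingRes p W (X.basicOpen f) (X.basicOpen_le _)
      let := φ.toRingHom.toAlgebra
      have := isLocalization_secRing p hW f rfl (X.basicOpen_le _)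
      have : IsScalarTower k (SecRing p W) (SecRing p (X.basicOpen f)) :=
        .of_algebraMap_eq fun r => (φ.commutes r).symm
      exact .of_algEquiv ((IsLocalization.algEquiv (Submonoid.powers (show SecRing p W from f))
        (Localization.Away (show SecRing p W from f))
        (SecRing p (X.basicOpen f))).restrictScalars k)
    let φ := secRingRes p _ _ hle
    let := φ.toRingHom.toAlgebra
    have : IsScalarTower k (SecRing p (X.basicOpen f))
        (SecRing p (X.basicOpen (f * h : Γ(X, W)))) :=
      .of_algebraMap_eq fun r => (φ.commutes r).symm
    have := isLocalization_secRing p (hW.basicOpen f) (ringRes (X.basicOpen_le _) h)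
      (V := X.basicOpen (f * h : Γ(X, W)))
      (by rw [basicOpen_ringRes, X.basicOpen_mul]) hle
    have : Algebra.IsStandardSmooth (SecRing p (X.basicOpen f))
        (SecRing p (X.basicOpen (f * h : Γ(X, W)))) :=
      .localization_away (show SecRing p (X.basicOpen f) from
        ringRes (X.basicOpen_le _) h)
    exact Algebra.IsStandardSmooth.trans k (SecRing p (X.basicOpen f)) _

end SmallOpens

/-! ### The equations `T ^ ℓ = z + s ^ ℓ * T` -/

/-- Finitely many equations `T ^ ℓ = z + s ^ ℓ * T` with `s ≠ 0` are solvable in a finite separable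
extension, since the derivative of `T ^ ℓ - s ^ ℓ * T - z` is the nonzero constant `-s ^ ℓ`. -/
lemma exists_isSeparable_extension {K : Type u} [Field K] (ℓ : ℕ) [Fact ℓ.Prime] [CharP K ℓ]
    {ι : Type*} [Finite ι] (z s : ι → K) (hs : ∀ i, s i ≠ 0) :
    ∃ (L : Type u) (_ : Field L) (_ : Algebra K L), FiniteDimensional K L ∧
      Algebra.IsSeparable K L ∧ ∃ w : ι → L, ∀ i,
        w i ^ ℓ = algebraMap K L (z i) + algebraMap K L (s i) ^ ℓ * w i := by
  let F (i : ι) : Polynomial K :=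
    .X ^ ℓ - (Polynomial.C (s i ^ ℓ) * .X + Polynomial.C (z i))
  have hℓ : 1 < ℓ := (Fact.out : ℓ.Prime).one_lt
  have hmonic (i) : (F i).Monic := by
    refine Polynomial.monic_X_pow_sub ?_
    exact Polynomial.degree_linear_le.trans_lt (by exact_mod_cast hℓ)
  have hdeg (i) : (F i).degree ≠ 0 := by
    have : (F i).degree = ℓ := by
      refine Polynomial.degree_sub_eq_left_of_degree_lt ?_ |>.trans (Polynomial.degree_X_pow _)
      rw [Polynomial.degree_X_pow]
      exact Polynomial.degree_linear_le.trans_lt (by exact_mod_cast hℓ)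
    rw [this]
    exact_mod_cast (by omega : ℓ ≠ 0)
  have hsep (i) : (F i).Separable := by
    -- in characteristic `ℓ`, the derivative of `F i` is a nonzero constant
    have hder : (F i).derivative = Polynomial.C (-(s i ^ ℓ)) := by
      simp [F, Polynomial.derivative_pow, CharP.cast_eq_zero]
    rw [Polynomial.Separable, hder]
    refine ⟨0, Polynomial.C (-(s i ^ ℓ))⁻¹, ?_⟩
    rw [zero_mul, zero_add, ← Polynomial.C_mul,
      inv_mul_cancel₀ (neg_ne_zero.2 (pow_ne_zero _ (hs i))), Polynomial.C_1]
  choose r hr using fun i => IsAlgClosed.exists_aeval_eq_zero (AlgebraicClosure K) (F i) (hdeg i)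
  let L := IntermediateField.adjoin K (Set.range r)
  have hfd : FiniteDimensional K L := IntermediateField.finiteDimensional_adjoin
    (by rintro _ ⟨i, rfl⟩; exact ⟨F i, hmonic i, hr i⟩)
  have hL : Algebra.IsSeparable K L := by
    rw [IntermediateField.isSeparable_adjoin_iff_isSeparable]
    rintro _ ⟨i, rfl⟩
    exact (hsep i).of_dvd (minpoly.dvd K _ (hr i))
  refine ⟨L, inferInstance, inferInstance, hfd, hL,
    fun i => ⟨r i, IntermediateField.subset_adjoin _ _ ⟨i, rfl⟩⟩, fun i => ?_⟩
  apply Subtype.ext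
  have := hr i
  simp only [F, map_sub, map_add, map_mul, map_pow, Polynomial.aeval_X, Polynomial.aeval_C] at this
  rw [sub_eq_zero] at this
  refine this.trans ?_
  rw [add_comm]
  rfl

/-- A root of `T ^ ℓ - s ^ ℓ * T - z` is integral, as this polynomial is monic. -/
lemma isIntegralElem_of_pow_eq {R S : Type*} [CommRing R] [CommRing S] (φ : R →+* S) {ℓ : ℕ}
    (hℓ : 1 < ℓ) (z s : R) (w : S) (hw : w ^ ℓ = φ z + φ s ^ ℓ * w) : φ.IsIntegralElem w := by
  rcases subsingleton_or_nontrivial R with hR | hR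
  · have : Subsingleton S := φ.codomain_trivial
    exact ⟨1, Polynomial.monic_one, Subsingleton.elim _ _⟩
  have hdeg : (Polynomial.C (s ^ ℓ) * Polynomial.X + Polynomial.C z).degree < (ℓ : WithBot ℕ) :=
    lt_of_le_of_lt Polynomial.degree_linear_le (Nat.one_lt_cast.2 hℓ)
  have h0 : (Polynomial.X ^ ℓ - (Polynomial.C (s ^ ℓ) * Polynomial.X + Polynomial.C z)).eval₂ φ w
      = 0 := by
    rw [Polynomial.eval₂_sub, Polynomial.eval₂_add, Polynomial.eval₂_mul, Polynomial.eval₂_pow,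
      Polynomial.eval₂_X, Polynomial.eval₂_C, Polynomial.eval₂_C, hw, map_pow, add_comm, sub_self]
  exact ⟨_, Polynomial.monic_X_pow_sub hdeg, h0⟩

/-! ### Normalization in an extension of the function field -/

section NormalizationIn

variable (X : Scheme.{u}) [IsIntegral X] (L : Type u) [Field L] [Algebra X.functionField L]

/-- The morphism `Spec L ⟶ X` onto the generic point given by an extension `L` of the function
field of `X`. -/
def specToGeneric : Spec (.of L) ⟶ X :=
  Spec.map (CommRingCat.ofHom (algebraMap X.functionField L)) ≫ X.fromSpecStalk (genericPoint X)

instance : QuasiCompact (specToGeneric X L) where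
  isCompact_preimage _ _ _ := (Set.toFinite _).isCompact

instance : QuasiSeparated (specToGeneric X L) := inferInstance

/-- The normalization of `X` in the extension `L` of its function field. -/
abbrev normalizationIn : Scheme.{u} := (specToGeneric X L).normalization

/-- The canonical morphism to `X` from its normalization in `L`. -/
abbrev normalizationInMap : normalizationIn X L ⟶ X := (specToGeneric X L).fromNormalization

variable {X}

lemma genericPoint_mem {V : X.Opens} (hV : (V : Set X).Nonempty) : genericPoint X ∈ V :=
  ((genericPoint_spec X).mem_open_set_iff V.isOpen).2 (by simpa using hV)

lemma specToGeneric_apply (y : Spec (.of L)) : specToGeneric X L y = genericPoint X := by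
  have hy : y = IsLocalRing.closedPoint L := Subsingleton.elim _ _
  have : Spec.map (CommRingCat.ofHom (algebraMap X.functionField L)) y =
      IsLocalRing.closedPoint X.functionField := Subsingleton.elim _ _
  rw [specToGeneric, Scheme.Hom.comp_apply, this]
  exact X.fromSpecStalk_closedPoint

lemma specToGeneric_le {V : X.Opens} (hV : (V : Set X).Nonempty) :
    ⊤ ≤ (specToGeneric X L) ⁻¹ᵁ V := fun y _ => by
  show specToGeneric X L y ∈ V
  rw [specToGeneric_apply]; exact genericPoint_mem hV

lemma appLE_specToGeneric {V : X.Opens} (hV : (V : Set X).Nonempty) (g : Spec (.of L) ⟶ X)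
    (hg : g = specToGeneric X L) (h : ⊤ ≤ g ⁻¹ᵁ V) :
    g.appLE V ⊤ h ≫ (Scheme.ΓSpecIso (.of L)).hom =
      X.presheaf.germ V (genericPoint X) (genericPoint_mem hV) ≫
        CommRingCat.ofHom (algebraMap X.functionField L) := by
  have hg' : g = Spec.map (CommRingCat.ofHom (algebraMap X.functionField L)) ≫
      X.fromSpecStalk (genericPoint X) := hg
  subst hg'
  rw [Scheme.Hom.comp_appLE, Scheme.fromSpecStalk_app (genericPoint_mem hV)]
  have h3 : (Spec (X.presheaf.stalk (genericPoint X))).presheaf.map (homOfLE le_top).op ≫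
      (Spec.map (CommRingCat.ofHom (algebraMap X.functionField L))).appLE
        (X.fromSpecStalk (genericPoint X) ⁻¹ᵁ V) ⊤ h =
      (Spec.map (CommRingCat.ofHom (algebraMap X.functionField L))).appTop :=
    (Scheme.Hom.map_appLE ..).trans (Scheme.Hom.appLE_eq_app _)
  have h4 := Scheme.ΓSpecIso_inv_naturality (CommRingCat.ofHom (algebraMap X.functionField L))
  simp only [Category.assoc]
  refine congrArg (X.presheaf.germ V (genericPoint X) (genericPoint_mem hV) ≫ ·) ?_
  refine (congrArg (fun t => (Scheme.ΓSpecIso _).inv ≫ t) ((Category.assoc _ _ _).symm.trans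
    (congrArg (· ≫ _) h3))).trans ?_
  rw [← Category.assoc]
  refine (congrArg (· ≫ _) h4.symm).trans ?_
  simp
  rfl

lemma toNormalization_le {V : X.Opens} (hV : (V : Set X).Nonempty) :
    ⊤ ≤ (specToGeneric X L).toNormalization ⁻¹ᵁ (normalizationInMap X L ⁻¹ᵁ V) := by
  rw [← Scheme.Hom.comp_preimage, Scheme.Hom.toNormalization_fromNormalization]
  exact specToGeneric_le L hV

/-- Functions on the preimage of `V` in the normalization of `X` in `L`, as elements of `L`. -/
def normalizationInToField (V : X.Opens) (hV : (V : Set X).Nonempty) :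
    Γ(normalizationIn X L, normalizationInMap X L ⁻¹ᵁ V) →+* L :=
  ((specToGeneric X L).toNormalization.appLE (normalizationInMap X L ⁻¹ᵁ V) ⊤
    (toNormalization_le L hV) ≫ (Scheme.ΓSpecIso (.of L)).hom).hom

/-- The embedding of functions on the normalization into `L` extends `Γ(X, V) → k(X) → L`. -/
lemma normalizationInToField_app (V : X.Opens) (hV : (V : Set X).Nonempty) (a : Γ(X, V)) :
    normalizationInToField L V hV ((normalizationInMap X L).app V a) =
      algebraMap X.functionField L
        (X.presheaf.germ V (genericPoint X) (genericPoint_mem hV) a) := by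
  have h1 : (normalizationInMap X L).app V ≫ (specToGeneric X L).toNormalization.appLE
      (normalizationInMap X L ⁻¹ᵁ V) ⊤ (toNormalization_le L hV) ≫ (Scheme.ΓSpecIso (.of L)).hom =
      X.presheaf.germ V (genericPoint X) (genericPoint_mem hV) ≫
        CommRingCat.ofHom (algebraMap X.functionField L) := by
    rw [← Category.assoc, Scheme.Hom.app_eq_appLE, Scheme.Hom.appLE_comp_appLE]
    exact appLE_specToGeneric L hV _ (Scheme.Hom.toNormalization_fromNormalization _) _
  exact ConcreteCategory.congr_hom h1 a

variable {V : X.Opens} (hVa : IsAffineOpen V) (hV : (V : Set X).Nonempty)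

lemma normalizationInToField_eq (c) :
    normalizationInToField L V hV c = (Scheme.ΓSpecIso (.of L)).hom
      ((Spec (.of L)).presheaf.map (homOfLE (specToGeneric_le L hV)).op
        (((specToGeneric X L).normalizationObjIso hVa).hom c).1) := by
  have h1 := (specToGeneric X L).normalizationObjIso_hom_val hVa
  have h2 : (specToGeneric X L).toNormalization.appLE (normalizationInMap X L ⁻¹ᵁ V) ⊤
      (toNormalization_le L hV) = (specToGeneric X L).toNormalization.appLE
        (normalizationInMap X L ⁻¹ᵁ V) ((specToGeneric X L) ⁻¹ᵁ V)
          (by simp [← Scheme.Hom.comp_preimage]) ≫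
          (Spec (.of L)).presheaf.map (homOfLE (specToGeneric_le L hV)).op := by
    rw [Scheme.Hom.appLE_map]
  rw [← h1] at h2
  exact congrArg (Scheme.ΓSpecIso (.of L)).hom (ConcreteCategory.congr_hom h2 c)

lemma specToGeneric_bijective :
    Function.Bijective fun x : Γ(Spec (.of L), (specToGeneric X L) ⁻¹ᵁ V) =>
      (Scheme.ΓSpecIso (.of L)).hom
        ((Spec (.of L)).presheaf.map (homOfLE (specToGeneric_le L hV)).op x) := by
  have : IsIso (homOfLE (specToGeneric_le L hV)) :=
    ⟨homOfLE le_top, Subsingleton.elim _ _, Subsingleton.elim _ _⟩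
  exact ConcreteCategory.bijective_of_isIso
    ((Spec (.of L)).presheaf.map (homOfLE (specToGeneric_le L hV)).op ≫
      (Scheme.ΓSpecIso (.of L)).hom)

lemma normalizationInToField_injective {V : X.Opens} (hVa : IsAffineOpen V)
    (hV : (V : Set X).Nonempty) :
    Function.Injective (normalizationInToField L V hV) := by
  intro c c' h
  rw [normalizationInToField_eq L hVa, normalizationInToField_eq L hVa] at h
  have h1 := Subtype.ext ((specToGeneric_bijective L hV).1 h)
  exact (ConcreteCategory.bijective_of_isIso
    ((specToGeneric X L).normalizationObjIso hVa).hom).1 h1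

lemma exists_normalizationInToField_eq {V : X.Opens} (hVa : IsAffineOpen V)
    (hV : (V : Set X).Nonempty) (x : L)
    (hx : ((algebraMap X.functionField L).comp
      (X.presheaf.germ V (genericPoint X) (genericPoint_mem hV)).hom).IsIntegralElem x) :
    ∃ c, normalizationInToField L V hV c = x := by
  obtain ⟨y, hy⟩ := (specToGeneric_bijective L hV).2 x
  let := ((specToGeneric X L).app V).hom.toAlgebra
  have hint : IsIntegral Γ(X, V) y := by
    obtain ⟨P, hP, hPx⟩ := hx
    refine ⟨P, hP, (specToGeneric_bijective L hV).1 ?_⟩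
    let ψ := ((Spec (.of L)).presheaf.map (homOfLE (specToGeneric_le L hV)).op ≫
      (Scheme.ΓSpecIso (.of L)).hom).hom
    have hψ : ψ.comp (algebraMap Γ(X, V) Γ(Spec (.of L), (specToGeneric X L) ⁻¹ᵁ V)) =
        (algebraMap X.functionField L).comp
          (X.presheaf.germ V (genericPoint X) (genericPoint_mem hV)).hom :=
      congrArg CommRingCat.Hom.hom (appLE_specToGeneric L hV _ rfl (specToGeneric_le L hV))
    show ψ _ = ψ 0
    rw [Polynomial.hom_eval₂, hψ, map_zero]
    exact (congrArg (fun t => P.eval₂ _ t) hy).trans hPx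
  obtain ⟨c, hc⟩ := (ConcreteCategory.bijective_of_isIso
    ((specToGeneric X L).normalizationObjIso hVa).hom).2 ⟨y, hint⟩
  refine ⟨c, ?_⟩
  rw [normalizationInToField_eq L hVa, hc]
  exact hy

/-- Over a nonempty affine open `V`, the ring of functions on the normalization of `X` in `L` is the
integral closure of `Γ(X, V)` in `L`. -/
lemma isIntegralClosure_normalizationIn {V : X.Opens} (hVa : IsAffineOpen V)
    (hV : (V : Set X).Nonempty) :
    letI : Algebra Γ(X, V) L := ((algebraMap X.functionField L).comp
      (X.presheaf.germ V (genericPoint X) (genericPoint_mem hV)).hom).toAlgebra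
    letI := (normalizationInToField L V hV).toAlgebra
    IsIntegralClosure Γ(normalizationIn X L, normalizationInMap X L ⁻¹ᵁ V) Γ(X, V) L := by
  let : Algebra Γ(X, V) L := ((algebraMap X.functionField L).comp
    (X.presheaf.germ V (genericPoint X) (genericPoint_mem hV)).hom).toAlgebra
  let := (normalizationInToField L V hV).toAlgebra
  refine ⟨normalizationInToField_injective L hVa hV, fun {x} =>
    ⟨fun hx => exists_normalizationInToField_eq L hVa hV x hx, ?_⟩⟩
  rintro ⟨c, rfl⟩
  obtain ⟨P, hP, hPc⟩ := (normalizationInMap X L).isIntegral_app V hVa c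
  refine ⟨P, hP, ?_⟩
  have h1 : algebraMap Γ(X, V) L = (normalizationInToField L V hV).comp
      ((normalizationInMap X L).app V).hom :=
    RingHom.ext fun a => (normalizationInToField_app L V hV a).symm
  rw [h1, RingHom.algebraMap_toAlgebra, ← Polynomial.hom_eval₂, hPc, map_zero]

lemma isIntegrallyClosed_normalizationIn {V : X.Opens} (hVa : IsAffineOpen V)
    (hV : (V : Set X).Nonempty) :
    IsIntegrallyClosed Γ(normalizationIn X L, normalizationInMap X L ⁻¹ᵁ V) := by
  let : Algebra Γ(X, V) L := ((algebraMap X.functionField L).comp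
    (X.presheaf.germ V (genericPoint X) (genericPoint_mem hV)).hom).toAlgebra
  let := (normalizationInToField L V hV).toAlgebra
  let := ((normalizationInMap X L).app V).hom.toAlgebra
  have := isIntegralClosure_normalizationIn L hVa hV
  have : IsScalarTower Γ(X, V) Γ(normalizationIn X L, normalizationInMap X L ⁻¹ᵁ V) L :=
    .of_algebraMap_eq fun a => (normalizationInToField_app L V hV a).symm
  have : IsIntegrallyClosedIn Γ(normalizationIn X L, normalizationInMap X L ⁻¹ᵁ V) L :=
    .of_isIntegralClosure Γ(X, V)
  have : FaithfulSMul Γ(normalizationIn X L, normalizationInMap X L ⁻¹ᵁ V) L :=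
    (faithfulSMul_iff_algebraMap_injective _ _).2 (normalizationInToField_injective L hVa hV)
  exact .of_isIntegrallyClosedIn _ L

/-- Over a normal Noetherian affine open, the normalization in a finite separable extension is
finite. -/
lemma finite_normalizationIn [FiniteDimensional X.functionField L]
    [Algebra.IsSeparable X.functionField L] {V : X.Opens} (hVa : IsAffineOpen V)
    (hV : (V : Set X).Nonempty) [IsNoetherianRing Γ(X, V)] [IsIntegrallyClosed Γ(X, V)] :
    ((normalizationInMap X L).app V).hom.Finite := by
  have : Nonempty V := hV.to_subtype
  let : Algebra Γ(X, V) L := ((algebraMap X.functionField L).comp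
    (X.presheaf.germ V (genericPoint X) (genericPoint_mem hV)).hom).toAlgebra
  let := (normalizationInToField L V hV).toAlgebra
  let := ((normalizationInMap X L).app V).hom.toAlgebra
  have := isIntegralClosure_normalizationIn L hVa hV
  have : IsScalarTower Γ(X, V) X.functionField L := .of_algebraMap_eq fun _ => rfl
  have : IsScalarTower Γ(X, V) Γ(normalizationIn X L, normalizationInMap X L ⁻¹ᵁ V) L :=
    .of_algebraMap_eq fun a => (normalizationInToField_app L V hV a).symm
  have := functionField_isFractionRing_of_isAffineOpen X V hVa
  exact IsIntegralClosure.finite Γ(X, V) X.functionField L _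

/-- A root in `L` of `T ^ ℓ - s ^ ℓ * T - z` is a function on the preimage of `V` in the
normalization. -/
lemma exists_pow_eq_normalizationIn {V : X.Opens} (hVa : IsAffineOpen V)
    (hV : (V : Set X).Nonempty) {ℓ : ℕ} (hℓ : 1 < ℓ) (z s : Γ(X, V)) (w : L)
    (hw : w ^ ℓ = algebraMap X.functionField L
      (X.presheaf.germ V (genericPoint X) (genericPoint_mem hV) z) +
      algebraMap X.functionField L
        (X.presheaf.germ V (genericPoint X) (genericPoint_mem hV) s) ^ ℓ * w) :
    ∃ c : Γ(normalizationIn X L, normalizationInMap X L ⁻¹ᵁ V),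
      c ^ ℓ = (normalizationInMap X L).app V z + (normalizationInMap X L).app V s ^ ℓ * c := by
  obtain ⟨c, rfl⟩ := exists_normalizationInToField_eq L hVa hV w
    (isIntegralElem_of_pow_eq _ hℓ z s w hw)
  refine ⟨c, normalizationInToField_injective L hVa hV ?_⟩
  rw [map_pow, hw, map_add, map_mul, map_pow, normalizationInToField_app,
    normalizationInToField_app]

lemma isNormalScheme_normalizationIn : IsNormalScheme (normalizationIn X L) := by
  intro y
  refine ⟨inferInstance, ?_⟩
  obtain ⟨V, hVa, hyV, -⟩ := exists_isAffineOpen_mem_and_subset (U := ⊤)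
    (x := normalizationInMap X L y) trivial
  have hV : (V : Set X).Nonempty := ⟨_, hyV⟩
  have hW := hVa.preimage (normalizationInMap X L)
  have := isIntegrallyClosed_normalizationIn L hVa hV
  let y' : (normalizationInMap X L ⁻¹ᵁ V : (normalizationIn X L).Opens) := ⟨y, hyV⟩
  have : Nonempty (normalizationInMap X L ⁻¹ᵁ V : (normalizationIn X L).Opens) := ⟨y'⟩
  let := TopCat.Presheaf.algebra_section_stalk (normalizationIn X L).presheaf y'
  have := hW.isLocalization_stalk y'
  exact isIntegrallyClosed_of_isLocalization _ _
    (hW.primeIdealOf y').asIdeal.primeCompl_le_nonZeroDivisors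

instance : IsDominant (normalizationInMap X L) := by
  refine ⟨dense_iff_closure_eq.2 (Set.eq_univ_of_univ_subset ?_)⟩
  rw [← show closure {genericPoint X} = Set.univ from genericPoint_spec X]
  refine closure_mono (Set.singleton_subset_iff.2 ?_)
  let y : Spec (.of L) := IsLocalRing.closedPoint L
  refine ⟨(specToGeneric X L).toNormalization y, ?_⟩
  rw [← Scheme.Hom.comp_apply, Scheme.Hom.toNormalization_fromNormalization]
  exact specToGeneric_apply L y

/-- The function field of the normalization of `X` in `L` is `L`, so the normalization is separable
over `X` if `L` is separable over the function field of `X`. -/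
lemma isSeparableMap_normalizationInMap [FiniteDimensional X.functionField L]
    [Algebra.IsSeparable X.functionField L] :
    IsSeparableMap (normalizationInMap X L) := by
  obtain ⟨V, hVa, hyV, -⟩ := exists_isAffineOpen_mem_and_subset (U := ⊤)
    (x := genericPoint X) trivial
  have hV : (V : Set X).Nonempty := ⟨_, hyV⟩
  have hW := hVa.preimage (normalizationInMap X L)
  have hgen : genericPoint (normalizationIn X L) ∈ normalizationInMap X L ⁻¹ᵁ V := by
    show normalizationInMap X L _ ∈ V
    rw [map_genericPoint_of_isDominant]
    exact hyV
  have : Nonempty V := hV.to_subtype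
  have : Nonempty (normalizationInMap X L ⁻¹ᵁ V : (normalizationIn X L).Opens) := ⟨_, hgen⟩
  let C := Γ(normalizationIn X L, normalizationInMap X L ⁻¹ᵁ V)
  let K' := (normalizationIn X L).functionField
  let : Algebra Γ(X, V) L := ((algebraMap X.functionField L).comp
    (X.presheaf.germ V (genericPoint X) (genericPoint_mem hV)).hom).toAlgebra
  let : Algebra C L := (normalizationInToField L V hV).toAlgebra
  let := ((normalizationInMap X L).app V).hom.toAlgebra
  have := isIntegralClosure_normalizationIn L hVa hV
  have : IsScalarTower Γ(X, V) X.functionField L := .of_algebraMap_eq fun _ => rfl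
  have : IsScalarTower Γ(X, V) C L :=
    .of_algebraMap_eq fun a => (normalizationInToField_app L V hV a).symm
  have := functionField_isFractionRing_of_isAffineOpen X V hVa
  have : IsFractionRing C K' :=
    functionField_isFractionRing_of_isAffineOpen (normalizationIn X L) _ hW
  have : IsFractionRing C L :=
    IsIntegralClosure.isFractionRing_of_finite_extension Γ(X, V) X.functionField L C
  -- both `L` and the function field of the normalization are fraction fields of `C`
  let e : L ≃ₐ[C] K' := IsLocalization.algEquiv (nonZeroDivisors C) L K'
  have he : (e : L →+* K').comp (algebraMap X.functionField L) =
      functionFieldMap (normalizationInMap X L) := by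
    refine IsLocalization.ringHom_ext (nonZeroDivisors Γ(X, V)) (RingHom.ext fun a => ?_)
    have h1 : e (normalizationInToField L V hV ((normalizationInMap X L).app V a)) =
        (normalizationIn X L).presheaf.germ _ _ hgen ((normalizationInMap X L).app V a) :=
      e.commutes ((normalizationInMap X L).app V a)
    rw [normalizationInToField_app] at h1
    refine h1.trans (Eq.symm ?_)
    have h2 : X.presheaf.germ V (genericPoint X) (genericPoint_mem hV) ≫
        X.presheaf.stalkSpecializes (specializes_of_eq
          (map_genericPoint_of_isDominant (normalizationInMap X L))) ≫
        (normalizationInMap X L).stalkMap (genericPoint (normalizationIn X L)) =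
        (normalizationInMap X L).app V ≫ (normalizationIn X L).presheaf.germ _ _ hgen := by
      rw [TopCat.Presheaf.germ_stalkSpecializes_assoc, Scheme.Hom.germ_stalkMap]
    exact ConcreteCategory.congr_hom h2 a
  let := (functionFieldMap (normalizationInMap X L)).toAlgebra
  exact AlgEquiv.Algebra.isSeparable (AlgEquiv.ofRingEquiv (f := e.toRingEquiv)
    fun x => RingHom.congr_fun he x : L ≃ₐ[X.functionField] K')

end NormalizationIn

/-! ### Finite separable covers that contain prescribed roots -/

section Cover

variable {k : Type u} [Field k] {X : Scheme.{u}} [IsIntegral X] (p : X ⟶ Spec (.of k))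

/-- The normalization of a smooth integral scheme in a finite separable extension is finite, as the
scheme is covered by normal Noetherian affine opens. -/
lemma isFinite_normalizationInMap [Smooth p] (L : Type u) [Field L] [Algebra X.functionField L]
    [FiniteDimensional X.functionField L] [Algebra.IsSeparable X.functionField L] :
    IsFinite (normalizationInMap X L) := by
  refine (IsFinite.iff_isIntegralHom_and_locallyOfFiniteType _).2 ⟨inferInstance, ?_⟩
  rw [HasRingHomProperty.iff_exists_appLE (P := @LocallyOfFiniteType)
    (RingHom.finiteType_stableUnderComposition.stableUnderCompositionWithLocalizationAway
      RingHom.finiteType_holdsForLocalizationAway).left]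
  intro y
  obtain ⟨W, hW, hyW, -⟩ := exists_isAffineOpen_mem_and_subset (U := ⊤)
    (x := normalizationInMap X L y) trivial
  obtain ⟨g, hyg, -, hg⟩ := exists_basicOpen_isStandardSmooth p hW hyW (O := ⊤) trivial
  have hV := hW.basicOpen g
  have : Nonempty (X.basicOpen g) := ⟨⟨_, hyg⟩⟩
  have : IsDomain (SecRing p (X.basicOpen g)) := inferInstanceAs (IsDomain Γ(X, X.basicOpen g))
  have : IsIntegrallyClosed Γ(X, X.basicOpen g) :=
    isIntegrallyClosed_of_isStandardSmooth k (SecRing p (X.basicOpen g))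
  have : IsNoetherianRing Γ(X, X.basicOpen g) :=
    Algebra.FiniteType.isNoetherianRing k (SecRing p (X.basicOpen g))
  refine ⟨⟨_, hV⟩, ⟨_, hV.preimage (normalizationInMap X L)⟩, hyg, le_rfl, ?_⟩
  have h := finite_normalizationIn L hV ⟨_, hyg⟩
  rw [Scheme.Hom.app_eq_appLE] at h
  exact h.finiteType

/-- Given finitely many functions `z i j` and nonzero functions `s i` on nonempty affine opens
`V i` of a smooth integral scheme `X`, there is a normal finite separable cover of `X` on which
each equation `T ^ ℓ = z i j + (s i) ^ ℓ * T` has a solution. -/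
theorem exists_finite_separable_cover [Smooth p] (ℓ : ℕ) [Fact ℓ.Prime] [CharP k ℓ]
    {ι : Type*} [Finite ι] {κ : ι → Type*} [∀ i, Finite (κ i)] (V : ι → X.Opens)
    (hVa : ∀ i, IsAffineOpen (V i)) (hV : ∀ i, (V i : Set X).Nonempty)
    (z : ∀ i, κ i → Γ(X, V i)) (s : ∀ i, Γ(X, V i)) (hs : ∀ i, s i ≠ 0) :
    ∃ (Y : Scheme.{u}) (f : Y ⟶ X) (_ : IsIntegral Y) (_ : IsDominant f),
      IsFinite f ∧ IsSeparableMap f ∧ IsNormalScheme Y ∧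
      (∀ W : X.Opens, IsAffineOpen W → (W : Set X).Nonempty → IsIntegrallyClosed Γ(Y, f ⁻¹ᵁ W)) ∧
      ∀ i j, ∃ w : Γ(Y, f ⁻¹ᵁ V i), w ^ ℓ = f.app (V i) (z i j) + f.app (V i) (s i) ^ ℓ * w := by
  have : CharP X.functionField ℓ := by
    let φ : k →+* X.functionField := (secRingScalar p ⊤ ≫
      X.presheaf.germ ⊤ (genericPoint X) trivial).hom
    exact charP_of_injective_ringHom φ.injective ℓ
  let gm (i : ι) := X.presheaf.germ (V i) (genericPoint X) (genericPoint_mem (hV i))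
  obtain ⟨L, _, _, hfd, hsep, w, hw⟩ := exists_isSeparable_extension (K := X.functionField) ℓ
    (ι := Σ i, κ i) (fun i => gm i.1 (z i.1 i.2)) (fun i => gm i.1 (s i.1)) (fun i h =>
      hs i.1 (germ_injective_of_isIntegral X _ (genericPoint_mem (hV i.1))
        (h.trans (map_zero _).symm)))
  refine ⟨normalizationIn X L, normalizationInMap X L, inferInstance, inferInstance,
    isFinite_normalizationInMap p L, isSeparableMap_normalizationInMap L,
    isNormalScheme_normalizationIn L, fun W hW hW' => isIntegrallyClosed_normalizationIn L hW hW',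
    fun i j => ?_⟩
  exact exists_pow_eq_normalizationIn L (hVa i) (hV i) (Fact.out : ℓ.Prime).one_lt _ _ _ (hw ⟨i, j⟩)

end Cover

/-! ### Separable maps are generically étale -/

section GenericallyEtale

variable {X Y : Scheme.{u}} [IsIntegral X] [IsIntegral Y] (f : Y ⟶ X) [IsDominant f]

lemma genericPoint_mem_preimage {V : X.Opens} (hV : (V : Set X).Nonempty) :
    genericPoint Y ∈ f ⁻¹ᵁ V := by
  show f _ ∈ V
  rw [map_genericPoint_of_isDominant]
  exact genericPoint_mem hV

/-- The homomorphism from `Γ(X, V)` to the function field of `Y` given by a dominant morphism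
`f : Y ⟶ X`. -/
abbrev toFunctionFieldHom {V : X.Opens} (hV : (V : Set X).Nonempty) :
    Γ(X, V) →+* Y.functionField :=
  (f.app V ≫ Y.presheaf.germ (f ⁻¹ᵁ V) _ (genericPoint_mem_preimage f hV)).hom

lemma functionFieldMap_germ {V : X.Opens} (hV : (V : Set X).Nonempty) (a : Γ(X, V)) :
    functionFieldMap f (X.presheaf.germ V (genericPoint X) (genericPoint_mem hV) a) =
      toFunctionFieldHom f hV a := by
  have h2 : X.presheaf.germ V (genericPoint X) (genericPoint_mem hV) ≫
      X.presheaf.stalkSpecializes (specializes_of_eq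
        (map_genericPoint_of_isDominant f)) ≫ f.stalkMap (genericPoint Y) =
      f.app V ≫ Y.presheaf.germ _ _ (genericPoint_mem_preimage f hV) := by
    rw [TopCat.Presheaf.germ_stalkSpecializes_assoc, Scheme.Hom.germ_stalkMap]
  exact ConcreteCategory.congr_hom h2 a

/-- If `f` is separable, the function field of `Y` is formally étale over the functions on an affine
open of `X`, as the composite of a localization and a separable extension. -/
lemma formallyEtale_functionField (hf : IsSeparableMap f) {V : X.Opens} (hVa : IsAffineOpen V)
    (hV : (V : Set X).Nonempty) : (toFunctionFieldHom f hV).FormallyEtale := by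
  have : Nonempty V := hV.to_subtype
  let := (functionFieldMap f).toAlgebra
  have : Algebra.IsSeparable X.functionField Y.functionField := hf
  let := (toFunctionFieldHom f hV).toAlgebra
  have : IsScalarTower Γ(X, V) X.functionField Y.functionField :=
    .of_algebraMap_eq fun a => (functionFieldMap_germ f hV a).symm
  have := functionField_isFractionRing_of_isAffineOpen X V hVa
  have : Algebra.FormallyEtale Γ(X, V) X.functionField :=
    .of_isLocalization (nonZeroDivisors Γ(X, V))
  have : Algebra.FormallyEtale X.functionField Y.functionField :=
    .of_isSeparable _ _
  exact Algebra.FormallyEtale.comp Γ(X, V) X.functionField Y.functionField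

lemma app_injective_of_isDominant {V : X.Opens} : Function.Injective (f.app V) := by
  rcases (V : Set X).eq_empty_or_nonempty with hV | hV
  · have : V = ⊥ := by ext1; exact hV
    subst this
    have : Subsingleton Γ(X, ⊥) := inferInstance
    exact Function.injective_of_subsingleton _
  · refine (injective_iff_map_eq_zero (f.app V).hom).2 fun a ha => ?_
    refine germ_injective_of_isIntegral X _ (genericPoint_mem hV) ?_
    rw [map_zero]
    refine (functionFieldMap f).injective ?_
    rw [functionFieldMap_germ f hV, map_zero]
    exact (congrArg (Y.presheaf.germ _ _ (genericPoint_mem_preimage f hV)) ha).trans (map_zero _)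

end GenericallyEtale

/-! ### Twisted forms on a generically étale cover -/

section LocalForms

variable {k : Type u} [Field k] {X Y : Scheme.{u}} (p : X ⟶ Spec (.of k))

lemma exists_basis_kaehlerDifferential (A : Type u) [CommRing A] [Algebra k A]
    [Algebra.IsStandardSmooth k A] :
    ∃ n : ℕ, Nonempty (Module.Basis (Fin n) A (Ω[A⁄k])) := by
  have := Algebra.IsStandardSmooth.free_kaehlerDifferential (R := k) (S := A)
  let b := Module.Free.chooseBasis A (Ω[A⁄k])
  exact ⟨_, ⟨b.reindex (Fintype.equivFin _)⟩⟩

/-- If `Ω_{A/k}` is free, and `A → B → L` composes to an injective formally étale map into a field,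
then `⋀^q Ω_{A/k}` embeds into `⋀^q Ω_{B/k}`, since it embeds into `⋀^q Ω_{L/k}`. -/
lemma kaehlerExteriorMap_injective {A B L : Type*} [CommRing A] [CommRing B]
    [Field L] [Algebra k A] [Algebra k B] [Algebra k L] [Algebra A B] [Algebra A L] [Algebra B L]
    [IsScalarTower k A B] [IsScalarTower k A L] [IsScalarTower k B L] [IsScalarTower A B L]
    [Algebra.FormallyEtale A L] (hinj : Function.Injective (algebraMap A L))
    {n : ℕ} (β : Module.Basis (Fin n) A (Ω[A⁄k])) (q : ℕ) :
    Function.Injective (kaehlerExteriorMap k A B q) := by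
  refine (injective_iff_map_eq_zero _).2 fun η h => ?_
  let b := β.exteriorPower q
  rw [← b.sum_repr η] at h ⊢
  have hli := exteriorPower.ιMulti_family_linearIndependent_field q
    (linearIndependent_map_basis (L := L) β).1
  have h2 := congrArg (kaehlerExteriorMap k B L q) h
  simp only [b, exteriorPower.basis_apply, map_zero, map_smul, map_sum, exteriorPower.ιMulti_family,
    kaehlerExteriorMap_ιMulti, LinearMap.map_smul_of_tower, map_map_apply] at h2
  have h3 : ∀ s, algebraMap A L (b.repr η s) = 0 := by
    refine Fintype.linearIndependent_iff.1 hli _ ?_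
    rw [← h2]
    refine Finset.sum_congr rfl fun s _ => ?_
    rw [algebraMap_smul]
    rfl
  refine Finset.sum_eq_zero fun s _ => ?_
  have := h3 s
  rw [map_eq_zero_iff _ hinj] at this
  rw [this, zero_smul]

/-- The twisted version of `kaehlerExteriorMap_injective`, for coefficients in free modules of rank
one and a map `m` that sends a generator to a generator. -/
lemma semilinearFormsMap_injective {A B L : Type*} [CommRing A] [CommRing B]
    [Field L] [Algebra k A] [Algebra k B] {P Q : Type*} [AddCommGroup P] [Module A P]
    [AddCommGroup Q] [Module B Q] (φ : A →ₐ[k] B) (m : P →ₛₗ[φ.toRingHom] Q) (g : B →+* L)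
    (hg : (g.comp φ.toRingHom).FormallyEtale) (hinj : Function.Injective (g.comp φ.toRingHom))
    {n : ℕ} (β : Module.Basis (Fin n) A (Ω[A⁄k])) (e : P ≃ₗ[A] A) (e' : Q ≃ₗ[B] B)
    (he : e' (m (e.symm 1)) = 1) (q : ℕ) :
    Function.Injective (semilinearFormsMap φ m q) := by
  let : Algebra A B := φ.toRingHom.toAlgebra
  let : Algebra B L := g.toAlgebra
  let : Algebra A L := (g.comp φ.toRingHom).toAlgebra
  let : Algebra k L := (g.comp (algebraMap k B)).toAlgebra
  have : IsScalarTower k A B := .of_algebraMap_eq fun r => (φ.commutes r).symm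
  have : IsScalarTower k B L := .of_algebraMap_eq fun r => rfl
  have : IsScalarTower A B L := .of_algebraMap_eq fun r => rfl
  have : IsScalarTower k A L := .of_algebraMap_eq fun r => congrArg g (φ.commutes r).symm
  have : Algebra.FormallyEtale A L := hg
  refine (injective_iff_map_eq_zero _).2 fun ω h => ?_
  let T : AlgTwistedForms k A P q ≃ₗ[A] ⋀[A]^q Ω[A⁄k] :=
    TensorProduct.congr (LinearEquiv.refl A _) e ≪≫ₗ TensorProduct.rid A _
  let T' : AlgTwistedForms k B Q q ≃ₗ[B] ⋀[B]^q Ω[B⁄k] :=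
    TensorProduct.congr (LinearEquiv.refl B _) e' ≪≫ₗ TensorProduct.rid B _
  obtain ⟨η, rfl⟩ := T.symm.surjective ω
  have h1 : T.symm η = η ⊗ₜ e.symm 1 := by simp [T]
  have h2 : semilinearFormsMap φ m q (η ⊗ₜ e.symm 1) =
      kaehlerExteriorMap k A B q η ⊗ₜ m (e.symm 1) := rfl
  rw [h1, h2] at h
  have h3 := congrArg T' h
  simp only [T', LinearEquiv.trans_apply, TensorProduct.congr_tmul, he, LinearEquiv.refl_apply,
    TensorProduct.rid_tmul, one_smul, map_zero] at h3
  rw [kaehlerExteriorMap_injective (L := L) hinj β q (h3.trans (map_zero _).symm), map_zero]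

lemma resSection_self (M : X.Modules) {V : X.Opens} (e : Γ(M, V)) : resSection M le_rfl e = e :=
  ConcreteCategory.congr_hom (M.presheaf.map_id (.op V)) e

/-- A frame of `M` over `V` identifies the sections of `M` over `V` with functions. -/
lemma IsFrame.exists_linearEquiv {M : X.Modules} {V : X.Opens} {e : Γ(M, V)} (he : IsFrame M e) :
    ∃ ε : Γ(M, V) ≃ₗ[SecRing p V] SecRing p V, ε.symm 1 = e := by
  have h := he V le_rfl
  let φ : SecRing p V →ₗ[SecRing p V] Γ(M, V) :=
    LinearMap.toSpanSingleton _ _ (resSection M le_rfl e)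
  refine ⟨(LinearEquiv.ofBijective φ h).symm, ?_⟩
  exact (one_smul (SecRing p V) _).trans (resSection_self M e)

variable [IsIntegral X] [IsIntegral Y] (f : Y ⟶ X) [IsDominant f] {ℓ : ℕ} [Fact ℓ.Prime]
  [CharP k ℓ] {M : X.Modules} {q : ℕ}

/-- On the preimage of a small enough affine open `V`, forms that are spanned by wedge products of
differentials of roots are torsion free. -/
lemma forms_eq_zero_of_smul_eq_zero [PerfectField k] (hf : IsSeparableMap f) {V : X.Opens}
    (hVa : IsAffineOpen V) (hV : (V : Set X).Nonempty) [Algebra.IsStandardSmooth k (SecRing p V)]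
    (hY : IsIntegrallyClosed Γ(Y, f ⁻¹ᵁ V)) {e : Γ(M, V)} (he : IsFrame M e)
    {J : Type*} [Finite J] {z : J → SecRing p V} (hz : GeneratesUpToInverses k z)
    {s : SecRing p V} (hs : s ≠ 0) {v : J → (SecRing p V)ˣ} {w : J → SecRing (f ≫ p) (f ⁻¹ᵁ V)}
    (hw : ∀ j, w j ^ ℓ = secRingMap p f V _ le_rfl (z j) +
      secRingMap p f V _ le_rfl ((s * v j) ^ ℓ) * w j)
    {ω : FormsOn (f ≫ p) ((Scheme.Modules.pullback f).obj M) q (f ⁻¹ᵁ V)}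
    (hω : ω ∈ wedgeForms k w Γ((Scheme.Modules.pullback f).obj M, f ⁻¹ᵁ V) q)
    {b : SecRing (f ≫ p) (f ⁻¹ᵁ V)} (hb : b ≠ 0) (h : b • ω = 0) : ω = 0 := by
  let A := SecRing p V
  let B := SecRing (f ≫ p) (f ⁻¹ᵁ V)
  let φ := secRingMap p f V (f ⁻¹ᵁ V) le_rfl
  have hW := genericPoint_mem_preimage f hV
  have : Nonempty (f ⁻¹ᵁ V : Y.Opens) := ⟨_, hW⟩
  have : IsDomain B := inferInstanceAs (IsDomain Γ(Y, f ⁻¹ᵁ V))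
  have : IsIntegrallyClosed B := hY
  have : CharP B ℓ := charP_of_injective_ringHom (algebraMap k B).injective ℓ
  let g : B →+* Y.functionField := (Y.presheaf.germ (f ⁻¹ᵁ V) _ hW).hom
  let : Algebra A B := φ.toRingHom.toAlgebra
  let : Algebra B Y.functionField := g.toAlgebra
  let : Algebra A Y.functionField := (g.comp φ.toRingHom).toAlgebra
  let : Algebra k Y.functionField := (g.comp (algebraMap k B)).toAlgebra
  have : IsScalarTower k A B := .of_algebraMap_eq fun r => (φ.commutes r).symm
  have : IsScalarTower k B Y.functionField := .of_algebraMap_eq fun r => rfl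
  have : IsScalarTower A B Y.functionField := .of_algebraMap_eq fun r => rfl
  have : IsScalarTower k A Y.functionField :=
    .of_algebraMap_eq fun r => congrArg g (φ.commutes r).symm
  have : Algebra.FormallyEtale A Y.functionField := by
    have h1 := formallyEtale_functionField f hf hVa hV
    have h2 : toFunctionFieldHom f hV = g.comp φ.toRingHom :=
      congrArg (fun t => (t ≫ Y.presheaf.germ (f ⁻¹ᵁ V) _ hW).hom)
        (Scheme.Hom.app_eq_appLE (U := V) f)
    rw [h2] at h1
    exact h1
  obtain ⟨n, ⟨β⟩⟩ := exists_basis_kaehlerDifferential (k := k) A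
  obtain ⟨ε, -⟩ := (he.pullSection f).exists_linearEquiv (f ≫ p)
  have hBL : Function.Injective (algebraMap B Y.functionField) :=
    germ_injective_of_isIntegral Y _ hW
  have hs' : algebraMap A B s ≠ 0 := by
    refine (map_ne_zero_iff φ.toRingHom ?_).2 hs
    have h1 := app_injective_of_isDominant f (V := V)
    rw [Scheme.Hom.app_eq_appLE] at h1
    exact h1
  exact eq_zero_of_smul_eq_zero_of_mem_wedgeForms (L := Y.functionField) hBL hs' hz hw β ε hω hb h

/-- Pullback of forms along a separable map is injective over small enough affine opens. -/
lemma formsPullback_injective (hf : IsSeparableMap f) {V : X.Opens} (hVa : IsAffineOpen V)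
    (hV : (V : Set X).Nonempty) [Algebra.IsStandardSmooth k (SecRing p V)]
    {e : Γ(M, V)} (he : IsFrame M e) :
    Function.Injective (formsPullback p f M q V (f ⁻¹ᵁ V) le_rfl) := by
  let φ := secRingMap p f V (f ⁻¹ᵁ V) le_rfl
  have hW := genericPoint_mem_preimage f hV
  let g : SecRing (f ≫ p) (f ⁻¹ᵁ V) →+* Y.functionField :=
    (Y.presheaf.germ (f ⁻¹ᵁ V) _ hW).hom
  have h1 := formallyEtale_functionField f hf hVa hV
  have h2 : toFunctionFieldHom f hV = g.comp φ.toRingHom :=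
    congrArg (fun t => (t ≫ Y.presheaf.germ (f ⁻¹ᵁ V) _ hW).hom)
        (Scheme.Hom.app_eq_appLE (U := V) f)
  have h3 : Function.Injective (toFunctionFieldHom f hV) :=
    (germ_injective_of_isIntegral Y _ hW).comp (app_injective_of_isDominant f)
  rw [h2] at h1 h3
  obtain ⟨n, ⟨β⟩⟩ := exists_basis_kaehlerDifferential (k := k) (SecRing p V)
  obtain ⟨ε, hε⟩ := he.exists_linearEquiv p
  obtain ⟨ε', hε'⟩ := (he.pullSection f).exists_linearEquiv (f ≫ p)
  refine semilinearFormsMap_injective φ (modulePullback p f M V (f ⁻¹ᵁ V) le_rfl) g h1 h3 β ε ε'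
    ?_ q
  rw [hε, ← LinearEquiv.eq_symm_apply, hε']
  exact resSection_self _ _

end LocalForms

section SecRing

variable {k : Type u} [Field k] {X Y : Scheme.{u}} (p : X ⟶ Spec (.of k)) (f : Y ⟶ X)

lemma secRingMap_injective [IsIntegral X] [IsIntegral Y] [IsDominant f] (V : X.Opens) :
    Function.Injective (secRingMap p f V (f ⁻¹ᵁ V) le_rfl) := by
  have h1 := app_injective_of_isDominant f (V := V)
  rw [Scheme.Hom.app_eq_appLE] at h1
  exact h1

lemma secRingRes_injective [IsIntegral X] {V V' : X.Opens} (h : V' ≤ V)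
    (hV : (V' : Set X).Nonempty) : Function.Injective (secRingRes p V V' h) :=
  have : Nonempty V' := hV.to_subtype
  map_injective_of_isIntegral X (homOfLE h)

lemma preimage_basicOpen_secRing {V : X.Opens} (t : SecRing p V) :
    f ⁻¹ᵁ X.basicOpen (show Γ(X, V) from t) =
      Y.basicOpen (show Γ(Y, f ⁻¹ᵁ V) from secRingMap p f V _ le_rfl t) := by
  rw [Scheme.preimage_basicOpen]
  exact congrArg Y.basicOpen (congrArg (fun φ => φ.hom t) (Scheme.Hom.app_eq_appLE (U := V) f))

lemma exists_pow_smul_eq_zero_of_formsRes {M : X.Modules} {q : ℕ} (hM : IsLocallyFramed M)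
    {W : X.Opens} (hW : IsAffineOpen W) (g : SecRing p W) {W' : X.Opens}
    (hW' : W' = X.basicOpen (show Γ(X, W) from g)) (h : W' ≤ W) (ω : FormsOn p M q W)
    (hω : formsRes p M q W W' h ω = 0) : ∃ n : ℕ, g ^ n • ω = 0 := by
  subst hW'
  exact (formsRes_isLocalized p q hM hW (show Γ(X, W) from g)).1 ω hω

end SecRing

/-! ### Charts with roots -/

section RootCharts

variable {k : Type u} [Field k] {X Y : Scheme.{u}} (p : X ⟶ Spec (.of k)) (f : Y ⟶ X) (ℓ m : ℕ)

/-- An affine open `V` of `X` with a function `t`, together with roots in `Γ(Y, f⁻¹ V)` of the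
polynomials `T ^ ℓ - (t ^ m) ^ ℓ * T - z i`, where the `z i` are finitely many generators of the
`k`-algebra `Γ(X, V)`. -/
structure RootChart where
  /-- The affine open. -/
  V : X.Opens
  isAffineOpen : IsAffineOpen V
  /-- The function on `V`. -/
  t : SecRing p V
  /-- The index set of the generators. -/
  κ : Type u
  [finite : Finite κ]
  /-- The generators. -/
  z : κ → SecRing p V
  adjoin_eq_top : Algebra.adjoin k (Set.range z) = ⊤
  /-- The roots. -/
  w : κ → SecRing (f ≫ p) (f ⁻¹ᵁ V)
  pow_eq : ∀ i, w i ^ ℓ = secRingMap p f V _ le_rfl (z i) +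
    secRingMap p f V _ le_rfl (t ^ m) ^ ℓ * w i

attribute [instance] RootChart.finite

namespace RootChart

variable {p f ℓ m} (c : RootChart p f ℓ m)

/-- The roots, restricted to an open subset. -/
def root (W : Y.Opens) (hW : W ≤ f ⁻¹ᵁ c.V) (i : c.κ) : SecRing (f ≫ p) W :=
  secRingRes (f ≫ p) _ W hW (c.w i)

/-- The forms on `W` that are spanned by wedge products of differentials of the roots. -/
def forms (M : X.Modules) (q : ℕ) (W : Y.Opens) (hW : W ≤ f ⁻¹ᵁ c.V) :
    Submodule (SecRing (f ≫ p) W) (FormsOn (f ≫ p) ((Scheme.Modules.pullback f).obj M) q W) :=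
  wedgeForms k (c.root W hW) Γ((Scheme.Modules.pullback f).obj M, W) q

lemma secRingRes_root {W W' : Y.Opens} (hW : W ≤ f ⁻¹ᵁ c.V) (h : W' ≤ W) (i : c.κ) :
    secRingRes (f ≫ p) W W' h (c.root W hW i) = c.root W' (h.trans hW) i :=
  ringRes_ringRes hW h (c.w i)

lemma secRingRes_secRingMap {V V' : X.Opens} (h : V' ≤ V) (a : SecRing p V) :
    secRingRes (f ≫ p) (f ⁻¹ᵁ V) (f ⁻¹ᵁ V') (f.preimage_mono h) (secRingMap p f V _ le_rfl a) =
      secRingMap p f V' _ le_rfl (secRingRes p V V' h a) := by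
  have h1 : f.appLE V (f ⁻¹ᵁ V) le_rfl ≫ Y.presheaf.map (homOfLE (f.preimage_mono h)).op =
      X.presheaf.map (homOfLE h).op ≫ f.appLE V' (f ⁻¹ᵁ V') le_rfl := by
    rw [Scheme.Hom.appLE_map, Scheme.Hom.map_appLE]
  exact ConcreteCategory.congr_hom h1 a

lemma root_pow {V : X.Opens} (hV : V ≤ c.V) (i : c.κ) :
    c.root (f ⁻¹ᵁ V) (f.preimage_mono hV) i ^ ℓ =
      secRingMap p f V _ le_rfl (secRingRes p c.V V hV (c.z i)) +
      secRingMap p f V _ le_rfl (secRingRes p c.V V hV c.t ^ m) ^ ℓ *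
        c.root (f ⁻¹ᵁ V) (f.preimage_mono hV) i := by
  have h := congrArg (secRingRes (f ≫ p) _ _ (f.preimage_mono hV)) (c.pow_eq i)
  rw [map_pow, map_add, map_mul, map_pow, secRingRes_secRingMap hV, secRingRes_secRingMap hV,
    map_pow (secRingRes p c.V V hV)] at h
  exact h

lemma formsRes_mem_forms {M : X.Modules} {q : ℕ} {W W' : Y.Opens} (hW : W ≤ f ⁻¹ᵁ c.V)
    (h : W' ≤ W) {ω} (hω : ω ∈ c.forms M q W hW) :
    formsRes (f ≫ p) _ q W W' h ω ∈ c.forms M q W' (h.trans hW) := by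
  have h1 := semilinearFormsMap_mem_wedgeForms (secRingRes (f ≫ p) W W' h)
    (moduleRes (f ≫ p) ((Scheme.Modules.pullback f).obj M) W W' h) hω
  have h2 : (fun i => secRingRes (f ≫ p) W W' h (c.root W hW i)) = c.root W' (h.trans hW) :=
    funext fun i => c.secRingRes_root hW h i
  rw [h2] at h1
  exact h1

lemma generatesUpToInverses_of_basicOpen (g : SecRing p c.V) {V : X.Opens}
    (hV : V = X.basicOpen (show Γ(X, c.V) from g)) (hle : V ≤ c.V) :
    GeneratesUpToInverses k fun i => secRingRes p c.V V hle (c.z i) := by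
  let := (secRingRes p c.V V hle).toRingHom.toAlgebra
  have : IsScalarTower k (SecRing p c.V) (SecRing p V) :=
    .of_algebraMap_eq fun r => ((secRingRes p c.V V hle).commutes r).symm
  have := isLocalization_secRing p c.isAffineOpen g hV hle
  exact generatesUpToInverses_of_isLocalization (A' := SecRing p V) g c.adjoin_eq_top

/-- The pullback of a form is divisible by `(t ^ m) ^ q` among the forms spanned by wedge products
of differentials of the roots. -/
lemma exists_formsPullback_eq_smul [Fact ℓ.Prime] [CharP k ℓ] {M : X.Modules} {q : ℕ}
    {V : X.Opens} (hV : V ≤ c.V)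
    (hz : GeneratesUpToInverses k fun i => secRingRes p c.V V hV (c.z i))
    [Nontrivial (SecRing (f ≫ p) (f ⁻¹ᵁ V))] (ω : FormsOn p M q V) :
    ∃ η ∈ c.forms M q (f ⁻¹ᵁ V) (f.preimage_mono hV), formsPullback p f M q V _ le_rfl ω =
      secRingMap p f V (f ⁻¹ᵁ V) le_rfl (secRingRes p c.V V hV c.t ^ m) ^ q • η := by
  let A := SecRing p V
  let B := SecRing (f ≫ p) (f ⁻¹ᵁ V)
  let φ := secRingMap p f V (f ⁻¹ᵁ V) le_rfl
  have : CharP B ℓ := charP_of_injective_ringHom (algebraMap k B).injective ℓ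
  let : Algebra A B := φ.toRingHom.toAlgebra
  have : IsScalarTower k A B := .of_algebraMap_eq fun r => (φ.commutes r).symm
  have key := D_algebraMap_mem_smul_span (k := k) (A := A) (B := B) (p := ℓ) (v := fun _ => 1)
    (s := secRingRes p c.V V hV c.t ^ m) (w := c.root (f ⁻¹ᵁ V) (f.preimage_mono hV)) hz
    (fun j => by
      rw [Units.val_one, mul_one, map_pow (algebraMap A B)]
      exact c.root_pow hV j)
  refine exists_semilinearFormsMap_eq_smul (w := c.root (f ⁻¹ᵁ V) (f.preimage_mono hV)) φ
    (modulePullback p f M V _ le_rfl) (fun a => ?_) ω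
  have h1 := key a
  rw [Submodule.ideal_span_singleton_smul, Submodule.mem_smul_pointwise_iff_exists] at h1
  exact h1

/-- Every point of a chart has arbitrarily small basic open neighborhoods in it that are standard
smooth and on which the line bundle has a frame. -/
lemma exists_isStandardSmooth_isFrame [Smooth p] {M : X.Modules} (hM : IsLocallyFramed M)
    {x : X} (hx : x ∈ c.V) {O : X.Opens} (hO : x ∈ O) :
    ∃ (g : SecRing p c.V) (V : X.Opens) (_ : V = X.basicOpen (show Γ(X, c.V) from g))
      (e : Γ(M, V)), x ∈ V ∧ V ≤ c.V ∧ V ≤ O ∧ Algebra.IsStandardSmooth k (SecRing p V) ∧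
        IsFrame M e := by
  obtain ⟨O', hxO', e, he⟩ := hM x
  obtain ⟨g, hxg, hgO, hg⟩ := exists_basicOpen_isStandardSmooth p c.isAffineOpen hx
    (O := O ⊓ O') ⟨hO, hxO'⟩
  exact ⟨g, _, rfl, resSection M (hgO.trans inf_le_right) e, hxg, X.basicOpen_le _,
    hgO.trans inf_le_left, hg, he.res _⟩

/-- The generators of two charts, over a common open subset. -/
def pairGenerators (c' : RootChart p f ℓ m) {V : X.Opens} (hle : V ≤ c.V) (hle' : V ≤ c'.V) :
    c.κ ⊕ c'.κ → SecRing p V :=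
  Sum.elim (fun i => secRingRes p c.V V hle (c.z i)) (fun i => secRingRes p c'.V V hle' (c'.z i))

/-- The roots of two charts, over a common open subset. -/
def pairRoots (c' : RootChart p f ℓ m) {V : X.Opens} (hle : V ≤ c.V) (hle' : V ≤ c'.V) :
    c.κ ⊕ c'.κ → SecRing (f ≫ p) (f ⁻¹ᵁ V) :=
  Sum.elim (c.root _ (f.preimage_mono hle)) (c'.root _ (f.preimage_mono hle'))

/-- If the functions `t` of two charts differ by a unit `u`, then the roots of both satisfy
equations of the same shape, with the function `t` of the first chart and the units `1` and `u ^ m`.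
This makes the torsion-freeness criterion applicable to differences of forms from the two charts. -/
lemma pairRoots_pow {c' : RootChart p f ℓ m} {V : X.Opens} (hle : V ≤ c.V) (hle' : V ≤ c'.V)
    {u : (SecRing p V)ˣ}
    (hu : secRingRes p c'.V V hle' c'.t = u * secRingRes p c.V V hle c.t) (j : c.κ ⊕ c'.κ) :
    c.pairRoots c' hle hle' j ^ ℓ =
      secRingMap p f V _ le_rfl (c.pairGenerators c' hle hle' j) +
      secRingMap p f V _ le_rfl ((secRingRes p c.V V hle c.t ^ m *
        (Sum.elim (fun _ => 1) (fun _ => u ^ m) j : (SecRing p V)ˣ)) ^ ℓ) *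
        c.pairRoots c' hle hle' j := by
  rcases j with i | i
  · simp only [pairRoots, pairGenerators, Sum.elim_inl, Units.val_one, mul_one]
    rw [map_pow]
    exact c.root_pow hle i
  · simp only [pairRoots, pairGenerators, Sum.elim_inr, Units.val_pow_eq_pow_val]
    rw [mul_comm (_ ^ m) (_ ^ m), ← mul_pow, ← hu, map_pow]
    exact c'.root_pow hle' i

lemma exists_unit_of_le {c' : RootChart p f ℓ m} {V : X.Opens} (hle : V ≤ c.V) (hle' : V ≤ c'.V)
    (hu : ∃ u : Γ(X, c.V ⊓ c'.V)ˣ, ringRes inf_le_right (show Γ(X, c'.V) from c'.t) =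
      u.val * ringRes inf_le_left (show Γ(X, c.V) from c.t)) :
    ∃ u : (SecRing p V)ˣ, secRingRes p c'.V V hle' c'.t = u * secRingRes p c.V V hle c.t := by
  obtain ⟨u, hu⟩ := hu
  refine ⟨Units.map (ringRes (le_inf hle hle')).toMonoidHom u, ?_⟩
  have h1 := congrArg (ringRes (le_inf hle hle')) hu
  rw [map_mul, ringRes_ringRes, ringRes_ringRes] at h1
  exact h1

lemma sub_mem_wedgeForms_pairRoots {M : X.Modules} {q : ℕ} {c' : RootChart p f ℓ m} {V : X.Opens}
    (hle : V ≤ c.V) (hle' : V ≤ c'.V)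
    {x y : FormsOn (f ≫ p) ((Scheme.Modules.pullback f).obj M) q (f ⁻¹ᵁ V)}
    (hx : x ∈ c.forms M q _ (f.preimage_mono hle))
    (hy : y ∈ c'.forms M q _ (f.preimage_mono hle')) :
    x - y ∈ wedgeForms k (c.pairRoots c' hle hle')
      Γ((Scheme.Modules.pullback f).obj M, f ⁻¹ᵁ V) q := by
  have h1 : x ∈ wedgeForms k (c.pairRoots c' hle hle')
      Γ((Scheme.Modules.pullback f).obj M, f ⁻¹ᵁ V) q :=
    wedgeForms_mono (w := c.root _ (f.preimage_mono hle)) (fun i => ⟨.inl i, rfl⟩) hx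
  have h2 : y ∈ wedgeForms k (c.pairRoots c' hle hle')
      Γ((Scheme.Modules.pullback f).obj M, f ⁻¹ᵁ V) q :=
    wedgeForms_mono (w := c'.root _ (f.preimage_mono hle')) (fun i => ⟨.inr i, rfl⟩) hy
  exact Submodule.sub_mem _ h1 h2

variable [Fact ℓ.Prime] [CharP k ℓ] [IsIntegral X] [IsIntegral Y] [IsDominant f]

/-- Two forms that are spanned by wedge products of differentials of the roots of two charts are
equal if they agree where `t` is invertible. -/
theorem eq_of_mem_forms [IsAffineHom f] [PerfectField k] (hf : IsSeparableMap f) {M : X.Modules}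
    (hM : IsLocallyFramed M) {q : ℕ} {c' : RootChart p f ℓ m}
    (hu : ∃ u : Γ(X, c.V ⊓ c'.V)ˣ, ringRes inf_le_right (show Γ(X, c'.V) from c'.t) =
      u.val * ringRes inf_le_left (show Γ(X, c.V) from c.t)) (ht : c.t ≠ 0)
    (g : SecRing p c.V) {V : X.Opens} (hV : V = X.basicOpen (show Γ(X, c.V) from g))
    (hVne : (V : Set X).Nonempty) (hle : V ≤ c.V) (hle' : V ≤ c'.V)
    (hss : Algebra.IsStandardSmooth k (SecRing p V)) (hY : IsIntegrallyClosed Γ(Y, f ⁻¹ᵁ V))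
    {e : Γ(M, V)} (he : IsFrame M e)
    {x y : FormsOn (f ≫ p) ((Scheme.Modules.pullback f).obj M) q (f ⁻¹ᵁ V)}
    (hx : x ∈ c.forms M q _ (f.preimage_mono hle)) (hy : y ∈ c'.forms M q _ (f.preimage_mono hle'))
    {D : X.Opens} (hD : D = X.basicOpen (show Γ(X, V) from secRingRes p c.V V hle c.t))
    (hDV : D ≤ V) (h : formsRes (f ≫ p) _ q _ (f ⁻¹ᵁ D) (f.preimage_mono hDV) x =
      formsRes (f ≫ p) _ q _ (f ⁻¹ᵁ D) (f.preimage_mono hDV) y) : x = y := by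
  have hVa : IsAffineOpen V := hV ▸ c.isAffineOpen.basicOpen _
  have : Nonempty V := hVne.to_subtype
  have : IsDomain (SecRing p V) := inferInstanceAs (IsDomain Γ(X, V))
  have : Nonempty (f ⁻¹ᵁ V : Y.Opens) := ⟨_, genericPoint_mem_preimage f hVne⟩
  have : IsDomain (SecRing (f ≫ p) (f ⁻¹ᵁ V)) := inferInstanceAs (IsDomain Γ(Y, f ⁻¹ᵁ V))
  have ht' : secRingRes p c.V V hle c.t ≠ 0 :=
    (map_ne_zero_iff _ (secRingRes_injective p hle hVne)).2 ht
  obtain ⟨u, hu⟩ := c.exists_unit_of_le hle hle' hu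
  have hz : GeneratesUpToInverses k (c.pairGenerators c' hle hle') :=
    (c.generatesUpToInverses_of_basicOpen g hV hle).of_comp fun i => ⟨.inl i, rfl⟩
  -- `x - y` vanishes where `t` is invertible, so a power of `t` kills it
  obtain ⟨n, hn⟩ := exists_pow_smul_eq_zero_of_formsRes (f ≫ p) (hM.pullback f) (hVa.preimage f)
    (secRingMap p f V _ le_rfl (secRingRes p c.V V hle c.t))
    (by rw [hD]; exact preimage_basicOpen_secRing p f _) (f.preimage_mono hDV) (x - y)
    (by rw [map_sub, h, sub_self])
  exact sub_eq_zero.1 (forms_eq_zero_of_smul_eq_zero p f hf hVa hVne hY he hz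
    (pow_ne_zero m ht') (c.pairRoots_pow hle hle' hu)
    (c.sub_mem_wedgeForms_pairRoots hle hle' hx hy)
    (pow_ne_zero n ((map_ne_zero_iff _ (secRingMap_injective p f V)).2 ht')) hn)

end RootChart
end RootCharts

/-! ### Extending the pullback of a form -/

section Regularization

variable {k : Type u} [Field k] {X Y : Scheme.{u}} {p : X ⟶ Spec (.of k)} {f : Y ⟶ X} {ℓ m : ℕ}

namespace RootChart

variable (c : RootChart p f ℓ m) {M : X.Modules} {q : ℕ}

lemma generatesUpToInverses :
    GeneratesUpToInverses k fun i => secRingRes p c.V c.V le_rfl (c.z i) :=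
  c.generatesUpToInverses_of_basicOpen 1
    (X.basicOpen_of_isUnit (isUnit_one (M := Γ(X, c.V)))).symm le_rfl

variable [Fact ℓ.Prime] [CharP k ℓ]

/-- If `t ^ n` times a form on the locus where `t` is invertible extends to `V`, with `n` at most
`m * q`, then the pullback of that form extends to the preimage of `V`. -/
lemma exists_mem_forms_formsRes_eq {D : X.Opens}
    (hD : D = X.basicOpen (show Γ(X, c.V) from c.t)) (hDV : D ≤ c.V)
    [Nontrivial (SecRing (f ≫ p) (f ⁻¹ᵁ c.V))] (a : FormsOn p M q D) {n : ℕ} (hn : n ≤ m * q)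
    {η : FormsOn p M q c.V}
    (h : formsRes p M q c.V D hDV η = secRingRes p c.V D hDV (c.t ^ n) • a) :
    ∃ ω ∈ c.forms M q (f ⁻¹ᵁ c.V) le_rfl,
      formsRes (f ≫ p) _ q _ (f ⁻¹ᵁ D) (f.preimage_mono hDV) ω =
        formsPullback p f M q D (f ⁻¹ᵁ D) le_rfl a := by
  obtain ⟨ξ, hξ, hηξ⟩ := c.exists_formsPullback_eq_smul le_rfl c.generatesUpToInverses η
  have hself : secRingRes p c.V c.V le_rfl c.t = c.t :=
    ConcreteCategory.congr_hom (X.presheaf.map_id (.op c.V)) c.t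
  rw [hself] at hηξ
  let τ := secRingMap p f D (f ⁻¹ᵁ D) le_rfl (secRingRes p c.V D hDV c.t)
  have hτ : IsUnit τ := by
    refine IsUnit.map (secRingMap p f D (f ⁻¹ᵁ D) le_rfl) ?_
    subst hD
    exact isUnit_secRingRes_basicOpen c.t
  -- the pullback of `η` is both `t ^ (m * q) • ξ` and `t ^ n` times the pullback of `a`
  refine ⟨secRingMap p f c.V (f ⁻¹ᵁ c.V) le_rfl (c.t ^ (m * q - n)) • ξ,
    Submodule.smul_mem _ _ hξ, ?_⟩
  have h1 := congrArg (formsRes (f ≫ p) _ q _ (f ⁻¹ᵁ D) (f.preimage_mono hDV)) hηξ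
  rw [formsRes_formsPullback, ← formsPullback_formsRes p M q f le_rfl hDV, h, formsPullback_smul,
    ← map_pow, ← pow_mul, formsRes_smul, secRingRes_secRingMap hDV] at h1
  rw [formsRes_smul, secRingRes_secRingMap hDV]
  have h2 : τ ^ n • (secRingMap p f D (f ⁻¹ᵁ D) le_rfl
      (secRingRes p c.V D hDV (c.t ^ (m * q - n))) •
        formsRes (f ≫ p) _ q _ (f ⁻¹ᵁ D) (f.preimage_mono hDV) ξ) =
      τ ^ n • formsPullback p f M q D (f ⁻¹ᵁ D) le_rfl a := by
    rw [smul_smul, ← map_pow, ← map_pow, ← map_mul, ← map_mul, ← pow_add,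
      Nat.add_sub_cancel' hn]
    exact h1.symm
  exact (hτ.pow n).smul_left_cancel.1 h2

variable [IsIntegral X] [IsIntegral Y] [IsDominant f] [Smooth p] [IsAffineHom f] [PerfectField k]

/-- Two forms that are locally spanned by wedge products of differentials of the roots of two charts
are equal if they agree over a nonempty open subset `D` on which `t` is invertible. -/
theorem formsRes_eq_of_mem_forms (hf : IsSeparableMap f) (hM : IsLocallyFramed M)
    (hY : ∀ V : X.Opens, IsAffineOpen V → (V : Set X).Nonempty → IsIntegrallyClosed Γ(Y, f ⁻¹ᵁ V))
    {c' : RootChart p f ℓ m}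
    (hu : ∃ u : Γ(X, c.V ⊓ c'.V)ˣ, ringRes inf_le_right (show Γ(X, c'.V) from c'.t) =
      u.val * ringRes inf_le_left (show Γ(X, c.V) from c.t)) (ht : c.t ≠ 0)
    {D : X.Opens} (hD : X.basicOpen (show Γ(X, c.V) from c.t) = c.V ⊓ D)
    {O : X.Opens} (hO : O ≤ c.V) (hO' : O ≤ c'.V) {Wx Wy : Y.Opens} (hWx : f ⁻¹ᵁ O ≤ Wx)
    (hWy : f ⁻¹ᵁ O ≤ Wy)
    {x : FormsOn (f ≫ p) ((Scheme.Modules.pullback f).obj M) q Wx}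
    {y : FormsOn (f ≫ p) ((Scheme.Modules.pullback f).obj M) q Wy}
    (hx : ∀ (g : SecRing p c.V) (V : X.Opens) (_ : V = X.basicOpen (show Γ(X, c.V) from g))
      (h : V ≤ O), formsRes (f ≫ p) _ q Wx (f ⁻¹ᵁ V) ((f.preimage_mono h).trans hWx) x ∈
        c.forms M q (f ⁻¹ᵁ V) (f.preimage_mono (h.trans hO)))
    (hy : ∀ (g : SecRing p c.V) (V : X.Opens) (_ : V = X.basicOpen (show Γ(X, c.V) from g))
      (_ : (V : Set X).Nonempty) (h : V ≤ O),
      formsRes (f ≫ p) _ q Wy (f ⁻¹ᵁ V) ((f.preimage_mono h).trans hWy) y ∈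
        c'.forms M q (f ⁻¹ᵁ V) (f.preimage_mono (h.trans hO')))
    (hxy : ∀ (V : X.Opens) (_ : IsAffineOpen V) (h : V ≤ O) (_ : V ≤ D),
      formsRes (f ≫ p) _ q Wx (f ⁻¹ᵁ V) ((f.preimage_mono h).trans hWx) x =
        formsRes (f ≫ p) _ q Wy (f ⁻¹ᵁ V) ((f.preimage_mono h).trans hWy) y)
    {W : Y.Opens} (hW : IsAffineOpen W) (hWO : W ≤ f ⁻¹ᵁ O) :
    formsRes (f ≫ p) _ q Wx W (hWO.trans hWx) x = formsRes (f ≫ p) _ q Wy W (hWO.trans hWy) y := by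
  refine forms_eq_of_locally (hM.pullback f) hW fun w hw => ?_
  obtain ⟨g, V, hV, e, hwV, hle, hVO, hss, he⟩ :=
    c.exists_isStandardSmooth_isFrame hM (hO (hWO hw)) (hWO hw)
  have hVa : IsAffineOpen V := hV ▸ c.isAffineOpen.basicOpen _
  have hVne : (V : Set X).Nonempty := ⟨_, hwV⟩
  have hDV : X.basicOpen (show Γ(X, V) from secRingRes p c.V V hle c.t) ≤ V := X.basicOpen_le _
  have hDD : X.basicOpen (show Γ(X, V) from secRingRes p c.V V hle c.t) ≤ D := by
    refine (basicOpen_ringRes hle (show Γ(X, c.V) from c.t)).le.trans (inf_le_right.trans ?_)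
    rw [hD]
    exact inf_le_right
  have key := c.eq_of_mem_forms hf hM hu ht g hV hVne hle (hVO.trans hO') hss (hY V hVa hVne) he
    (hx g V hV hVO) (hy g V hV hVne hVO) rfl hDV (by
      rw [formsRes_formsRes, formsRes_formsRes]
      exact hxy _ (hVa.basicOpen _) (hDV.trans hVO) hDD)
  refine ⟨W ⊓ f ⁻¹ᵁ V, ⟨hw, hwV⟩, inf_le_left, ?_⟩
  have h1 := congrArg (formsRes (f ≫ p) _ q (f ⁻¹ᵁ V) (W ⊓ f ⁻¹ᵁ V) inf_le_right) key
  rw [formsRes_formsRes, formsRes_formsRes] at h1 ⊢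
  exact h1

end RootChart

variable [Fact ℓ.Prime] [CharP k ℓ] [IsIntegral X] [IsIntegral Y] [IsDominant f] [Smooth p]
  [IsAffineHom f] {M : X.Modules} {q : ℕ}

/-- If `X` is covered by charts on which the pullback of `α` extends across the zeros of `t`, then
the pullback of `α` extends to `Y`. -/
theorem exists_isPullbackForm [PerfectField k] (hf : IsSeparableMap f) (hM : IsLocallyFramed M)
    (hY : ∀ V : X.Opens, IsAffineOpen V → (V : Set X).Nonempty → IsIntegrallyClosed Γ(Y, f ⁻¹ᵁ V))
    {U D : X.Opens} (hDU : D ≤ U) (α : TwistedForms p M q U) {ι : Type*}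
    (c : ι → RootChart p f ℓ m) (hc : ∀ x : X, ∃ i, x ∈ (c i).V)
    (hu : ∀ i j, ∃ u : Γ(X, (c i).V ⊓ (c j).V)ˣ,
      ringRes inf_le_right (show Γ(X, (c j).V) from (c j).t) =
      u.val * ringRes inf_le_left (show Γ(X, (c i).V) from (c i).t)) (ht : ∀ i, (c i).t ≠ 0)
    (hD : ∀ i, X.basicOpen (show Γ(X, (c i).V) from (c i).t) = (c i).V ⊓ D)
    (ω : ∀ i, FormsOn (f ≫ p) ((Scheme.Modules.pullback f).obj M) q (f ⁻¹ᵁ (c i).V))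
    (hω : ∀ i, ω i ∈ (c i).forms M q (f ⁻¹ᵁ (c i).V) le_rfl)
    (hωα : ∀ i (V : AffineOpensIn U) (hV : V.1 ≤ (c i).V), V.1 ≤ D →
      formsRes (f ≫ p) _ q _ (f ⁻¹ᵁ V.1) (f.preimage_mono hV) (ω i) =
        formsPullback p f M q V.1 (f ⁻¹ᵁ V.1) le_rfl (α.1 V)) :
    ∃ β : TwistedForms (f ≫ p) ((Scheme.Modules.pullback f).obj M) q ⊤,
      IsPullbackForm p f α (restrictForms β (f ⁻¹ᵁ U) le_top) := by
  have hωmem (i) (V : X.Opens) (hV : V ≤ (c i).V) :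
      formsRes (f ≫ p) _ q _ (f ⁻¹ᵁ V) (f.preimage_mono hV) (ω i) ∈
        (c i).forms M q (f ⁻¹ᵁ V) (f.preimage_mono hV) :=
    (c i).formsRes_mem_forms le_rfl (f.preimage_mono hV) (hω i)
  obtain ⟨β, hβ⟩ := exists_twistedForms_of_cover (p := f ≫ p) (q := q) (hM.pullback f)
    (fun i => f ⁻¹ᵁ (c i).V)
    (top_unique fun y _ => Opens.mem_iSup.2 (hc (f y))) ω (fun i j W hW h h' =>
      (c i).formsRes_eq_of_mem_forms hf hM hY (hu i j) (ht i) (hD i) (O := (c i).V ⊓ (c j).V)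
        inf_le_left inf_le_right (f.preimage_mono inf_le_left) (f.preimage_mono inf_le_right)
        (fun _ V _ hV => hωmem i V (hV.trans inf_le_left))
        (fun _ V _ _ hV => hωmem j V (hV.trans inf_le_right))
        (fun V hVa hV hVD => (hωα i ⟨V, hVa, hVD.trans hDU⟩ (hV.trans inf_le_left) hVD).trans
          (hωα j ⟨V, hVa, hVD.trans hDU⟩ (hV.trans inf_le_right) hVD).symm)
        hW (le_inf h h'))
  -- near a point of the preimage of `V`, the form on a chart and the pullback of `α` on `V` are
  -- both spanned by wedge products of differentials of the roots, and they agree over `D`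
  refine ⟨β, fun V W h => ?_⟩
  refine forms_eq_of_locally (hM.pullback f) W.2.1 fun w hw => ?_
  obtain ⟨i, hi⟩ := hc (f w)
  obtain ⟨W', hW', hwW', hle⟩ := exists_isAffineOpen_mem_and_subset
    (U := W.1 ⊓ f ⁻¹ᵁ ((c i).V ⊓ V.1)) (x := w) ⟨hw, hi, h hw⟩
  have hleW : W' ≤ W.1 := fun a ha => (hle ha).1
  have hleO : W' ≤ f ⁻¹ᵁ ((c i).V ⊓ V.1) := fun a ha => (hle ha).2
  refine ⟨W', hwW', hleW, ?_⟩
  have h1 := β.2 ⟨W.1, W.2.1, le_top⟩ ⟨W', hW', le_top⟩ hleW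
  refine h1.trans ((hβ i W' hW' (hleO.trans (f.preimage_mono inf_le_left))).trans ?_)
  rw [formsRes_formsPullback, ← formsRes_formsPullback p M q f le_rfl
    (hleO.trans (f.preimage_mono inf_le_right))]
  refine (c i).formsRes_eq_of_mem_forms hf hM hY (hu i i) (ht i) (hD i) (O := (c i).V ⊓ V.1)
    inf_le_left inf_le_left (f.preimage_mono inf_le_left) (f.preimage_mono inf_le_right)
    (fun _ V' _ hV => hωmem i V' (hV.trans inf_le_left)) (fun g V' hV' hne hV => ?_)
    (fun V' hV'a hV' hV'D => ?_) hW' hleO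
  · have : Nonempty (f ⁻¹ᵁ V' : Y.Opens) := ⟨_, genericPoint_mem_preimage f hne⟩
    have : Nontrivial (SecRing (f ≫ p) (f ⁻¹ᵁ V')) :=
      inferInstanceAs (Nontrivial Γ(Y, f ⁻¹ᵁ V'))
    obtain ⟨ξ, hξ, h2⟩ := (c i).exists_formsPullback_eq_smul (hV.trans inf_le_left)
      ((c i).generatesUpToInverses_of_basicOpen g hV' _)
      (formsRes p M q V.1 V' (hV.trans inf_le_right) (α.1 V))
    rw [formsRes_formsPullback, ← formsPullback_formsRes p M q f le_rfl (hV.trans inf_le_right), h2]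
    exact Submodule.smul_mem _ _ hξ
  · rw [formsRes_formsPullback, ← formsPullback_formsRes p M q f le_rfl (hV'.trans inf_le_right)]
    refine (hωα i ⟨V', hV'a, hV'D.trans hDU⟩ (hV'.trans inf_le_left) hV'D).trans ?_
    exact congrArg _ (α.2 V ⟨V', hV'a, hV'D.trans hDU⟩ (hV'.trans inf_le_right)).symm

/-- The pullback of a nonzero form along a separable map is nonzero. -/
theorem IsPullbackForm.ne_zero (hf : IsSeparableMap f) (hM : IsLocallyFramed M) {U : X.Opens}
    {α : TwistedForms p M q U} (hα : α ≠ 0)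
    {γ : TwistedForms (f ≫ p) ((Scheme.Modules.pullback f).obj M) q (f ⁻¹ᵁ U)}
    (hγ : IsPullbackForm p f α γ) : γ ≠ 0 := by
  rintro rfl
  refine hα (Subtype.ext (funext fun V => ?_))
  refine forms_eq_zero_of_locally hM V.2.1 fun x hx => ?_
  obtain ⟨O, hxO, e, he⟩ := hM x
  obtain ⟨g, hxg, hgO, hss⟩ := exists_basicOpen_isStandardSmooth p V.2.1 hx hxO
  refine ⟨X.basicOpen g, hxg, X.basicOpen_le g, ?_⟩
  refine formsPullback_injective p f hf (V.2.1.basicOpen g) ⟨x, hxg⟩ (he.res hgO) ?_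
  rw [map_zero]
  let V' : AffineOpensIn U := ⟨X.basicOpen g, V.2.1.basicOpen g, (X.basicOpen_le g).trans V.2.2⟩
  refine (congrArg _ (α.2 V V' (X.basicOpen_le g))).trans ?_
  exact (hγ V' ⟨f ⁻¹ᵁ V'.1, V'.2.1.preimage f, f.preimage_mono V'.2.2⟩ le_rfl).symm

end Regularization

end

theorem mainTheorem5 (ℓ : ℕ) [Fact ℓ.Prime] (k : Type u) [Field k] [CharP k ℓ] [PerfectField k]
    (X : Scheme.{u}) (p : X ⟶ Spec (.of k)) [IsIntegral X] [Smooth p] (hp : IsProjectiveOver p)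
    (M : X.Modules) (hM : IsLineBundle M) (q : ℕ) (hq : 1 ≤ q)
    (U : X.Opens) (hU : Dense (U : Set X)) (α : TwistedForms p M q U) (hα : α ≠ 0) :
    ∃ (Y : Scheme.{u}) (f : Y ⟶ X) (_ : IsIntegral Y) (_ : IsDominant f),
      IsFinite f ∧ IsSeparableMap f ∧ IsNormalScheme Y ∧
      ∃ β : TwistedForms (f ≫ p) ((Scheme.Modules.pullback f).obj M) q ⊤,
        IsPullbackForm p f α (restrictForms β (f ⁻¹ᵁ U) le_top) ∧
        restrictForms β (f ⁻¹ᵁ U) le_top ≠ 0 := by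
  have hM' := hM.isLocallyFramed
  obtain ⟨n, V, t, D, hVa, hcov, hDU, hDne, hD, hu⟩ := hp.exists_divisor (U := U) hU.nonempty
  -- roots are adjoined only for the nonempty members of the cover, on which `t` is nonzero
  let I := {j : Fin n // (V j : Set X).Nonempty}
  have ht (i : I) : t i.1 ≠ 0 := fun h0 => by
    have h1 := hD i.1
    rw [h0, Scheme.basicOpen_zero] at h1
    have h2 : genericPoint X ∈ V i.1 ⊓ D := ⟨genericPoint_mem i.2, genericPoint_mem hDne⟩
    rw [← h1] at h2
    exact h2
  have hft (i : I) : ∃ s : Finset (SecRing p (V i.1)),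
      Algebra.adjoin k (s : Set (SecRing p (V i.1))) = ⊤ := by
    have := smooth_secRing p (hVa i.1)
    have : Algebra.FiniteType k (SecRing p (V i.1)) := inferInstance
    exact this.out
  choose z hz using hft
  have hle (i : I) : X.basicOpen (t i.1) ≤ V i.1 := X.basicOpen_le _
  let a (i : I) : AffineOpensIn U :=
    ⟨X.basicOpen (t i.1), (hVa i.1).basicOpen _, (hD i.1).le.trans (inf_le_right.trans hDU)⟩
  -- `t ^ r * α` extends from the complement of the divisor to `V`
  choose r η hη using fun i : I => (formsRes_isLocalized p q hM' (hVa i.1) (t i.1)).2 (α.1 (a i))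
  -- pulling back to the cover gains the factor `t ^ (m * q)`, and `m ≤ m * q` as `q ≥ 1`
  obtain ⟨m, hm⟩ : ∃ m, ∀ i, r i ≤ m := by
    have := Fintype.ofFinite I
    exact ⟨Finset.univ.sup r, fun i => Finset.le_sup (Finset.mem_univ i)⟩
  obtain ⟨Y, f, _, _, hfin, hsep, hnor, hYn, hroots⟩ := exists_finite_separable_cover p ℓ
    (fun i : I => V i.1) (fun i => hVa i.1) (fun i => i.2) (κ := fun i => z i) (fun i j => j.1)
    (fun i => t i.1 ^ m) (fun i => by
      have : Nonempty (V i.1) := i.2.to_subtype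
      exact pow_ne_zero m (ht i))
  choose w hw using hroots
  let c (i : I) : RootChart p f ℓ m :=
    { V := V i.1
      isAffineOpen := hVa i.1
      t := t i.1
      κ := z i
      z := fun j => j.1
      adjoin_eq_top := (congrArg (Algebra.adjoin k) Subtype.range_coe).trans (hz i)
      w := w i
      pow_eq := fun j => by
        have h1 := hw i j
        rw [Scheme.Hom.app_eq_appLE] at h1
        exact h1 }
  have hnt (i : I) : Nontrivial (SecRing (f ≫ p) (f ⁻¹ᵁ (c i).V)) := by
    have : Nonempty (f ⁻¹ᵁ V i.1 : Y.Opens) := ⟨_, genericPoint_mem_preimage f i.2⟩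
    exact inferInstanceAs (Nontrivial Γ(Y, f ⁻¹ᵁ V i.1))
  have hex (i : I) := (c i).exists_mem_forms_formsRes_eq (M := M) (q := q) rfl (hle i)
    (α.1 (a i)) ((hm i).trans (Nat.le_mul_of_pos_right m hq)) (hη i)
  choose ω hω hωα using hex
  obtain ⟨β, hβ⟩ := exists_isPullbackForm hsep hM' hYn hDU α c
    (fun x => by obtain ⟨j, hj⟩ := hcov x; exact ⟨⟨j, ⟨x, hj⟩⟩, hj⟩)
    (fun i j => hu i.1 j.1) ht (fun i => hD i.1) ω hω (fun i W hW hWD => by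
      have hWa : W.1 ≤ (a i).1 := (le_inf hW hWD).trans (hD i.1).ge
      have h1 := congrArg (formsRes (f ≫ p) _ q _ (f ⁻¹ᵁ W.1) (f.preimage_mono hWa)) (hωα i)
      rw [formsRes_formsRes, formsRes_formsPullback,
        ← formsPullback_formsRes p M q f le_rfl hWa, α.2 (a i) W hWa] at h1
      exact h1)
  exact ⟨Y, f, inferInstance, inferInstance, hfin, hsep, hnor, β, hβ, hβ.ne_zero hsep hM' hα⟩
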